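/- Let $\Omega\subset\mathbb R^3$ be a bounded open set with smooth boundary $\Gamma=\partial\Omega$, with outward unit normal $\vec n$ and surface measure $dS$, and for $\varepsilon>0$ let $\omega_\varepsilon=\{x-\sigma\vec n(x): x\in\Gamma,\ \sigma\in[0,\varepsilon)\}$ (for small $\varepsilon$ this is a one-sided neighbourhood of $\Gamma$ in $\overline\Omega$). Let $a\in C^1(\overline\Omega)$ with $0<a_0\le a(x)\le a_1$ on $\overline\Omega$. Let $f,g\in C^2(\mathbb R)$ be such that, for $j=f$ and $j=g$, $\limsup_{|s|\to\infty}j(s)/s\le 0$ and $|j|+|j'|+|j''|\le K$ on $\mathbb R$ for some constant $K>0$. Let $H^1(\Omega)$ be the real Sobolev space with its usual norm, $H^{-1}(\Omega)$ its dual, and $\gamma:H^1(\Omega)\to L^2(\Gamma)$ the trace operator. For $u,w,\varphi\in H^1(\Omega)$ and $\varepsilon>0$ define elements of $H^{-1}(\Omega)$ by $$\langle\Lambda u,\varphi\rangle=\int_\Omega a\nabla u\cdot\nabla\varphi\,dx+\int_\Omega u\varphi\,dx,\qquad \langle\tilde F_\varepsilon(u),\varphi\rangle=\int_\Omega f(u)\varphi\,dx+\frac1\varepsilon\int_{\Omega\cap\omega_\varepsilon}g(u)\varphi\,dx,$$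 $$\langle\tilde F_0(u),\varphi\rangle=\int_\Omega f(u)\varphi\,dx+\int_\Gamma g(\gamma u)\,\gamma\varphi\,dS,\qquad \langle D\tilde F_0(u)w,\varphi\rangle=\int_\Omega f'(u)w\varphi\,dx+\int_\Gamma g'(\gamma u)\,\gamma w\,\gamma\varphi\,dS .$$ Let $\mathcal E_\varepsilon=\{u\in H^1(\Omega):\Lambda u=\tilde F_\varepsilon(u)\}$ for $\varepsilon\ge 0$. Thus $\mathcal E_\varepsilon$, $\varepsilon>0$, is the set of weak solutions of $-\mathrm{div}(a\nabla u)+u=f(u)+\frac1\varepsilon\chi_{\omega_\varepsilon}g(u)$ in $\Omega$, $a\,\partial u/\partial\vec n=0$ on $\Gamma$, and $\mathcal E_0$ is the set of weak solutions of $-\mathrm{div}(a\nabla u)+u=f(u)$ in $\Omega$, $a\,\partial u/\partial\vec n=g(u)$ on $\Gamma$. **Theorem.** Let $u_0^*\in\mathcal E_0$ be such that $0\notin\sigma(\Lambda-D\tilde F_0(u_0^*))$, that is, $\Lambda-D\tilde F_0(u_0^*):H^1(\Omega)\to H^{-1}(\Omega)$ has a bounded inverse. Then there are $\varepsilon_0>0$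 and $\delta>0$ such that, for each $\varepsilon\in(0,\varepsilon_0]$, there is exactly one $u_\varepsilon^*\in\mathcal E_\varepsilon$ with $\|u_\varepsilon^*-u_0^*\|_{H^1(\Omega)}\le\delta$. Furthermore, $u_\varepsilon^*\to u_0^*$ in $H^1(\Omega)$ as $\varepsilon\to0^+$. In particular, if $0\notin\sigma(\Lambda-D\tilde F_0(u))$ for every $u\in\mathcal E_0$, then the family $\{\mathcal E_\varepsilon\}$ is lower semicontinuous at $\varepsilon=0$: $$\sup_{u\in\mathcal E_0}\ \inf_{v\in\mathcal E_\varepsilon}\|u-v\|_{H^1(\Omega)}\to0\quad\text{as }\varepsilon\to0^+ .$$ -/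

import Mathlib

open MeasureTheory Filter Topology Set
open scoped ContDiff ENNReal RealInnerProductSpace

noncomputable section

namespace Concentrated

/-- Three dimensional Euclidean space. -/
abbrev E3 : Type := EuclideanSpace ℝ (Fin 3)

/-! ### The domain, its boundary and the boundary strip -/

/-- `ρ` is a smooth defining function of `Ω` in the open set `U`: its gradient does not vanish in
`U`, and `Ω ∩ U = {ρ < 0}`. (Then `∂Ω ∩ U = {ρ = 0}`.) -/
structure IsDefiningFunction (Ω U : Set E3) (ρ : E3 → ℝ) : Prop where
  isOpen : IsOpen U
  smooth : ContDiffOn ℝ ∞ ρ U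
  gradient_ne_zero : ∀ y ∈ U, gradient ρ y ≠ 0
  mem_iff : ∀ y ∈ U, y ∈ Ω ↔ ρ y < 0

/-- A bounded open set with smooth boundary (lying locally on one side of it). -/
structure IsSmoothBoundedDomain (Ω : Set E3) : Prop where
  isOpen : IsOpen Ω
  isBounded : Bornology.IsBounded Ω
  smooth_frontier : ∀ x ∈ frontier Ω, ∃ (U : Set E3) (ρ : E3 → ℝ),
    x ∈ U ∧ IsDefiningFunction Ω U ρ

/-- `n` is the outward unit normal of `Ω` at the boundary point `x`. -/
def IsOutwardNormal (Ω : Set E3) (x n : E3) : Prop :=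
  x ∈ frontier Ω ∧ ∃ (U : Set E3) (ρ : E3 → ℝ),
    x ∈ U ∧ IsDefiningFunction Ω U ρ ∧ n = ‖gradient ρ x‖⁻¹ • gradient ρ x

/-- The strip `ω_ε = {x - σ n(x) : x ∈ ∂Ω, σ ∈ [0, ε)}`. -/
def strip (Ω : Set E3) (ε : ℝ) : Set E3 :=
  {y | ∃ x n : E3, IsOutwardNormal Ω x n ∧ ∃ σ ∈ Ico 0 ε, y = x - σ • n}

/-- Surface measure on the boundary: the two dimensional Hausdorff measure, normalised so that it
is the usual area. -/
def surface (Ω : Set E3) : Measure E3 :=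
  (Measure.euclideanHausdorffMeasure 2 : Measure E3).restrict (frontier Ω)

/-! ### The Sobolev space `H¹(Ω)` -/

/-- `G` is the weak gradient of `u` in `Ω`. -/
def IsWeakGradient (Ω : Set E3) (u : E3 → ℝ) (G : E3 → E3) : Prop :=
  ∀ ψ : E3 → ℝ, ContDiff ℝ ∞ ψ → HasCompactSupport ψ → tsupport ψ ⊆ Ω → ∀ v : E3,
    ∫ x in Ω, u x * fderiv ℝ ψ x v = - ∫ x in Ω, ⟪G x, v⟫ * ψ x

lemma memLp_fderiv {ψ : E3 → ℝ} (hψ : ContDiff ℝ ∞ ψ) (hc : HasCompactSupport ψ) (v : E3)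
    (μ : Measure E3) [IsFiniteMeasureOnCompacts μ] (p : ℝ≥0∞) :
    MemLp (fun x => fderiv ℝ ψ x v) p μ := by
  refine Continuous.memLp_of_hasCompactSupport ?_ ?_
  · exact (hψ.continuous_fderiv (by simp)).clm_apply continuous_const
  · exact hc.fderiv_apply (𝕜 := ℝ) v

/-- The Hilbert space `H¹(Ω)`, realised as the space of all pairs `(u, ∇u)` with `u ∈ L²(Ω)` and
weak gradient `∇u ∈ L²(Ω)³`. Its norm is given by `‖u‖² = ∫_Ω |u|² + ∫_Ω |∇u|²`. -/
def sobolevSpace (Ω : Set E3) : Submodule ℝ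
    (WithLp 2 (Lp ℝ 2 (volume.restrict Ω) × Lp E3 2 (volume.restrict Ω))) where
  carrier := {w | IsWeakGradient Ω w.fst w.snd}
  zero_mem' := by
    intro ψ _ _ _ v
    have h1 : (fun x => ((0 : Lp ℝ 2 (volume.restrict Ω)) : E3 → ℝ) x * fderiv ℝ ψ x v)
        =ᵐ[volume.restrict Ω] fun _ => 0 := by
      filter_upwards [Lp.coeFn_zero ℝ 2 (volume.restrict Ω)] with x hx
      rw [hx]
      simp
    have h2 : (fun x => ⟪((0 : Lp E3 2 (volume.restrict Ω)) : E3 → E3) x, v⟫ * ψ x)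
        =ᵐ[volume.restrict Ω] fun _ => 0 := by
      filter_upwards [Lp.coeFn_zero E3 2 (volume.restrict Ω)] with x hx
      rw [hx]
      simp
    simp only [WithLp.zero_fst, WithLp.zero_snd]
    rw [integral_congr_ae h1, integral_congr_ae h2]
    simp
  add_mem' := by
    intro w z hw hz ψ hψ hc hs v
    have hd := memLp_fderiv hψ hc v (volume.restrict Ω) 2
    have hψ2 : MemLp ψ 2 (volume.restrict Ω) :=
      hψ.continuous.memLp_of_hasCompactSupport hc
    have i1 : ∀ u : Lp ℝ 2 (volume.restrict Ω),
        Integrable (fun x => u x * fderiv ℝ ψ x v) (volume.restrict Ω) :=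
      fun u => (Lp.memLp u).integrable_mul hd
    have i2 : ∀ G : Lp E3 2 (volume.restrict Ω),
        Integrable (fun x => ⟪G x, v⟫ * ψ x) (volume.restrict Ω) :=
      fun G => ((Lp.memLp G).inner_const v).integrable_mul hψ2
    have h1 : (fun x => (w.fst + z.fst : Lp ℝ 2 (volume.restrict Ω)) x * fderiv ℝ ψ x v)
        =ᵐ[volume.restrict Ω]
        fun x => w.fst x * fderiv ℝ ψ x v + z.fst x * fderiv ℝ ψ x v := by
      filter_upwards [Lp.coeFn_add w.fst z.fst] with x hx
      rw [hx, Pi.add_apply, add_mul]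
    have h2 : (fun x => ⟪(w.snd + z.snd : Lp E3 2 (volume.restrict Ω)) x, v⟫ * ψ x)
        =ᵐ[volume.restrict Ω]
        fun x => ⟪w.snd x, v⟫ * ψ x + ⟪z.snd x, v⟫ * ψ x := by
      filter_upwards [Lp.coeFn_add w.snd z.snd] with x hx
      rw [hx, Pi.add_apply, inner_add_left, add_mul]
    simp only [WithLp.add_fst, WithLp.add_snd]
    rw [integral_congr_ae h1, integral_congr_ae h2, integral_add (i1 _) (i1 _),
      integral_add (i2 _) (i2 _), hw ψ hψ hc hs v, hz ψ hψ hc hs v]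
    ring
  smul_mem' := by
    intro c w hw ψ hψ hc hs v
    have h1 : (fun x => (c • w.fst : Lp ℝ 2 (volume.restrict Ω)) x * fderiv ℝ ψ x v)
        =ᵐ[volume.restrict Ω] fun x => c * (w.fst x * fderiv ℝ ψ x v) := by
      filter_upwards [Lp.coeFn_smul c w.fst] with x hx
      simp [hx, mul_assoc]
    have h2 : (fun x => ⟪(c • w.snd : Lp E3 2 (volume.restrict Ω)) x, v⟫ * ψ x)
        =ᵐ[volume.restrict Ω] fun x => c * (⟪w.snd x, v⟫ * ψ x) := by
      filter_upwards [Lp.coeFn_smul c w.snd] with x hx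
      simp [hx, real_inner_smul_left, mul_assoc]
    simp only [WithLp.smul_fst, WithLp.smul_snd]
    rw [integral_congr_ae h1, integral_congr_ae h2, integral_const_mul, integral_const_mul,
      hw ψ hψ hc hs v]
    ring

/-- `H¹(Ω)` as a type. -/
abbrev H1 (Ω : Set E3) : Type := sobolevSpace Ω

variable {Ω : Set E3}

/-- The function underlying an element of `H¹(Ω)`. -/
def H1.val (u : H1 Ω) : Lp ℝ 2 (volume.restrict Ω) := u.1.fst

/-- The weak gradient of an element of `H¹(Ω)`. -/
def H1.grad (u : H1 Ω) : Lp E3 2 (volume.restrict Ω) := u.1.snd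

/-! ### The trace operator -/

variable (Ω) in
/-- Smooth compactly supported functions on `ℝ³` that are square integrable on the boundary of `Ω`.
The last condition is automatic if the boundary is compact and smooth, as it has finite area. -/
def smoothFunctions : Submodule ℝ (E3 → ℝ) where
  carrier := {φ | ContDiff ℝ ∞ φ ∧ HasCompactSupport φ ∧ MemLp φ 2 (surface Ω)}
  zero_mem' := ⟨contDiff_const, HasCompactSupport.zero, MemLp.zero⟩
  add_mem' := fun h k => ⟨h.1.add k.1, h.2.1.add k.2.1, h.2.2.add k.2.2⟩
  smul_mem' := fun c _ h => ⟨h.1.const_smul c, h.2.1.smul_left (f := fun _ => c),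
    h.2.2.const_smul c⟩

lemma memLp_val (φ : smoothFunctions Ω) :
    MemLp φ.1 2 (volume.restrict Ω) :=
  φ.2.1.continuous.memLp_of_hasCompactSupport φ.2.2.1

lemma memLp_gradient (φ : smoothFunctions Ω) :
    MemLp (gradient φ.1) 2 (volume.restrict Ω) := by
  refine Continuous.memLp_of_hasCompactSupport ?_ ?_
  · exact (InnerProductSpace.toDual ℝ E3).symm.continuous.comp
      (φ.2.1.continuous_fderiv (by simp))
  · exact (φ.2.2.1.fderiv (𝕜 := ℝ)).comp_left (map_zero _)

lemma isWeakGradient (φ : smoothFunctions Ω) :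
    IsWeakGradient Ω φ.1 (gradient φ.1) := by
  intro ψ hψ hc hs v
  have hgrad : ∀ x, ⟪gradient φ.1 x, v⟫ = fderiv ℝ φ.1 x v := by
    intro x
    simp [gradient]
  have hz : ∀ x ∉ Ω, ψ x = 0 := fun x hx => image_eq_zero_of_notMem_tsupport fun h => hx (hs h)
  have hz' : ∀ x ∉ Ω, fderiv ℝ ψ x = 0 := fun x hx =>
    image_eq_zero_of_notMem_tsupport fun h => hx (hs (tsupport_fderiv_subset ℝ h))
  rw [setIntegral_eq_integral_of_forall_compl_eq_zero (fun x hx => by simp [hz' x hx]),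
    setIntegral_eq_integral_of_forall_compl_eq_zero (fun x hx => by simp [hz x hx])]
  simp only [hgrad]
  have m1 := φ.2.1.continuous.memLp_of_hasCompactSupport (μ := volume) (p := 2) φ.2.2.1
  have m2 := hψ.continuous.memLp_of_hasCompactSupport (μ := volume) (p := 2) hc
  have m3 := memLp_fderiv φ.2.1 φ.2.2.1 v volume 2
  have m4 := memLp_fderiv hψ hc v volume 2
  exact integral_mul_fderiv_eq_neg_fderiv_mul_of_integrable (m3.integrable_mul m2)
    (m1.integrable_mul m4) (m1.integrable_mul m2) (fun x _ => φ.2.1.differentiable (by simp) x)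
    (fun x _ => hψ.differentiable (by simp) x)

/-- Restriction of smooth functions to `Ω`, as elements of `H¹(Ω)`. -/
def toH1 : smoothFunctions Ω →ₗ[ℝ] H1 Ω where
  toFun φ := ⟨WithLp.toLp 2 ((memLp_val φ).toLp φ.1, (memLp_gradient φ).toLp (gradient φ.1)), by
    intro ψ hψ hc hs v
    have h1 : (fun x => ((memLp_val φ).toLp φ.1) x * fderiv ℝ ψ x v)
        =ᵐ[volume.restrict Ω] fun x => φ.1 x * fderiv ℝ ψ x v := by
      filter_upwards [(memLp_val φ).coeFn_toLp] with x hx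
      rw [hx]
    have h2 : (fun x => ⟪((memLp_gradient φ).toLp (gradient φ.1)) x, v⟫ * ψ x)
        =ᵐ[volume.restrict Ω] fun x => ⟪gradient φ.1 x, v⟫ * ψ x := by
      filter_upwards [(memLp_gradient φ).coeFn_toLp] with x hx
      rw [hx]
    exact (integral_congr_ae h1).trans
      ((isWeakGradient φ ψ hψ hc hs v).trans (congrArg Neg.neg (integral_congr_ae h2).symm))⟩
  map_add' φ χ := by
    have h : gradient (φ.1 + χ.1) = gradient φ.1 + gradient χ.1 := by
      funext x
      simp only [gradient, Pi.add_apply]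
      rw [fderiv_add (φ.2.1.differentiable (by simp) x) (χ.2.1.differentiable (by simp) x),
        map_add]
    apply Subtype.ext
    simp only [Submodule.coe_add, h, MemLp.toLp_add (memLp_val φ) (memLp_val χ),
      MemLp.toLp_add (memLp_gradient φ) (memLp_gradient χ)]
    rfl
  map_smul' c φ := by
    have h : gradient (c • φ.1) = c • gradient φ.1 := by
      funext x
      simp only [gradient, Pi.smul_apply]
      rw [fderiv_const_smul (φ.2.1.differentiable (by simp) x), map_smulₛₗ]
      rfl
    apply Subtype.ext
    simp only [Submodule.coe_smul, h, MemLp.toLp_const_smul c (memLp_val φ),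
      MemLp.toLp_const_smul c (memLp_gradient φ)]
    rfl

/-- Restriction of smooth functions to the boundary, as elements of `L²(∂Ω)`. -/
def toBoundary : smoothFunctions Ω →ₗ[ℝ] Lp ℝ 2 (surface Ω) where
  toFun φ := φ.2.2.2.toLp φ.1
  map_add' φ χ := MemLp.toLp_add φ.2.2.2 χ.2.2.2
  map_smul' c φ := MemLp.toLp_const_smul c φ.2.2.2

/-- The trace operator `γ : H¹(Ω) → L²(∂Ω)`: the continuous extension of the restriction of smooth
functions to the boundary. -/
def trace : H1 Ω →L[ℝ] Lp ℝ 2 (surface Ω) :=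
  LinearMap.extendOfNorm toBoundary toH1

/-! ### The operators. Elements of the dual space `H⁻¹(Ω)` are given through their pairing with
`φ ∈ H¹(Ω)`. -/

/-- `⟨Λ u, φ⟩ = ∫_Ω a ∇u·∇φ + ∫_Ω u φ`. -/
def Lam (a : E3 → ℝ) (u φ : H1 Ω) : ℝ :=
  (∫ x in Ω, a x * ⟪u.grad x, φ.grad x⟫) + ∫ x in Ω, u.val x * φ.val x

/-- `⟨F̃_ε(u), φ⟩ = ∫_Ω f(u) φ + (1/ε) ∫_{ω_ε} g(u) φ`, for `ε > 0`. -/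
def Fconc (f g : ℝ → ℝ) (ε : ℝ) (u φ : H1 Ω) : ℝ :=
  (∫ x in Ω, f (u.val x) * φ.val x)
    + 1 / ε * ∫ x in Ω ∩ strip Ω ε, g (u.val x) * φ.val x

/-- `⟨F̃₀(u), φ⟩ = ∫_Ω f(u) φ + ∫_Γ g(γ u) γ φ dS`. -/
def Flim (f g : ℝ → ℝ) (u φ : H1 Ω) : ℝ :=
  (∫ x in Ω, f (u.val x) * φ.val x)
    + ∫ x, g (trace u x) * trace φ x ∂(surface Ω)

/-- The differential of `F̃₀`:
`⟨DF̃₀(u) w, φ⟩ = ∫_Ω f'(u) w φ + ∫_Γ g'(γ u) γ w γ φ dS`. -/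
def DFlim (f g : ℝ → ℝ) (u w φ : H1 Ω) : ℝ :=
  (∫ x in Ω, deriv f (u.val x) * w.val x * φ.val x)
    + ∫ x, deriv g (trace u x) * trace w x * trace φ x ∂(surface Ω)

/-- `0 = Λ u - F̃_ε(u)`: the solutions of the concentrated problem
`-div(a∇u) + u = f(u) + (1/ε) χ_{ω_ε} g(u)` in `Ω`, `a ∂u/∂n = 0` on `∂Ω`. -/
def concSolutions (Ω : Set E3) (a : E3 → ℝ) (f g : ℝ → ℝ) (ε : ℝ) : Set (H1 Ω) :=
  {u | ∀ φ : H1 Ω, Lam a u φ - Fconc f g ε u φ = 0}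

/-- `0 = Λ u - F̃₀(u)`: the solutions of the limit problem
`-div(a∇u) + u = f(u)` in `Ω`, `a ∂u/∂n = g(u)` on `∂Ω`. -/
def limSolutions (Ω : Set E3) (a : E3 → ℝ) (f g : ℝ → ℝ) : Set (H1 Ω) :=
  {u | ∀ φ : H1 Ω, Lam a u φ - Flim f g u φ = 0}

/-- The linearization `Λ - DF̃₀(u)`, an operator from `H¹(Ω)` to `H⁻¹(Ω)`. -/
def linearization (a : E3 → ℝ) (f g : ℝ → ℝ) (u w φ : H1 Ω) : ℝ :=
  Lam a w φ - DFlim f g u w φ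

/-- `R` is the resolvent `(T - z)⁻¹`, a bounded operator from `H⁻¹(Ω)` to `H¹(Ω)`, of the
operator `T : H¹(Ω) → H⁻¹(Ω)`, where `w ∈ H¹(Ω)` is identified with the functional
`φ ↦ ∫_Ω w φ` in `H⁻¹(Ω)`. -/
def IsResolvent (T : H1 Ω → H1 Ω → ℝ) (z : ℝ) (R : StrongDual ℝ (H1 Ω) →L[ℝ] H1 Ω) : Prop :=
  (∀ (l : StrongDual ℝ (H1 Ω)) (φ : H1 Ω),
    T (R l) φ - z * ∫ x in Ω, (R l).val x * φ.val x = l φ) ∧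
  ∀ (w : H1 Ω) (l : StrongDual ℝ (H1 Ω)),
    (∀ φ : H1 Ω, T w φ - z * ∫ x in Ω, w.val x * φ.val x = l φ) → R l = w

/-- The (real points of the) spectrum of an operator `T` in `H⁻¹(Ω)` with domain `H¹(Ω)`. -/
def opSpectrum (T : H1 Ω → H1 Ω → ℝ) : Set ℝ :=
  {z | ¬ ∃ R : StrongDual ℝ (H1 Ω) →L[ℝ] H1 Ω, IsResolvent T z R}

/-! ### Hypotheses on the nonlinearities, and lower semicontinuity -/

/-- `j` is of class `C²`, dissipative, and bounded together with its first two derivatives. -/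
structure IsAdmissible (j : ℝ → ℝ) : Prop where
  contDiff : ContDiff ℝ 2 j
  dissipative : limsup (fun s : ℝ => ((j s / s : ℝ) : EReal)) (Bornology.cobounded ℝ) ≤ 0
  bounded : ∃ K > 0, ∀ s, |j s| + |deriv j s| + |deriv (deriv j) s| ≤ K

/-- The family `S ε`, `ε > 0`, is lower semicontinuous at `ε = 0`, where its member is `S₀`:
`sup_{u ∈ S₀} dist (u, S ε) → 0` as `ε → 0⁺`. -/
def LowerSemicontinuousAtZero {X : Type*} [PseudoEMetricSpace X] (S : ℝ → Set X)
    (S₀ : Set X) : Prop :=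
  Tendsto (fun ε => ⨆ u ∈ S₀, Metric.infEDist u (S ε)) (𝓝[>] 0) (𝓝 0)

end Concentrated

end

/-!
A nondegenerate solution of the limit problem persists because the concentrated problem is, near
it, a small perturbation of the limit problem: in the dual of `H¹(Ω)`, the operators
`u ↦ Λ u - F_ε(u)` are close at `u₀` to the limit operator, and their increments near `u₀` are close
to those of its linearization, uniformly for small `ε`. If `R` inverts the linearization, then
`u ↦ u - R (Λ u - F_ε(u))` is a contraction of a fixed small ball, whose fixed point is the solution
sought (`exists_unique_zero_near`, `exists_unique_solution_near`). What has to be shown is the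
convergence of the measures `ε⁻¹ dx` on the strips to the surface measure, in a sense strong enough
for this.

*Geometry.* In normal coordinates `(x, σ) ↦ x - σ n(x)`, Lebesgue measure near the boundary is
comparable with the product of surface measure and `dσ`, with constants which tend to `1` as the
layer gets thinner (`exists_restrict_strip_le`). No area or change of variables formula is needed:
near a boundary point the normal coordinates are, up to a factor near `1`, at the same distances as
those of the half space bounded by the tangent plane, and both Lebesgue and surface measure are
Hausdorff measures, so they only depend on distances, up to powers of that factor.

*Traces.* Applying the fundamental theorem of calculus along normals to `φ²` gives the trace
inequality `‖B φ‖² ≤ C ‖φ‖_{L²} ‖φ‖_{H¹}`, where `B` is the restriction to the boundary or to a strip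
with its normalised measure, and `C` does not depend on the width (`exists_trace_bound`). Smooth
functions are dense in `H¹(Ω)`, by mollification along interior cones (`denseRange_toH1`), so the
inequality holds on `H¹(Ω)` (`exists_isTrace`). The same mollifications give Rellich's theorem
(`exists_finite_net`).

*Superposition operators.* The nonlinearities are bounded in `C²`, and the remainder of
`u ↦ j(u)`, tested with `p`, is bounded by integrals of `min(1, |B z|) |B w| |B p|`. These are small
compared with `‖w‖ ‖p‖` if `z` is small in `H¹(Ω)`, uniformly in `B`
(`exists_integral_min_mul_le`): by Rellich's theorem and the interpolated trace inequality, `B w` is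
close in `L²` to the trace of one of finitely many smooth functions, which are bounded. Thus
compactness replaces Sobolev embeddings of the traces. For smooth `u` the forms with weights `j(u)`
and `j'(u)` converge by the comparison of measures (`exists_abs_integral_strip_sub_le`), and density
extends this to all `u` (`TracesConverge`).

*Lower semicontinuity.* Since `Λ` is coercive and the right-hand side of the equation is bounded,
the set of solutions of the limit problem is bounded; testing the difference of two solutions with
itself and using Rellich's theorem once more, it is precompact (`totallyBounded_solutions`). A
finite net of limit solutions, each of which persists, gives lower semicontinuity
(`lowerSemicontinuousAtZero_of_totallyBounded`).
-/

open MeasureTheory Filter Topology Set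
open scoped ContDiff ENNReal RealInnerProductSpace

noncomputable section

namespace Concentrated

/-! ### Defining functions and the outward normal -/

variable {Ω U : Set E3} {ρ : E3 → ℝ}

namespace IsDefiningFunction

lemma contDiffAt (h : IsDefiningFunction Ω U ρ) {x : E3} (hx : x ∈ U) : ContDiffAt ℝ ∞ ρ x :=
  h.smooth.contDiffAt (h.isOpen.mem_nhds hx)

lemma hasStrictFDerivAt (h : IsDefiningFunction Ω U ρ) {x : E3} (hx : x ∈ U) :
    HasStrictFDerivAt ρ (innerSL ℝ (gradient ρ x)) x := by
  have e : innerSL ℝ (gradient ρ x) = fderiv ℝ ρ x := by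
    ext v
    simp [gradient]
  rw [e]
  exact (h.contDiffAt hx).hasStrictFDerivAt (by simp)

lemma nonpos (h : IsDefiningFunction Ω U ρ) {x : E3} (hx : x ∈ closure Ω) (hU : x ∈ U) :
    ρ x ≤ 0 := by
  by_contra! hpos
  have h1 : ∀ᶠ y in 𝓝 x, 0 < ρ y :=
    (h.contDiffAt hU).continuousAt.eventually (lt_mem_nhds hpos)
  obtain ⟨y, ⟨hy, hyU⟩, hyΩ⟩ :=
    mem_closure_iff_nhds.1 hx _ (inter_mem h1 (h.isOpen.mem_nhds hU))
  exact lt_asymm hy ((h.mem_iff y hyU).1 hyΩ)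

lemma eq_zero (h : IsDefiningFunction Ω U ρ) (hΩ : IsOpen Ω) {x : E3} (hx : x ∈ frontier Ω)
    (hU : x ∈ U) : ρ x = 0 := by
  refine le_antisymm (h.nonpos hx.1 hU) ?_
  rw [hΩ.frontier_eq] at hx
  exact not_lt.1 fun hlt => hx.2 ((h.mem_iff x hU).2 hlt)

/-- A defining function is uniformly close to its linearization at `p` on pairs of points near `p`.
-/
lemma exists_abs_sub_le (h : IsDefiningFunction Ω U ρ) {p : E3} (hp : p ∈ U) {θ : ℝ} (hθ : 0 < θ) :
    ∃ r > 0, Metric.ball p r ⊆ U ∧ ∀ x ∈ Metric.ball p r, ∀ y ∈ Metric.ball p r,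
      |ρ x - ρ y - ⟪gradient ρ p, x - y⟫| ≤ θ * ‖x - y‖ := by
  have h1 := (h.hasStrictFDerivAt hp).isLittleO.def hθ
  rw [nhds_prod_eq] at h1
  obtain ⟨V, hV, hV'⟩ := eventually_prod_self_iff'.1 h1
  obtain ⟨r, hr, hr'⟩ := Metric.mem_nhds_iff.1 (inter_mem hV (h.isOpen.mem_nhds hp))
  refine ⟨r, hr, fun x hx => (hr' hx).2, fun x hx y hy => ?_⟩
  simpa using hV' x (hr' hx).1 y (hr' hy).1

/-- Directions in which the defining function decreases point into `Ω`. -/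
lemma eventually_mem (h : IsDefiningFunction Ω U ρ) {x v : E3} (hU : x ∈ U) (hx : ρ x ≤ 0)
    (hv : ⟪gradient ρ x, v⟫ < 0) : ∀ᶠ t in 𝓝[>] (0 : ℝ), x + t • v ∈ Ω := by
  have hv0 : v ≠ 0 := by rintro rfl; simp at hv
  have hn : 0 < ‖v‖ := norm_pos_iff.2 hv0
  obtain ⟨r, hr, hrU, hr'⟩ :=
    h.exists_abs_sub_le hU (θ := -⟪gradient ρ x, v⟫ / (2 * ‖v‖)) (by positivity [neg_pos.2 hv])
  have h2 : ∀ᶠ t in 𝓝[>] (0 : ℝ), t < r / ‖v‖ :=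
    nhdsWithin_le_nhds (Iio_mem_nhds (by positivity))
  filter_upwards [h2, self_mem_nhdsWithin] with t ht ht0
  have ht0 : 0 < t := ht0
  have hmem : x + t • v ∈ Metric.ball x r := by
    rw [Metric.mem_ball, dist_eq_norm, add_sub_cancel_left, norm_smul, Real.norm_of_nonneg ht0.le]
    exact (lt_div_iff₀ hn).1 ht
  refine (h.mem_iff _ (hrU hmem)).2 ?_
  have := (abs_le.1 (hr' _ hmem x (Metric.mem_ball_self hr))).2
  rw [add_sub_cancel_left, norm_smul, Real.norm_of_nonneg ht0.le, inner_smul_right] at this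
  have e : -⟪gradient ρ x, v⟫ / (2 * ‖v‖) * (t * ‖v‖) = -⟪gradient ρ x, v⟫ * t / 2 := by
    field_simp
  rw [e] at this
  nlinarith

/-- Directions in which the defining function increases point out of `Ω`. -/
lemma eventually_notMem (h : IsDefiningFunction Ω U ρ) (hΩ : IsOpen Ω) {x v : E3} (hU : x ∈ U)
    (hx : x ∈ frontier Ω)
    (hv : 0 < ⟪gradient ρ x, v⟫) : ∀ᶠ t in 𝓝[>] (0 : ℝ), x + t • v ∉ Ω := by
  -- `-ρ` is a defining function for the complementary side
  have hneg : IsDefiningFunction (U ∩ {y | 0 < ρ y}) U (fun y => -ρ y) := by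
    have hg : ∀ y, gradient (fun y => - ρ y) y = - gradient ρ y := by
      intro y
      simp [gradient, fderiv_fun_neg]
    refine ⟨h.isOpen, h.smooth.neg, fun y hy => ?_, fun y hy => ?_⟩
    · rw [hg]; simpa using h.gradient_ne_zero y hy
    · simp [hy]
  have hg : gradient (fun y => - ρ y) x = - gradient ρ x := by
    simp [gradient, fderiv_fun_neg]
  have := hneg.eventually_mem (x := x) (v := v) hU (by simp [h.eq_zero hΩ hx hU])
    (by rw [hg]; simpa using hv)
  filter_upwards [this] with t ht hmem
  exact lt_asymm ht.2 ((h.mem_iff _ ht.1).1 hmem)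

/-- The unit normals given by two defining functions agree: otherwise some direction would
point into `Ω` for one of them and out of `Ω` for the other. -/
lemma unit_gradient_eq (h : IsDefiningFunction Ω U ρ) (hΩ : IsOpen Ω) {U' : Set E3} {ρ' : E3 → ℝ}
    (h' : IsDefiningFunction Ω U' ρ') {x : E3} (hx : x ∈ frontier Ω) (hU : x ∈ U) (hU' : x ∈ U') :
    ‖gradient ρ x‖⁻¹ • gradient ρ x = ‖gradient ρ' x‖⁻¹ • gradient ρ' x := by
  have g0 := h.gradient_ne_zero x hU
  have g0' := h'.gradient_ne_zero x hU'
  have gn : 0 < ‖gradient ρ x‖ := norm_pos_iff.2 g0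
  have gn' : 0 < ‖gradient ρ' x‖ := norm_pos_iff.2 g0'
  set n := ‖gradient ρ x‖⁻¹ • gradient ρ x with hn
  set n' := ‖gradient ρ' x‖⁻¹ • gradient ρ' x with hn'
  have n1 : ‖n‖ = 1 := by rw [hn, norm_smul, norm_inv, norm_norm, inv_mul_cancel₀ gn.ne']
  have n1' : ‖n'‖ = 1 := by rw [hn', norm_smul, norm_inv, norm_norm, inv_mul_cancel₀ gn'.ne']
  have e : gradient ρ x = ‖gradient ρ x‖ • n := by rw [hn, smul_inv_smul₀ gn.ne']
  have e' : gradient ρ' x = ‖gradient ρ' x‖ • n' := by rw [hn', smul_inv_smul₀ gn'.ne']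
  by_contra hne
  have hlt : ⟪n, n'⟫ < 1 := (inner_lt_one_iff_real_of_norm_eq_one n1 n1').2 hne
  have i1 : ⟪gradient ρ x, n' - n⟫ < 0 := by
    rw [e, real_inner_smul_left, inner_sub_right, real_inner_self_eq_norm_sq, n1]
    nlinarith
  have i2 : 0 < ⟪gradient ρ' x, n' - n⟫ := by
    rw [e', real_inner_smul_left, inner_sub_right, real_inner_self_eq_norm_sq, n1',
      real_inner_comm]
    nlinarith
  obtain ⟨t, ht, ht'⟩ := ((h.eventually_mem hU (h.eq_zero hΩ hx hU).le i1).and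
    (h'.eventually_notMem hΩ hU' hx i2)).exists
  exact ht' ht

end IsDefiningFunction

open Classical in
/-- The outward unit normal of `Ω`, extended by zero off the boundary. -/
def normal (Ω : Set E3) (x : E3) : E3 :=
  if h : ∃ n, IsOutwardNormal Ω x n then h.choose else 0

lemma IsOutwardNormal.eq_unit_gradient (hΩ : IsOpen Ω) {x n : E3} (hn : IsOutwardNormal Ω x n)
    (h : IsDefiningFunction Ω U ρ) (hU : x ∈ U) :
    n = ‖gradient ρ x‖⁻¹ • gradient ρ x := by
  obtain ⟨hx, U', ρ', hU', h', rfl⟩ := hn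
  exact h'.unit_gradient_eq hΩ h hx hU' hU

lemma normal_of_notMem {x : E3} (hx : x ∉ frontier Ω) : normal Ω x = 0 :=
  dif_neg fun ⟨_, hn⟩ => hx hn.1

namespace IsSmoothBoundedDomain

variable (hΩ : IsSmoothBoundedDomain Ω)
include hΩ

lemma isOutwardNormal_normal {x : E3} (hx : x ∈ frontier Ω) :
    IsOutwardNormal Ω x (normal Ω x) := by
  obtain ⟨U, ρ, hU, h⟩ := hΩ.smooth_frontier x hx
  have : ∃ n, IsOutwardNormal Ω x n := ⟨_, hx, U, ρ, hU, h, rfl⟩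
  rw [normal, dif_pos this]
  exact this.choose_spec

lemma normal_eq {x : E3} (hx : x ∈ frontier Ω) (h : IsDefiningFunction Ω U ρ) (hU : x ∈ U) :
    normal Ω x = ‖gradient ρ x‖⁻¹ • gradient ρ x :=
  (hΩ.isOutwardNormal_normal hx).eq_unit_gradient hΩ.isOpen h hU

lemma isOutwardNormal_iff {x n : E3} :
    IsOutwardNormal Ω x n ↔ x ∈ frontier Ω ∧ n = normal Ω x := by
  constructor
  · intro hn
    obtain ⟨hx, U, ρ, hU, h, rfl⟩ := id hn
    exact ⟨hx, (hΩ.normal_eq hx h hU).symm⟩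
  · rintro ⟨hx, rfl⟩
    exact hΩ.isOutwardNormal_normal hx

lemma norm_normal {x : E3} (hx : x ∈ frontier Ω) : ‖normal Ω x‖ = 1 := by
  obtain ⟨U, ρ, hU, h⟩ := hΩ.smooth_frontier x hx
  rw [hΩ.normal_eq hx h hU, norm_smul, norm_inv, norm_norm,
    inv_mul_cancel₀ (norm_ne_zero_iff.2 (h.gradient_ne_zero x hU))]

lemma isCompact_frontier : IsCompact (frontier Ω) :=
  Metric.isCompact_of_isClosed_isBounded isClosed_frontier
    (hΩ.isBounded.closure.subset frontier_subset_closure)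

lemma isCompact_closure : IsCompact (closure Ω) :=
  Metric.isCompact_of_isClosed_isBounded isClosed_closure hΩ.isBounded.closure

/-- The normal is Lipschitz near each boundary point. -/
lemma exists_normal_lipschitz {p : E3} (hp : p ∈ frontier Ω) :
    ∃ L ≥ (0 : ℝ), ∃ r > 0, ∀ x ∈ frontier Ω ∩ Metric.ball p r, ∀ y ∈ frontier Ω ∩ Metric.ball p r,
      ‖normal Ω x - normal Ω y‖ ≤ L * ‖x - y‖ := by
  obtain ⟨U, ρ, hU, h⟩ := hΩ.smooth_frontier p hp
  have hg : ContDiffAt ℝ 1 (gradient ρ) p :=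
    (InnerProductSpace.toDual ℝ E3).symm.contDiff.contDiffAt.comp p
      ((h.contDiffAt hU).fderiv_right (m := 1) (by norm_cast))
  have hN : ContDiffAt ℝ 1 (fun x => ‖gradient ρ x‖⁻¹ • gradient ρ x) p :=
    ((hg.norm ℝ (h.gradient_ne_zero p hU)).inv
      (norm_ne_zero_iff.2 (h.gradient_ne_zero p hU))).smul hg
  obtain ⟨K, t, ht, hK⟩ := hN.exists_lipschitzOnWith
  obtain ⟨r, hr, hr'⟩ := Metric.mem_nhds_iff.1 (inter_mem ht (h.isOpen.mem_nhds hU))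
  refine ⟨K, K.2, r, hr, fun x hx y hy => ?_⟩
  have := hK.dist_le_mul x (hr' hx.2).1 y (hr' hy.2).1
  rwa [dist_eq_norm, dist_eq_norm, ← hΩ.normal_eq hx.1 h (hr' hx.2).2,
    ← hΩ.normal_eq hy.1 h (hr' hy.2).2] at this

lemma continuousOn_normal : ContinuousOn (normal Ω) (frontier Ω) := by
  intro p hp
  obtain ⟨L, hL, r, hr, h⟩ := hΩ.exists_normal_lipschitz hp
  refine tendsto_iff_norm_sub_tendsto_zero.2 ?_
  refine squeeze_zero' (g := fun x => L * ‖x - p‖) (Eventually.of_forall fun _ => norm_nonneg _) ?_ ?_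
  · filter_upwards [inter_mem_nhdsWithin (frontier Ω) (Metric.ball_mem_nhds p hr)] with x hx
    exact h x hx p ⟨hp, Metric.mem_ball_self hr⟩
  · have : ContinuousAt (fun x => L * ‖x - p‖) p := by fun_prop
    have h2 := this.tendsto.mono_left (nhdsWithin_le_nhds (s := frontier Ω))
    simpa using h2

lemma measurable_normal : Measurable (normal Ω) := by
  classical
  have : normal Ω = (frontier Ω).piecewise (normal Ω) 0 := by
    funext x
    by_cases hx : x ∈ frontier Ω
    · simp [hx]
    · simp [hx, normal_of_notMem hx]
  rw [this]
  exact hΩ.continuousOn_normal.measurable_piecewise continuousOn_const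
    isClosed_frontier.measurableSet

/-- Near a boundary point `p` the boundary is almost orthogonal to the normal at `p`. -/
lemma exists_abs_inner_normal_le {p : E3} (hp : p ∈ frontier Ω) {θ : ℝ} (hθ : 0 < θ) :
    ∃ r > 0, ∀ x ∈ frontier Ω ∩ Metric.ball p r, ∀ y ∈ frontier Ω ∩ Metric.ball p r,
      |⟪normal Ω p, x - y⟫| ≤ θ * ‖x - y‖ := by
  obtain ⟨U, ρ, hU, h⟩ := hΩ.smooth_frontier p hp
  have hg : 0 < ‖gradient ρ p‖ := norm_pos_iff.2 (h.gradient_ne_zero p hU)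
  obtain ⟨r, hr, hrU, hr'⟩ := h.exists_abs_sub_le hU (θ := θ * ‖gradient ρ p‖) (by positivity)
  refine ⟨r, hr, fun x hx y hy => ?_⟩
  have := hr' x hx.2 y hy.2
  rw [h.eq_zero hΩ.isOpen hx.1 (hrU hx.2), h.eq_zero hΩ.isOpen hy.1 (hrU hy.2), sub_self, zero_sub,
    abs_neg] at this
  rw [hΩ.normal_eq hp h hU, real_inner_smul_left, abs_mul, abs_of_pos (inv_pos.2 hg),
    inv_mul_le_iff₀ hg]
  linarith

/-- Interior cone condition near a boundary point `p`: the directions in the ball of radius `1/2`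
about the inward normal at `p` point into `Ω`, uniformly in the apex. -/
lemma exists_cone_frontier {p : E3} (hp : p ∈ frontier Ω) :
    ∃ r > 0, ∀ x ∈ closure Ω ∩ Metric.ball p r,
      ∀ t ∈ Ioo 0 r, ∀ d ∈ Metric.closedBall (-normal Ω p) (1 / 2), x + t • d ∈ Ω := by
  obtain ⟨U, ρ, hU, h⟩ := hΩ.smooth_frontier p hp
  have hg : 0 < ‖gradient ρ p‖ := norm_pos_iff.2 (h.gradient_ne_zero p hU)
  obtain ⟨r, hr, hrU, hr'⟩ := h.exists_abs_sub_le hU (θ := ‖gradient ρ p‖ / 4) (by positivity)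
  refine ⟨r / 3, by positivity, fun x hx t ht d hd => ?_⟩
  have hd1 : ‖d + normal Ω p‖ ≤ 1 / 2 := by
    simpa [dist_eq_norm] using hd
  have hd2 : ‖d‖ ≤ 3 / 2 := by
    have : d = (d + normal Ω p) - normal Ω p := by abel
    rw [this]
    refine (norm_sub_le _ _).trans ?_
    rw [hΩ.norm_normal hp]
    linarith
  have hxr : ‖x - p‖ < r / 3 := by simpa [dist_eq_norm] using hx.2
  have htd : ‖t • d‖ ≤ t * (3 / 2) := by
    rw [norm_smul, Real.norm_of_nonneg ht.1.le]
    exact mul_le_mul_of_nonneg_left hd2 ht.1.le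
  have hxB : x ∈ Metric.ball p r := by
    rw [Metric.mem_ball, dist_eq_norm]; linarith
  have hyB : x + t • d ∈ Metric.ball p r := by
    rw [Metric.mem_ball, dist_eq_norm, add_sub_right_comm]
    refine (norm_add_le _ _).trans_lt ?_
    linarith [ht.2]
  refine (h.mem_iff _ (hrU hyB)).2 ?_
  have h1 := (abs_le.1 (hr' _ hyB x hxB)).2
  rw [add_sub_cancel_left, inner_smul_right] at h1
  have h2 : ⟪gradient ρ p, d⟫ ≤ - ‖gradient ρ p‖ / 2 := by
    have e1 : ⟪gradient ρ p, normal Ω p⟫ = ‖gradient ρ p‖ := by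
      rw [hΩ.normal_eq hp h hU, inner_smul_right, real_inner_self_eq_norm_sq]
      field_simp
    have e2 : ⟪gradient ρ p, d + normal Ω p⟫ ≤ ‖gradient ρ p‖ * (1 / 2) :=
      (real_inner_le_norm _ _).trans (mul_le_mul_of_nonneg_left hd1 hg.le)
    rw [inner_add_right, e1] at e2
    linarith
  have h3 := h.nonpos hx.1 (hrU hxB)
  have h4 : ‖gradient ρ p‖ / 4 * ‖t • d‖ ≤ ‖gradient ρ p‖ / 4 * (t * (3 / 2)) :=
    mul_le_mul_of_nonneg_left htd (by positivity)
  have h5 : t * ⟪gradient ρ p, d⟫ ≤ t * (- ‖gradient ρ p‖ / 2) :=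
    mul_le_mul_of_nonneg_left h2 ht.1.le
  nlinarith [mul_pos ht.1 hg]

/-- Uniform interior cone condition near a point of the closure: `Ω` contains, with each of its
points `x` near `p`, a truncated open cone with apex `x`. The directions of the cone form a ball
which does not depend on `x`. -/
lemma exists_cone {p : E3} (hp : p ∈ closure Ω) :
    ∃ e : E3, ‖e‖ ≤ 1 ∧ ∃ r > 0, ∀ x ∈ closure Ω ∩ Metric.ball p r,
      ∀ t ∈ Ioo 0 r, ∀ d ∈ Metric.closedBall e (1 / 2), x + t • d ∈ Ω := by
  by_cases hpΩ : p ∈ Ω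
  · obtain ⟨r, hr, hr'⟩ := Metric.isOpen_iff.1 hΩ.isOpen p hpΩ
    refine ⟨0, by simp, r / 2, by positivity, fun x hx t ht d hd => hr' ?_⟩
    have h1 : ‖d‖ ≤ 1 / 2 := by simpa using hd
    have h2 : ‖x - p‖ < r / 2 := by simpa [dist_eq_norm] using hx.2
    rw [Metric.mem_ball, dist_eq_norm, add_sub_right_comm]
    refine (norm_add_le _ _).trans_lt ?_
    rw [norm_smul, Real.norm_of_nonneg ht.1.le]
    nlinarith [ht.1, ht.2, norm_nonneg d]
  · have hpf : p ∈ frontier Ω := by rw [hΩ.isOpen.frontier_eq]; exact ⟨hp, hpΩ⟩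
    exact ⟨-normal Ω p, by rw [norm_neg, hΩ.norm_normal hpf], hΩ.exists_cone_frontier hpf⟩

/-- Boundary points are moved into `Ω` along the inward normal. -/
lemma exists_sub_smul_normal_mem {p : E3} (hp : p ∈ frontier Ω) :
    ∃ r > 0, ∀ x ∈ frontier Ω ∩ Metric.ball p r, ∀ σ ∈ Ioo 0 r, x - σ • normal Ω x ∈ Ω := by
  obtain ⟨r, hr, h⟩ := hΩ.exists_cone_frontier hp
  obtain ⟨s, hs, hs'⟩ := Metric.continuousWithinAt_iff.1 (hΩ.continuousOn_normal p hp) (1 / 2)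
    (by norm_num)
  refine ⟨min r s, lt_min hr hs, fun x hx σ hσ => ?_⟩
  have hx2 : dist x p < min r s := hx.2
  have := h x ⟨hx.1.1, hx2.trans_le (min_le_left _ _)⟩ σ
    ⟨hσ.1, hσ.2.trans_le (min_le_left _ _)⟩ (-normal Ω x) (by
      rw [Metric.mem_closedBall, dist_neg_neg]
      exact (hs' hx.1 (hx2.trans_le (min_le_right _ _))).le)
  simpa [sub_eq_add_neg] using this

end IsSmoothBoundedDomain

/-! ### Normal coordinates near the boundary -/

/-- Two maps whose distances are comparable on `S` have comparable image measures. -/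
lemma hausdorff_image_le_of_dist_le {X : Type*} {F G : X → E3} {S : Set X} {K : NNReal}
    (h : ∀ x ∈ S, ∀ y ∈ S, dist (F x) (F y) ≤ K * dist (G x) (G y)) (d : ℕ) :
    (Measure.euclideanHausdorffMeasure d : Measure E3) (F '' S)
      ≤ (K : ℝ≥0∞) ^ d * (Measure.euclideanHausdorffMeasure d : Measure E3) (G '' S) := by
  rcases S.eq_empty_or_nonempty with rfl | ⟨x₀, -⟩
  · simp
  have : Nonempty X := ⟨x₀⟩
  set f : E3 → E3 := fun y => F (Function.invFunOn G S y) with hf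
  have hmem : ∀ x ∈ S, Function.invFunOn G S (G x) ∈ S ∧ G (Function.invFunOn G S (G x)) = G x :=
    fun x hx => ⟨Function.invFunOn_mem ⟨x, hx, rfl⟩, Function.invFunOn_eq ⟨x, hx, rfl⟩⟩
  have hL : LipschitzOnWith K f (G '' S) := by
    refine LipschitzOnWith.of_dist_le_mul ?_
    rintro _ ⟨x, hx, rfl⟩ _ ⟨y, hy, rfl⟩
    have := h _ (hmem x hx).1 _ (hmem y hy).1
    rwa [(hmem x hx).2, (hmem y hy).2] at this
  have him : F '' S = f '' (G '' S) := by
    rw [image_image]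
    refine image_congr fun x hx => ?_
    have := h _ hx _ (hmem x hx).1
    rw [(hmem x hx).2, dist_self, mul_zero] at this
    exact dist_le_zero.1 this
  have hH := hL.hausdorffMeasure_image_le (d := d) (by positivity)
  rw [him, Measure.euclideanHausdorffMeasure_def, Measure.smul_apply, Measure.smul_apply,
    ENNReal.smul_def, ENNReal.smul_def, smul_eq_mul, smul_eq_mul, mul_left_comm]
  rw [ENNReal.rpow_natCast] at hH
  gcongr

/-- The normal coordinates `(x, σ) ↦ x - σ n(x)` of the boundary strip. -/
def tube (Ω : Set E3) (z : E3 × ℝ) : E3 := z.1 - z.2 • normal Ω z.1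

/-- The normal coordinates of the half space with outward normal `N`, preceded by the
orthogonal projection onto its boundary. -/
def flat (N : E3) (z : E3 × ℝ) : E3 := z.1 - ⟪N, z.1⟫ • N - z.2 • N

lemma tube_zero (Ω : Set E3) (x : E3) : tube Ω (x, 0) = x := by simp [tube]

lemma continuous_flat (N : E3) : Continuous (flat N) := by
  unfold flat; fun_prop

lemma inner_flat {N : E3} (hN : ‖N‖ = 1) (z : E3 × ℝ) : ⟪N, flat N z⟫ = - z.2 := by
  simp [flat, inner_sub_right, inner_smul_right, hN]

lemma norm_flat_sub_sq {N : E3} (hN : ‖N‖ = 1) (z w : E3 × ℝ) :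
    ‖flat N z - flat N w‖ ^ 2 = ‖z.1 - w.1‖ ^ 2 - ⟪N, z.1 - w.1⟫ ^ 2 + (z.2 - w.2) ^ 2 := by
  have e : flat N z - flat N w
      = (z.1 - w.1) - (⟪N, z.1 - w.1⟫ + (z.2 - w.2)) • N := by
    simp only [flat, inner_sub_right]
    module
  rw [e, norm_sub_sq_real, inner_smul_right, norm_smul, hN, Real.norm_eq_abs, mul_one, sq_abs,
    real_inner_comm]
  ring

namespace IsSmoothBoundedDomain

variable (hΩ : IsSmoothBoundedDomain Ω)
include hΩ

lemma measurable_tube : Measurable (tube Ω) := by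
  unfold tube
  have := hΩ.measurable_normal
  fun_prop

lemma continuousOn_tube : ContinuousOn (tube Ω) (frontier Ω ×ˢ univ) := by
  unfold tube
  refine continuousOn_fst.sub (continuousOn_snd.smul ?_)
  exact hΩ.continuousOn_normal.comp continuousOn_fst fun z hz => hz.1

/-- Near a boundary point the normal coordinates differ from those of the half space bounded by
the tangent plane by a map with small Lipschitz constant. -/
lemma exists_norm_tube_sub_flat_le {p : E3} (hp : p ∈ frontier Ω) {κ : ℝ} (hκ : 0 < κ) :
    ∃ r > 0, ∀ z ∈ (frontier Ω ∩ Metric.closedBall p r) ×ˢ Icc 0 r,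
      ∀ w ∈ (frontier Ω ∩ Metric.closedBall p r) ×ˢ Icc 0 r,
      ‖(tube Ω z - tube Ω w) - (flat (normal Ω p) z - flat (normal Ω p) w)‖
        ≤ κ * ‖flat (normal Ω p) z - flat (normal Ω p) w‖ := by
  obtain ⟨L, hL, r₁, hr₁, h₁⟩ := hΩ.exists_normal_lipschitz hp
  set θ := min (1 / 2) (κ / 8) with hθdef
  have hθ : 0 < θ := by positivity
  obtain ⟨r₂, hr₂, h₂⟩ := hΩ.exists_abs_inner_normal_le hp hθ
  set r := min (min (r₁ / 2) (r₂ / 2)) (θ / (L + 1)) with hr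
  have hr0 : 0 < r := by positivity
  have hrL : L * r ≤ θ := by
    have : r ≤ θ / (L + 1) := min_le_right _ _
    rw [le_div_iff₀ (by positivity)] at this
    nlinarith
  have hrr₁ : r < r₁ := lt_of_le_of_lt ((min_le_left _ _).trans (min_le_left _ _)) (by linarith)
  have hrr₂ : r < r₂ := lt_of_le_of_lt ((min_le_left _ _).trans (min_le_right _ _)) (by linarith)
  refine ⟨r, hr0, ?_⟩
  rintro ⟨x, σ⟩ ⟨⟨hx, hxp⟩, hσ⟩ ⟨y, τ⟩ ⟨⟨hy, hyp⟩, hτ⟩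
  set N := normal Ω p with hN
  have hN1 : ‖N‖ = 1 := hΩ.norm_normal hp
  have hpp : p ∈ frontier Ω ∩ Metric.ball p r₁ := ⟨hp, Metric.mem_ball_self hr₁⟩
  have hx1 : x ∈ frontier Ω ∩ Metric.ball p r₁ := ⟨hx, lt_of_le_of_lt hxp hrr₁⟩
  have hy1 : y ∈ frontier Ω ∩ Metric.ball p r₁ := ⟨hy, lt_of_le_of_lt hyp hrr₁⟩
  have a1 := h₁ x hx1 y hy1
  have a2 := h₁ y hy1 p hpp
  have a3 := h₂ x ⟨hx, lt_of_le_of_lt hxp hrr₂⟩ y ⟨hy, lt_of_le_of_lt hyp hrr₂⟩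
  have a4 : ‖y - p‖ ≤ r := by simpa [dist_eq_norm] using hyp
  have hσ' : σ ≤ r := hσ.2
  have hσ0 : 0 ≤ σ := hσ.1
  have e : (tube Ω (x, σ) - tube Ω (y, τ)) - (flat N (x, σ) - flat N (y, τ))
      = ⟪N, x - y⟫ • N - σ • (normal Ω x - normal Ω y) - (σ - τ) • (normal Ω y - N) := by
    simp only [tube, flat, inner_sub_right]
    module
  have b1 : ‖(tube Ω (x, σ) - tube Ω (y, τ)) - (flat N (x, σ) - flat N (y, τ))‖
      ≤ 2 * θ * ‖x - y‖ + θ * |σ - τ| := by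
    rw [e]
    refine (norm_sub_le _ _).trans (add_le_add ((norm_sub_le _ _).trans ?_) ?_)
    · rw [norm_smul, norm_smul, hN1, Real.norm_eq_abs, Real.norm_eq_abs, abs_of_nonneg hσ0, mul_one]
      have : σ * ‖normal Ω x - normal Ω y‖ ≤ θ * ‖x - y‖ := by
        calc σ * ‖normal Ω x - normal Ω y‖ ≤ r * (L * ‖x - y‖) := by gcongr
          _ = (L * r) * ‖x - y‖ := by ring
          _ ≤ θ * ‖x - y‖ := by gcongr
      linarith
    · rw [norm_smul, Real.norm_eq_abs, mul_comm]
      have : ‖normal Ω y - N‖ ≤ θ := a2.trans ((mul_le_mul_of_nonneg_left a4 hL).trans hrL)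
      gcongr
  have b2 := norm_flat_sub_sq hN1 (x, σ) (y, τ)
  dsimp only at b2
  set D := ‖flat N (x, σ) - flat N (y, τ)‖ with hD
  have hD0 : 0 ≤ D := norm_nonneg _
  have hθ2 : θ ≤ 1 / 2 := min_le_left _ _
  have hθκ : θ ≤ κ / 8 := min_le_right _ _
  have b3 : ⟪N, x - y⟫ ^ 2 ≤ (1 / 2 * ‖x - y‖) ^ 2 := by
    rw [← sq_abs]
    gcongr
    exact a3.trans (by gcongr)
  have b4 : ‖x - y‖ ≤ 2 * D := by
    refine (le_abs_self _).trans (abs_le_of_sq_le_sq ?_ (by positivity))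
    nlinarith [sq_nonneg (σ - τ)]
  have b5 : |σ - τ| ≤ D := by
    refine abs_le_of_sq_le_sq ?_ hD0
    nlinarith [sq_nonneg ‖x - y‖]
  calc _ ≤ 2 * θ * ‖x - y‖ + θ * |σ - τ| := b1
    _ ≤ 2 * θ * (2 * D) + θ * D := by gcongr
    _ = 5 * θ * D := by ring
    _ ≤ κ * D := by
      gcongr
      linarith

/-- Near a boundary point the normal coordinates are nearly isometric to those of the half space
bounded by the tangent plane. -/
lemma exists_dist_tube_flat_le {p : E3} (hp : p ∈ frontier Ω) {K : NNReal} (hK : 1 < K) :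
    ∃ r > 0, ∀ z ∈ (frontier Ω ∩ Metric.closedBall p r) ×ˢ Icc 0 r,
      ∀ w ∈ (frontier Ω ∩ Metric.closedBall p r) ×ˢ Icc 0 r,
      dist (tube Ω z) (tube Ω w) ≤ K * dist (flat (normal Ω p) z) (flat (normal Ω p) w) ∧
      dist (flat (normal Ω p) z) (flat (normal Ω p) w) ≤ K * dist (tube Ω z) (tube Ω w) := by
  have hK' : (1 : ℝ) < K := by exact_mod_cast hK
  have hK0 : (0 : ℝ) < K := by linarith
  have hinv : (K : ℝ)⁻¹ < 1 := inv_lt_one_of_one_lt₀ hK'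
  obtain ⟨r, hr, h⟩ := hΩ.exists_norm_tube_sub_flat_le hp (κ := 1 - (K : ℝ)⁻¹) (by linarith)
  refine ⟨r, hr, fun z hz w hw => ?_⟩
  have h1 := h z hz w hw
  rw [dist_eq_norm, dist_eq_norm]
  set A := tube Ω z - tube Ω w
  set D := flat (normal Ω p) z - flat (normal Ω p) w
  have t1 := norm_sub_norm_le A D
  have t2 := norm_sub_norm_le D A
  rw [norm_sub_rev D A] at t2
  have hD := norm_nonneg D
  have hKK : 1 + (1 - (K : ℝ)⁻¹) ≤ K := by
    have : (K : ℝ) * (K : ℝ)⁻¹ = 1 := mul_inv_cancel₀ hK0.ne'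
    nlinarith [sq_nonneg ((K : ℝ) - 1)]
  refine ⟨by nlinarith, ?_⟩
  have : (K : ℝ)⁻¹ * ‖D‖ ≤ ‖A‖ := by linarith
  rwa [inv_mul_le_iff₀ hK0] at this

end IsSmoothBoundedDomain

/-- The volume of a set in the coordinates `flat N`, computed from its slices parallel to the
plane orthogonal to `N`. -/
lemma volume_flat_image {N : E3} (hN : ‖N‖ = 1) {B : Set (E3 × ℝ)}
    (hB : MeasurableSet (flat N '' B)) :
    volume (flat N '' B) = ∫⁻ σ : ℝ, (Measure.euclideanHausdorffMeasure 2 : Measure E3)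
      ((fun x => flat N (x, σ)) '' {x | (x, σ) ∈ B}) := by
  have h := EuclideanGeometry.euclideanHausdorffMeasure_eq_lintegral (V := E3) (0 : E3)
    (v := -N) (by rw [neg_ne_zero, ← norm_ne_zero_iff, hN]; simp) hB
  rw [finrank_euclideanSpace_fin, EuclideanSpace.euclideanHausdorffMeasure_eq_volume] at h
  rw [h, enorm_neg, ← ofReal_norm, hN, ENNReal.ofReal_one, one_mul]
  refine lintegral_congr fun σ => congrArg _ ?_
  ext y
  simp only [mem_inter_iff, mem_image, SetLike.mem_coe, AffineSubspace.mem_mk', vsub_eq_sub,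
    vadd_eq_add, add_zero, Submodule.mem_orthogonal_singleton_iff_inner_right, mem_ofPred_eq]
  constructor
  · rintro ⟨⟨⟨x, τ⟩, hz, rfl⟩, hy⟩
    have : τ = σ := by
      rw [inner_sub_right, inner_neg_left, inner_flat hN, inner_smul_right, inner_neg_neg,
        real_inner_self_eq_norm_sq, hN] at hy
      simp only at hy
      linarith
    subst this
    exact ⟨x, hz, rfl⟩
  · rintro ⟨x, hx, rfl⟩
    refine ⟨⟨_, hx, rfl⟩, ?_⟩
    rw [inner_sub_right, inner_neg_left, inner_flat hN, inner_smul_right, inner_neg_neg,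
        real_inner_self_eq_norm_sq, hN]
    simp

namespace IsSmoothBoundedDomain

variable (hΩ : IsSmoothBoundedDomain Ω)
include hΩ

/-- Near a boundary point, the volume of a set in normal coordinates is comparable, with a constant
close to one, to the integral of the areas of its slices. -/
lemma exists_volume_tube_image {p : E3} (hp : p ∈ frontier Ω) {K : NNReal} (hK : 1 < K) :
    ∃ r > 0, InjOn (tube Ω) ((frontier Ω ∩ Metric.closedBall p r) ×ˢ Icc 0 r) ∧
      ∀ B ⊆ (frontier Ω ∩ Metric.closedBall p r) ×ˢ Icc 0 r, MeasurableSet B →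
      volume (tube Ω '' B) ≤ (K : ℝ≥0∞) ^ 5 *
        ∫⁻ σ : ℝ, (Measure.euclideanHausdorffMeasure 2 : Measure E3) {x | (x, σ) ∈ B} ∧
      ∫⁻ σ : ℝ, (Measure.euclideanHausdorffMeasure 2 : Measure E3) {x | (x, σ) ∈ B} ≤
        (K : ℝ≥0∞) ^ 5 * volume (tube Ω '' B) := by
  obtain ⟨r, hr, h⟩ := hΩ.exists_dist_tube_flat_le hp hK
  set S := (frontier Ω ∩ Metric.closedBall p r) ×ˢ Icc (0 : ℝ) r with hS
  set N := normal Ω p with hNdef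
  have hN : ‖N‖ = 1 := hΩ.norm_normal hp
  have hS0 : ∀ z ∈ S, (z.1, (0 : ℝ)) ∈ S := fun z hz => ⟨hz.1, left_mem_Icc.2 hr.le⟩
  have hflat : InjOn (flat N) S := by
    intro z hz w hw hzw
    have e1 := (h _ (hS0 z hz) _ (hS0 w hw)).1
    have e2 : flat N (z.1, 0) = flat N (w.1, 0) ∧ z.2 = w.2 := by
      have : z.2 = w.2 := by
        have := congrArg (fun y => ⟪N, y⟫) hzw
        simp only [inner_flat hN] at this
        linarith
      refine ⟨?_, this⟩
      simp only [flat, this] at hzw ⊢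
      simpa using hzw
    rw [e2.1, dist_self, mul_zero, tube_zero, tube_zero] at e1
    exact Prod.ext (dist_le_zero.1 e1) e2.2
  have htube : InjOn (tube Ω) S := by
    intro z hz w hw hzw
    have := (h z hz w hw).2
    rw [hzw, dist_self, mul_zero] at this
    exact hflat hz hw (dist_le_zero.1 this)
  refine ⟨r, hr, htube, fun B hB hBm => ?_⟩
  have hvol : (volume : Measure E3) = Measure.euclideanHausdorffMeasure 3 :=
    (EuclideanSpace.euclideanHausdorffMeasure_eq_volume 3).symm
  have hBflat : MeasurableSet (flat N '' B) :=
    hBm.image_of_continuousOn_injOn (continuous_flat N).continuousOn (hflat.mono hB)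
  have v1 : volume (tube Ω '' B) ≤ (K : ℝ≥0∞) ^ 3 * volume (flat N '' B) := by
    rw [hvol]
    exact hausdorff_image_le_of_dist_le (fun z hz w hw => (h z (hB hz) w (hB hw)).1) 3
  have v2 : volume (flat N '' B) ≤ (K : ℝ≥0∞) ^ 3 * volume (tube Ω '' B) := by
    rw [hvol]
    exact hausdorff_image_le_of_dist_le (fun z hz w hw => (h z (hB hz) w (hB hw)).2) 3
  -- on a slice, `flat N` is a translate of its restriction to the slice `σ = 0`
  have hslice : ∀ σ : ℝ, ∀ x y : E3,
      dist (flat N (x, σ)) (flat N (y, σ)) = dist (flat N (x, 0)) (flat N (y, 0)) := by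
    intro σ x y
    simp [flat, dist_eq_norm]
  have s1 : ∀ σ : ℝ, (Measure.euclideanHausdorffMeasure 2 : Measure E3) {x | (x, σ) ∈ B} ≤
      (K : ℝ≥0∞) ^ 2 * (Measure.euclideanHausdorffMeasure 2 : Measure E3)
        ((fun x => flat N (x, σ)) '' {x | (x, σ) ∈ B}) := by
    intro σ
    have := hausdorff_image_le_of_dist_le (F := fun x : E3 => x) (G := fun x => flat N (x, σ))
      (S := {x | (x, σ) ∈ B}) (K := K) (fun x hx y hy => ?_) 2
    · simpa using this
    · rw [hslice]
      simpa [tube_zero] using (h _ (hS0 _ (hB hx)) _ (hS0 _ (hB hy))).1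
  have s2 : ∀ σ : ℝ, (Measure.euclideanHausdorffMeasure 2 : Measure E3)
        ((fun x => flat N (x, σ)) '' {x | (x, σ) ∈ B}) ≤
      (K : ℝ≥0∞) ^ 2 * (Measure.euclideanHausdorffMeasure 2 : Measure E3) {x | (x, σ) ∈ B} := by
    intro σ
    have := hausdorff_image_le_of_dist_le (F := fun x => flat N (x, σ)) (G := fun x : E3 => x)
      (S := {x | (x, σ) ∈ B}) (K := K) (fun x hx y hy => ?_) 2
    · simpa using this
    · rw [hslice]
      simpa [tube_zero] using (h _ (hS0 _ (hB hx)) _ (hS0 _ (hB hy))).2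
  have hKtop : ∀ k : ℕ, (K : ℝ≥0∞) ^ k ≠ ⊤ := fun k => by finiteness
  have e5 : (K : ℝ≥0∞) ^ 5 = (K : ℝ≥0∞) ^ 3 * (K : ℝ≥0∞) ^ 2 := by ring
  constructor
  · calc _ ≤ (K : ℝ≥0∞) ^ 3 * volume (flat N '' B) := v1
      _ ≤ (K : ℝ≥0∞) ^ 3 * ((K : ℝ≥0∞) ^ 2 * ∫⁻ σ : ℝ,
          (Measure.euclideanHausdorffMeasure 2 : Measure E3) {x | (x, σ) ∈ B}) := by
        rw [volume_flat_image hN hBflat, ← lintegral_const_mul' _ _ (hKtop 2)]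
        gcongr with σ
        exact s2 σ
      _ = _ := by rw [e5, mul_assoc]
  · calc _ ≤ (K : ℝ≥0∞) ^ 2 * volume (flat N '' B) := by
          rw [volume_flat_image hN hBflat, ← lintegral_const_mul' _ _ (hKtop 2)]
          gcongr with σ
          exact s1 σ
      _ ≤ (K : ℝ≥0∞) ^ 2 * ((K : ℝ≥0∞) ^ 3 * volume (tube Ω '' B)) := by gcongr
      _ = _ := by rw [e5]; ring

/-- The boundary has finite area: a thin layer of positive thickness over a piece of it has
finite volume. -/
lemma isFiniteMeasure_surface : IsFiniteMeasure (surface Ω) := by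
  refine ⟨?_⟩
  rw [surface, Measure.restrict_apply_univ]
  refine hΩ.isCompact_frontier.measure_lt_top_of_nhdsWithin fun p hp => ?_
  obtain ⟨r, hr, -, h⟩ := hΩ.exists_volume_tube_image hp (K := 2) (by norm_num)
  set A := frontier Ω ∩ Metric.closedBall p r with hA
  refine ⟨A, inter_mem_nhdsWithin _ (Metric.closedBall_mem_nhds p hr), ?_⟩
  have hAm : MeasurableSet A := isClosed_frontier.measurableSet.inter Metric.isClosed_closedBall.measurableSet
  have hAc : IsCompact A := hΩ.isCompact_frontier.inter_right Metric.isClosed_closedBall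
  have h2 := (h (A ×ˢ Icc 0 r) subset_rfl (hAm.prod measurableSet_Icc)).2
  have hfin : volume (tube Ω '' (A ×ˢ Icc 0 r)) < ⊤ := by
    refine IsCompact.measure_lt_top ((hAc.prod isCompact_Icc).image_of_continuousOn ?_)
    exact hΩ.continuousOn_tube.mono (prod_mono inter_subset_left (subset_univ _))
  have h3 : ENNReal.ofReal r * (Measure.euclideanHausdorffMeasure 2 : Measure E3) A ≤
      ∫⁻ σ : ℝ, (Measure.euclideanHausdorffMeasure 2 : Measure E3) {x | (x, σ) ∈ A ×ˢ Icc 0 r} := by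
    have : ∀ σ : ℝ, (Icc 0 r).indicator
        (fun _ => (Measure.euclideanHausdorffMeasure 2 : Measure E3) A) σ
        ≤ (Measure.euclideanHausdorffMeasure 2 : Measure E3) {x | (x, σ) ∈ A ×ˢ Icc 0 r} := by
      intro σ
      by_cases hσ : σ ∈ Icc 0 r
      · rw [indicator_of_mem hσ]
        exact measure_mono fun x hx => ⟨hx, hσ⟩
      · rw [indicator_of_notMem hσ]
        exact zero_le
    refine le_trans (le_of_eq ?_) (lintegral_mono this)
    rw [lintegral_indicator measurableSet_Icc, setLIntegral_const, Real.volume_Icc, sub_zero,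
      mul_comm]
  have h4 : ENNReal.ofReal r * (Measure.euclideanHausdorffMeasure 2 : Measure E3) A < ⊤ :=
    (h3.trans h2).trans_lt (ENNReal.mul_lt_top (by finiteness) hfin)
  by_contra htop
  rw [not_lt, top_le_iff] at htop
  rw [htop, ENNReal.mul_top (by simpa using hr)] at h4
  exact lt_irrefl _ h4

end IsSmoothBoundedDomain

/-! ### Lebesgue measure on thin boundary strips -/

/-- The image under the normal coordinates of the product of surface measure and Lebesgue measure
on `(0, ε)`. -/
def tubeMeasure (Ω : Set E3) (ε : ℝ) : Measure E3 :=
  ((surface Ω).prod (volume.restrict (Ioo 0 ε))).map (tube Ω)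

namespace IsSmoothBoundedDomain

variable (hΩ : IsSmoothBoundedDomain Ω)
include hΩ

/-- Since the boundary is compact, all inward normal segments of some fixed length lie in `Ω`. -/
lemma exists_tube_mem : ∃ r > 0, ∀ x ∈ frontier Ω, ∀ σ ∈ Ioo 0 r, tube Ω (x, σ) ∈ Ω := by
  refine hΩ.isCompact_frontier.induction_on
    (p := fun A => ∃ r > 0, ∀ x ∈ A ∩ frontier Ω, ∀ σ ∈ Ioo 0 r, tube Ω (x, σ) ∈ Ω)
    ⟨1, one_pos, by simp⟩ ?_ ?_ ?_ |> fun ⟨r, hr, h⟩ => ⟨r, hr, fun x hx => h x ⟨hx, hx⟩⟩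
  · rintro A A' hAA ⟨r, hr, h⟩
    exact ⟨r, hr, fun x hx => h x ⟨hAA hx.1, hx.2⟩⟩
  · rintro A A' ⟨r, hr, h⟩ ⟨r', hr', h'⟩
    refine ⟨min r r', lt_min hr hr', ?_⟩
    rintro x ⟨hx | hx, hxf⟩ σ hσ
    · exact h x ⟨hx, hxf⟩ σ ⟨hσ.1, hσ.2.trans_le (min_le_left _ _)⟩
    · exact h' x ⟨hx, hxf⟩ σ ⟨hσ.1, hσ.2.trans_le (min_le_right _ _)⟩
  · intro p hp
    obtain ⟨r, hr, h⟩ := hΩ.exists_sub_smul_normal_mem hp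
    exact ⟨Metric.ball p r, mem_nhdsWithin_of_mem_nhds (Metric.ball_mem_nhds p hr), r, hr,
      fun x hx σ hσ => h x hx.symm σ hσ⟩

/-- Normal coordinates are injective on a uniform layer. Locally this holds because they are close
to `flat`, which is injective; two points with the same image have feet at distance at most the sum
of their heights, so the local statement and compactness suffice. -/
lemma exists_injOn_tube : ∃ r > 0, InjOn (tube Ω) (frontier Ω ×ˢ Icc 0 r) := by
  obtain ⟨r, hr, h⟩ : ∃ r > 0, ∀ x ∈ frontier Ω ∩ frontier Ω, ∀ y ∈ frontier Ω, dist y x ≤ r →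
      ∀ σ ∈ Icc 0 r, ∀ τ ∈ Icc 0 r, tube Ω (x, σ) = tube Ω (y, τ) → x = y ∧ σ = τ := by
    refine hΩ.isCompact_frontier.induction_on
      (p := fun A => ∃ r > 0, ∀ x ∈ A ∩ frontier Ω, ∀ y ∈ frontier Ω, dist y x ≤ r →
        ∀ σ ∈ Icc 0 r, ∀ τ ∈ Icc 0 r, tube Ω (x, σ) = tube Ω (y, τ) → x = y ∧ σ = τ)
      ⟨1, one_pos, by simp⟩ ?_ ?_ ?_
    · rintro A A' hAA ⟨r, hr, h⟩
      exact ⟨r, hr, fun x hx => h x ⟨hAA hx.1, hx.2⟩⟩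
    · rintro A A' ⟨r, hr, h⟩ ⟨r', hr', h'⟩
      refine ⟨min r r', lt_min hr hr', ?_⟩
      have l := min_le_left r r'
      have l' := min_le_right r r'
      rintro x ⟨hx | hx, hxf⟩ y hy hxy σ hσ τ hτ
      · exact h x ⟨hx, hxf⟩ y hy (hxy.trans l) σ ⟨hσ.1, hσ.2.trans l⟩ τ ⟨hτ.1, hτ.2.trans l⟩
      · exact h' x ⟨hx, hxf⟩ y hy (hxy.trans l') σ ⟨hσ.1, hσ.2.trans l'⟩ τ ⟨hτ.1, hτ.2.trans l'⟩
    · intro p hp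
      obtain ⟨r, hr, h, -⟩ := hΩ.exists_volume_tube_image hp (K := 2) (by norm_num)
      refine ⟨Metric.ball p (r / 2),
        mem_nhdsWithin_of_mem_nhds (Metric.ball_mem_nhds p (by positivity)), r / 2, by positivity,
        fun x hx y hy hxy σ hσ τ hτ he => ?_⟩
      have hx1 : dist x p < r / 2 := hx.1
      have hyp : dist y p ≤ r := (dist_triangle y x p).trans (by linarith)
      have hz : (x, σ) ∈ (frontier Ω ∩ Metric.closedBall p r) ×ˢ Icc (0 : ℝ) r :=
        mk_mem_prod ⟨hx.2, Metric.mem_closedBall.2 (by linarith)⟩ ⟨hσ.1, hσ.2.trans (by linarith)⟩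
      have hw : (y, τ) ∈ (frontier Ω ∩ Metric.closedBall p r) ×ˢ Icc (0 : ℝ) r :=
        mk_mem_prod ⟨hy, hyp⟩ ⟨hτ.1, hτ.2.trans (by linarith)⟩
      exact Prod.mk.inj (h hz hw he)
  refine ⟨r / 2, by positivity, ?_⟩
  rintro ⟨x, σ⟩ ⟨hx, hσ⟩ ⟨y, τ⟩ ⟨hy, hτ⟩ he
  have hd : dist y x ≤ r := by
    have : y - x = τ • normal Ω y - σ • normal Ω x := by
      simp only [tube] at he
      rw [sub_eq_sub_iff_add_eq_add] at he ⊢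
      rw [← he, add_comm]
    rw [dist_eq_norm, this]
    refine (norm_sub_le _ _).trans ?_
    rw [norm_smul, norm_smul, hΩ.norm_normal hx, hΩ.norm_normal hy, Real.norm_of_nonneg hσ.1,
      Real.norm_of_nonneg hτ.1]
    linarith [hσ.2, hτ.2]
  have := h x ⟨hx, hx⟩ y hy hd σ ⟨hσ.1, hσ.2.trans (by linarith)⟩ τ
    ⟨hτ.1, hτ.2.trans (by linarith)⟩ he
  exact Prod.ext this.1 this.2

/-- Volume in normal coordinates is comparable with the product measure, on a layer over the whole
boundary. The local comparison is patched by induction over a compact cover, cutting `B` into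
disjoint pieces, whose images are disjoint by injectivity. -/
lemma exists_volume_tube_image_global {C : NNReal} (hC : 1 < C) :
    ∃ r > 0, ∀ B ⊆ frontier Ω ×ˢ Icc 0 r, MeasurableSet B →
      volume (tube Ω '' B) ≤ C * ((surface Ω).prod volume) B ∧
      ((surface Ω).prod volume) B ≤ C * volume (tube Ω '' B) := by
  have := hΩ.isFiniteMeasure_surface
  obtain ⟨r₀, hr₀, hinj⟩ := hΩ.exists_injOn_tube
  obtain ⟨K, hK, hKC⟩ : ∃ K : NNReal, 1 < K ∧ K ^ 5 < C := by
    have h1 : ∀ᶠ K : NNReal in 𝓝[>] 1, K ^ 5 < C :=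
      nhdsWithin_le_nhds ((continuous_pow 5).continuousAt.eventually (gt_mem_nhds (by simpa using hC)))
    obtain ⟨K, hK, hK'⟩ := (h1.and self_mem_nhdsWithin).exists
    exact ⟨K, hK', hK⟩
  have hKC' : (K : ℝ≥0∞) ^ 5 ≤ C := by exact_mod_cast hKC.le
  obtain ⟨A, hAm, hA, r, hr, -, h⟩ : ∃ A, MeasurableSet A ∧ frontier Ω ⊆ A ∧ ∃ r > 0, r ≤ r₀ ∧
      ∀ B ⊆ (frontier Ω ∩ A) ×ˢ Icc 0 r, MeasurableSet B →
      volume (tube Ω '' B) ≤ C * ((surface Ω).prod volume) B ∧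
      ((surface Ω).prod volume) B ≤ C * volume (tube Ω '' B) := by
    refine hΩ.isCompact_frontier.induction_on
      (p := fun A₀ => ∃ A, MeasurableSet A ∧ A₀ ⊆ A ∧ ∃ r > 0, r ≤ r₀ ∧
        ∀ B ⊆ (frontier Ω ∩ A) ×ˢ Icc 0 r, MeasurableSet B →
        volume (tube Ω '' B) ≤ C * ((surface Ω).prod volume) B ∧
        ((surface Ω).prod volume) B ≤ C * volume (tube Ω '' B)) ?_ ?_ ?_ ?_
    · refine ⟨∅, MeasurableSet.empty, subset_rfl, r₀, hr₀, le_rfl, fun B hB _ => ?_⟩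
      simp only [inter_empty, empty_prod, subset_empty_iff] at hB
      simp [hB]
    · rintro A₀ A₁ hAA ⟨A, hAm, hA, h⟩
      exact ⟨A, hAm, hAA.trans hA, h⟩
    · rintro A₀ A₁ ⟨A, hAm, hA, r, hr, hrr, h⟩ ⟨A', hAm', hA', r', hr', hrr', h'⟩
      refine ⟨A ∪ A', hAm.union hAm', union_subset_union hA hA', min r r', lt_min hr hr',
        (min_le_left _ _).trans hrr, fun B hB hBm => ?_⟩
      have hD : MeasurableSet (A ×ˢ (univ : Set ℝ)) := hAm.prod MeasurableSet.univ
      have b1 := h (B ∩ A ×ˢ univ) (fun z hz => ⟨⟨(hB hz.1).1.1, hz.2.1⟩, (hB hz.1).2.1,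
        (hB hz.1).2.2.trans (min_le_left _ _)⟩) (hBm.inter hD)
      have b2 := h' (B \ A ×ˢ univ) (fun z hz => ⟨⟨(hB hz.1).1.1,
        (hB hz.1).1.2.resolve_left fun ha => hz.2 ⟨ha, mem_univ _⟩⟩, (hB hz.1).2.1,
        (hB hz.1).2.2.trans (min_le_right _ _)⟩) (hBm.diff hD)
      have hBi : B ⊆ frontier Ω ×ˢ Icc 0 r₀ := fun z hz => ⟨(hB hz).1.1, (hB hz).2.1,
        (hB hz).2.2.trans ((min_le_left _ _).trans hrr)⟩
      have hmeas : MeasurableSet (tube Ω '' (B \ A ×ˢ univ)) :=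
        (hBm.diff hD).image_of_continuousOn_injOn
          (hΩ.continuousOn_tube.mono fun z hz => ⟨(hB hz.1).1.1, mem_univ _⟩)
          (hinj.mono (sdiff_subset.trans hBi))
      have hsplit : volume (tube Ω '' B)
          = volume (tube Ω '' (B ∩ A ×ˢ univ)) + volume (tube Ω '' (B \ A ×ˢ univ)) := by
        rw [← measure_union _ hmeas, ← image_union, inter_union_sdiff]
        exact disjoint_image_image fun z hz w hw he => hw.2 (hinj (hBi hz.1) (hBi hw.1) he ▸ hz.2)
      rw [hsplit, ← measure_inter_add_sdiff B hD, mul_add, mul_add]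
      exact ⟨add_le_add b1.1 b2.1, add_le_add b1.2 b2.2⟩
    · intro p hp
      obtain ⟨r, hr, -, h⟩ := hΩ.exists_volume_tube_image hp hK
      refine ⟨Metric.closedBall p r,
        mem_nhdsWithin_of_mem_nhds (Metric.closedBall_mem_nhds p hr), Metric.closedBall p r,
        Metric.isClosed_closedBall.measurableSet, subset_rfl, min r r₀, lt_min hr hr₀,
        min_le_right _ _, fun B hB hBm => ?_⟩
      have e : ((surface Ω).prod volume) B
          = ∫⁻ σ : ℝ, (Measure.euclideanHausdorffMeasure 2 : Measure E3) {x | (x, σ) ∈ B} := by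
        rw [Measure.prod_apply_symm hBm]
        refine lintegral_congr fun σ => ?_
        rw [surface, Measure.restrict_apply (measurable_prodMk_right hBm),
          inter_eq_self_of_subset_left]
        · rfl
        · exact fun x hx => (hB hx).1.1
      rw [e]
      have := h B (fun z hz => ⟨(hB hz).1, (hB hz).2.1, (hB hz).2.2.trans (min_le_left _ _)⟩) hBm
      exact ⟨this.1.trans (by gcongr), this.2.trans (by gcongr)⟩
  exact ⟨r, hr, fun B hB => h B fun z hz => ⟨⟨(hB hz).1, hA (hB hz).1⟩, (hB hz).2⟩⟩

/-- In normal coordinates, Lebesgue measure on a thin boundary strip is comparable with the product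
of surface measure and Lebesgue measure on an interval, with a constant which tends to one as the
strip gets thinner. -/
theorem exists_restrict_strip_le {C : NNReal} (hC : 1 < C) :
    ∃ ε₀ > 0, ∀ ε ∈ Ioc 0 ε₀,
      volume.restrict (Ω ∩ strip Ω ε) ≤ C • tubeMeasure Ω ε ∧
      tubeMeasure Ω ε ≤ C • volume.restrict (Ω ∩ strip Ω ε) := by
  have := hΩ.isFiniteMeasure_surface
  obtain ⟨r₁, hr₁, h₁⟩ := hΩ.exists_tube_mem
  obtain ⟨r₂, hr₂, h₂⟩ := hΩ.exists_volume_tube_image_global hC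
  refine ⟨min r₁ r₂, lt_min hr₁ hr₂, fun ε hε => ?_⟩
  have hε1 : ε ≤ r₁ := hε.2.trans (min_le_left _ _)
  have hε2 : ε ≤ r₂ := hε.2.trans (min_le_right _ _)
  have hstrip : Ω ∩ strip Ω ε = tube Ω '' (frontier Ω ×ˢ Ioo 0 ε) := by
    ext y
    constructor
    · rintro ⟨hy, x, n, hn, σ, hσ, rfl⟩
      obtain ⟨hx, rfl⟩ := hΩ.isOutwardNormal_iff.1 hn
      refine ⟨(x, σ), ⟨hx, lt_of_le_of_ne hσ.1 ?_, hσ.2⟩, rfl⟩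
      rintro rfl
      rw [hΩ.isOpen.frontier_eq] at hx
      exact hx.2 (by simpa using hy)
    · rintro ⟨⟨x, σ⟩, ⟨hx, hσ⟩, rfl⟩
      exact ⟨h₁ x hx σ ⟨hσ.1, hσ.2.trans_le hε1⟩, x, _, hΩ.isOutwardNormal_normal hx, σ,
        ⟨hσ.1.le, hσ.2⟩, rfl⟩
  have key : ∀ S, MeasurableSet S →
      volume.restrict (Ω ∩ strip Ω ε) S ≤ C * tubeMeasure Ω ε S ∧
      tubeMeasure Ω ε S ≤ C * volume.restrict (Ω ∩ strip Ω ε) S := by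
    intro S hS
    set B := tube Ω ⁻¹' S ∩ frontier Ω ×ˢ Ioo 0 ε with hB
    have hBm : MeasurableSet B := (hΩ.measurable_tube hS).inter
      (isClosed_frontier.measurableSet.prod measurableSet_Ioo)
    have e1 : volume.restrict (Ω ∩ strip Ω ε) S = volume (tube Ω '' B) := by
      rw [Measure.restrict_apply hS, hstrip, hB, image_preimage_inter]
    have e2 : tubeMeasure Ω ε S = ((surface Ω).prod volume) B := by
      have : ((surface Ω).prod volume).restrict (frontier Ω ×ˢ Ioo 0 ε)
          = (surface Ω).prod (volume.restrict (Ioo 0 ε)) := by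
        rw [← Measure.prod_restrict, surface, Measure.restrict_restrict
          isClosed_frontier.measurableSet, inter_self]
      rw [tubeMeasure, Measure.map_apply hΩ.measurable_tube hS, ← this,
        Measure.restrict_apply (hΩ.measurable_tube hS)]
    rw [e1, e2]
    exact h₂ B (fun z hz => ⟨hz.2.1, hz.2.2.1.le, hz.2.2.2.le.trans hε2⟩) hBm
  constructor
  · exact Measure.le_iff.2 fun S hS => by simpa using (key S hS).1
  · exact Measure.le_iff.2 fun S hS => by simpa using (key S hS).2

end IsSmoothBoundedDomain

/-! ### Mollification and translation in `L²` -/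

open scoped Convolution

variable {V : Type*} [NormedAddCommGroup V] [NormedSpace ℝ V]

lemma inner_gradient (φ : E3 → ℝ) (x v : E3) : ⟪gradient φ x, v⟫ = fderiv ℝ φ x v := by
  simp [gradient]

/-- Jensen's inequality for the square and a probability measure. -/
lemma sq_lintegral_le {S : Type*} [MeasurableSpace S] (κ : Measure S) [IsProbabilityMeasure κ]
    {f : S → ℝ≥0∞} (hf : AEMeasurable f κ) : (∫⁻ s, f s ∂κ) ^ 2 ≤ ∫⁻ s, f s ^ 2 ∂κ := by
  have h := ENNReal.lintegral_mul_le_Lp_mul_Lq κ Real.HolderConjugate.two_two hf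
    (aemeasurable_const (b := (1 : ℝ≥0∞)))
  simp only [Pi.mul_apply, mul_one, lintegral_const, measure_univ, ENNReal.rpow_two, one_pow,
    ENNReal.one_rpow] at h
  calc (∫⁻ s, f s ∂κ) ^ 2 ≤ ((∫⁻ s, f s ^ 2 ∂κ) ^ (1 / 2 : ℝ)) ^ 2 := by gcongr
    _ = _ := by
      rw [← ENNReal.rpow_natCast, ← ENNReal.rpow_mul]
      norm_num

/-- A uniform bound for the `L²` norms of a family of functions bounds the `L²` norm of its
averages. -/
lemma lintegral_sq_lintegral_le {X S : Type*} [MeasurableSpace X] [MeasurableSpace S]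
    {μ : Measure X} [SFinite μ] {κ : Measure S} [IsProbabilityMeasure κ] {f : X → S → ℝ≥0∞}
    (hf : Measurable (Function.uncurry f)) {c : ℝ≥0∞} (hc : ∀ᵐ s ∂κ, ∫⁻ x, f x s ^ 2 ∂μ ≤ c) :
    ∫⁻ x, (∫⁻ s, f x s ∂κ) ^ 2 ∂μ ≤ c := by
  calc ∫⁻ x, (∫⁻ s, f x s ∂κ) ^ 2 ∂μ ≤ ∫⁻ x, ∫⁻ s, f x s ^ 2 ∂κ ∂μ :=
        lintegral_mono fun x => sq_lintegral_le κ (hf.of_uncurry_left).aemeasurable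
    _ = ∫⁻ s, ∫⁻ x, f x s ^ 2 ∂μ ∂κ := by
        refine lintegral_lintegral_swap ?_
        exact (hf.pow_const 2).aemeasurable
    _ ≤ ∫⁻ _, c ∂κ := lintegral_mono_ae hc
    _ = c := by simp

omit [NormedSpace ℝ V] in
lemma eLpNorm_two_sq {X : Type*} [MeasurableSpace X] (μ : Measure X) (f : X → V) :
    eLpNorm f 2 μ ^ 2 = ∫⁻ x, ‖f x‖ₑ ^ 2 ∂μ := by
  have := eLpNorm_nnreal_pow_eq_lintegral (f := f) (μ := μ) (p := 2) (by norm_num)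
  simpa using this

/-- A smooth probability density with compact support. -/
structure IsMollifier (k : E3 → ℝ) : Prop where
  contDiff : ContDiff ℝ ∞ k
  hasCompactSupport : HasCompactSupport k
  nonneg : ∀ x, 0 ≤ k x
  integral_eq_one : ∫ x, k x = 1

/-- The convolution of `F` with the kernel `k`. -/
def mollify (k : E3 → ℝ) (F : E3 → V) : E3 → V :=
  k ⋆[ContinuousLinearMap.lsmul ℝ ℝ, volume] F

namespace IsMollifier

variable {k : E3 → ℝ} (hk : IsMollifier k) {F : E3 → V}
include hk

lemma integrable : Integrable k :=
  hk.contDiff.continuous.integrable_of_hasCompactSupport hk.hasCompactSupport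

/-- A mollifier as the density of a probability measure, so that Jensen's inequality applies. -/
lemma isProbabilityMeasure :
    IsProbabilityMeasure ((volume : Measure E3).withDensity fun s => ENNReal.ofReal (k s)) := by
  refine ⟨?_⟩
  rw [withDensity_apply _ MeasurableSet.univ, Measure.restrict_univ,
    ← ofReal_integral_eq_lintegral_ofReal hk.integrable (ae_of_all _ hk.nonneg),
    hk.integral_eq_one, ENNReal.ofReal_one]

lemma contDiff_mollify (hF : LocallyIntegrable F) : ContDiff ℝ ∞ (mollify k F) :=
  hk.hasCompactSupport.contDiff_convolution_left (n := ⊤) _ hk.contDiff hF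

lemma integrable_smul (hF : LocallyIntegrable F) (x : E3) :
    Integrable (fun s => k s • F (x - s)) :=
  hk.hasCompactSupport.convolutionExists_left (ContinuousLinearMap.lsmul ℝ ℝ)
    hk.contDiff.continuous hF x

lemma mollify_sub [CompleteSpace V] (hF : LocallyIntegrable F) (x : E3) :
    mollify k F x - F x = ∫ s, k s • (F (x - s) - F x) := by
  have e : F x = ∫ s, k s • F x := by
    rw [integral_smul_const, hk.integral_eq_one, one_smul]
  simp_rw [smul_sub]
  rw [integral_sub (hk.integrable_smul hF x) (hk.integrable.smul_const _), ← e]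
  rfl

/-- Convolution with `k` changes a function in `L²` by at most what translations by the points of
the support of `k` do. -/
lemma eLpNorm_mollify_sub_le [CompleteSpace V] (hF : LocallyIntegrable F)
    (hFm : StronglyMeasurable F) (A : Set E3) {c : ℝ≥0∞}
    (hc : ∀ s ∈ Function.support k,
      eLpNorm (fun x => F (x - s) - F x) 2 (volume.restrict A) ≤ c) :
    eLpNorm (fun x => mollify k F x - F x) 2 (volume.restrict A) ≤ c := by
  have := hk.isProbabilityMeasure
  have hkm : Measurable fun s => ENNReal.ofReal (k s) :=
    hk.contDiff.continuous.measurable.ennreal_ofReal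
  refine (ENNReal.pow_le_pow_left_iff two_ne_zero).1 ?_
  rw [eLpNorm_two_sq]
  have hm : Measurable (Function.uncurry fun x s : E3 => ‖F (x - s) - F x‖ₑ) := by
    have h1 : StronglyMeasurable fun z : E3 × E3 => F (z.1 - z.2) - F z.1 :=
      (hFm.comp_measurable (by fun_prop)).sub (hFm.comp_measurable (by fun_prop))
    exact h1.enorm
  refine le_trans (lintegral_mono fun x => ?_)
    (lintegral_sq_lintegral_le (μ := volume.restrict A) hm (c := c ^ 2) ?_
      (κ := (volume : Measure E3).withDensity fun s => ENNReal.ofReal (k s)))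
  · gcongr
    rw [hk.mollify_sub hF x, lintegral_withDensity_eq_lintegral_mul _ hkm
      (hm.of_uncurry_left (x := x))]
    refine (enorm_integral_le_lintegral_enorm _).trans (le_of_eq ?_)
    refine lintegral_congr fun s => ?_
    rw [enorm_smul, Pi.mul_apply, Real.enorm_of_nonneg (hk.nonneg s)]
  · rw [ae_withDensity_iff hkm]
    refine ae_of_all _ fun s hs => ?_
    rw [← eLpNorm_two_sq]
    gcongr
    exact hc s fun h0 => hs (by simp [h0])

end IsMollifier

omit [NormedSpace ℝ V] in
/-- Translation is continuous in `L²`. -/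
lemma tendsto_eLpNorm_translate_sub [CompleteSpace V] {F : E3 → V} (hF : MemLp F 2 volume) :
    Tendsto (fun s : E3 => eLpNorm (fun x => F (x - s) - F x) 2 volume) (𝓝 0) (𝓝 0) := by
  have : Fact ((2 : ℝ≥0∞) ≠ ⊤) := ⟨by simp⟩
  have hc : Continuous fun s : E3 => (DomAddAct.mk (-s)) +ᵥ hF.toLp F := by
    have : Continuous fun s : E3 => DomAddAct.mk (-s) :=
      DomAddAct.continuous_mk.comp continuous_neg
    exact this.vadd continuous_const
  have h1 : Tendsto (fun s : E3 => edist ((DomAddAct.mk (-s)) +ᵥ hF.toLp F) (hF.toLp F))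
      (𝓝 0) (𝓝 0) := by
    have h2 : Continuous fun s : E3 => edist ((DomAddAct.mk (-s)) +ᵥ hF.toLp F) (hF.toLp F) :=
      hc.edist continuous_const
    have h3 := h2.tendsto 0
    simpa using h3
  refine h1.congr fun s => ?_
  rw [DomAddAct.mk_vadd_toLp, Lp.edist_toLp_toLp]
  refine eLpNorm_congr_ae (ae_of_all _ fun x => ?_)
  simp [sub_eq_neg_add]

/-- A difference quotient of a smooth function is controlled in `L²` by its gradient. -/
lemma eLpNorm_translate_sub_le {φ : E3 → ℝ} (hφ : ContDiff ℝ ∞ φ) {A : Set E3} {s : E3}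
    (hA : MeasurableSet A) (hΩ : MeasurableSet Ω)
    (hs : ∀ x ∈ A, ∀ τ ∈ Icc (0 : ℝ) 1, x - τ • s ∈ Ω) :
    eLpNorm (fun x => φ (x - s) - φ x) 2 (volume.restrict A)
      ≤ ‖s‖ₑ * eLpNorm (gradient φ) 2 (volume.restrict Ω) := by
  have hgc : Continuous (gradient φ) :=
    (InnerProductSpace.toDual ℝ E3).symm.continuous.comp (hφ.continuous_fderiv (by simp))
  have hprob : IsProbabilityMeasure (volume.restrict (Ioc (0 : ℝ) 1)) := ⟨by simp⟩
  refine (ENNReal.pow_le_pow_left_iff two_ne_zero).1 ?_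
  rw [eLpNorm_two_sq]
  have hm : Measurable (Function.uncurry fun (x : E3) (τ : ℝ) => ‖s‖ₑ * ‖gradient φ (x - τ • s)‖ₑ) := by
    have : Continuous fun z : E3 × ℝ => gradient φ (z.1 - z.2 • s) := hgc.comp (by fun_prop)
    exact measurable_const.mul this.enorm.measurable
  refine le_trans (lintegral_mono fun x => ?_)
    (lintegral_sq_lintegral_le (μ := volume.restrict A) (κ := volume.restrict (Ioc (0 : ℝ) 1)) hm ?_)
  · gcongr
    have hd : ∀ τ ∈ uIcc (0 : ℝ) 1, HasDerivAt (fun τ : ℝ => φ (x - τ • s))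
        (-⟪gradient φ (x - τ • s), s⟫) τ := by
      intro τ _
      have h1 : HasFDerivAt φ (fderiv ℝ φ (x - τ • s)) (x - τ • s) :=
        (hφ.differentiable (by simp) _).hasFDerivAt
      have h2 : HasDerivAt (fun τ : ℝ => x - τ • s) (-((1 : ℝ) • s)) τ :=
        ((hasDerivAt_id τ).smul_const s).const_sub x
      have e : -⟪gradient φ (x - τ • s), s⟫ = fderiv ℝ φ (x - τ • s) (-((1 : ℝ) • s)) := by
        simp
      rw [e]
      exact h1.comp_hasDerivAt τ h2
    have hint : IntervalIntegrable (fun τ : ℝ => -⟪gradient φ (x - τ • s), s⟫) volume 0 1 := by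
      refine Continuous.intervalIntegrable ?_ _ _
      exact ((hgc.comp (by fun_prop)).inner continuous_const).neg
    have h0 := intervalIntegral.integral_eq_sub_of_hasDerivAt hd hint
    simp only [one_smul, zero_smul, sub_zero] at h0
    rw [← h0, intervalIntegral.integral_of_le zero_le_one]
    refine (enorm_integral_le_lintegral_enorm _).trans (lintegral_mono fun τ => ?_)
    rw [enorm_neg, mul_comm, ← ofReal_norm, ← ofReal_norm, ← ofReal_norm,
      ← ENNReal.ofReal_mul (norm_nonneg _)]
    exact ENNReal.ofReal_le_ofReal (norm_inner_le_norm _ _)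
  · refine (ae_restrict_iff' measurableSet_Ioc).2 (ae_of_all _ fun τ hτ => ?_)
    simp_rw [mul_pow]
    rw [lintegral_const_mul _ (by
      have : Continuous fun x : E3 => gradient φ (x - τ • s) := hgc.comp (by fun_prop)
      exact this.enorm.measurable.pow_const 2), eLpNorm_two_sq]
    refine mul_le_mul' le_rfl ?_
    rw [← lintegral_indicator hA, ← lintegral_indicator hΩ,
      ← lintegral_sub_right_eq_self (fun x => Ω.indicator (fun y => ‖gradient φ y‖ₑ ^ 2) x) (τ • s)]
    refine lintegral_mono fun x => ?_
    by_cases hx : x ∈ A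
    · rw [indicator_of_mem hx, indicator_of_mem (hs x hx τ (Ioc_subset_Icc_self hτ))]
    · rw [indicator_of_notMem hx]
      exact zero_le

/-! ### Mollification of Sobolev functions and partitions adapted to interior cones -/

/-- Extension by zero of a square integrable function on `Ω`. -/
def zeroExtend (w : Lp V 2 (volume.restrict Ω)) : E3 → V := Ω.indicator w

omit [NormedSpace ℝ V] in
lemma memLp_zeroExtend (hΩ : MeasurableSet Ω) (w : Lp V 2 (volume.restrict Ω)) :
    MemLp (zeroExtend w) 2 volume :=
  (memLp_indicator_iff_restrict hΩ).2 (Lp.memLp w)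

omit [NormedSpace ℝ V] in
lemma stronglyMeasurable_zeroExtend (hΩ : MeasurableSet Ω) (w : Lp V 2 (volume.restrict Ω)) :
    StronglyMeasurable (zeroExtend w) :=
  (Lp.stronglyMeasurable w).indicator hΩ

omit [NormedSpace ℝ V] in
lemma locallyIntegrable_zeroExtend (hΩ : MeasurableSet Ω) (w : Lp V 2 (volume.restrict Ω)) :
    LocallyIntegrable (zeroExtend w) :=
  (memLp_zeroExtend hΩ w).locallyIntegrable (by norm_num)

omit [NormedSpace ℝ V] in
lemma zeroExtend_of_mem (w : Lp V 2 (volume.restrict Ω)) {x : E3} (hx : x ∈ Ω) :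
    zeroExtend w x = w x := indicator_of_mem hx _

omit [NormedSpace ℝ V] in
lemma zeroExtend_ae_eq (hΩ : MeasurableSet Ω) (w : Lp V 2 (volume.restrict Ω)) :
    zeroExtend w =ᵐ[volume.restrict Ω] w :=
  (ae_restrict_iff' hΩ).2 (ae_of_all _ fun _ hx => zeroExtend_of_mem w hx)

lemma IsMollifier.fderiv_mollify_apply {k : E3 → ℝ} (hk : IsMollifier k) {F : E3 → ℝ}
    (hF : LocallyIntegrable F) (x v : E3) :
    fderiv ℝ (mollify k F) x v = ∫ y, fderiv ℝ k (x - y) v * F y := by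
  have hk1 : ContDiff ℝ 1 k := hk.contDiff.of_le (by norm_cast)
  have h := hk.hasCompactSupport.hasFDerivAt_convolution_left
    (ContinuousLinearMap.lsmul ℝ ℝ) hk1 hF x
  have hex := (hk.hasCompactSupport.fderiv (𝕜 := ℝ)).convolutionExists_left
    ((ContinuousLinearMap.lsmul ℝ ℝ : ℝ →L[ℝ] ℝ →L[ℝ] ℝ).precompL E3)
    (hk.contDiff.continuous_fderiv (by simp)) hF x
  rw [mollify, h.fderiv, convolution_def, ContinuousLinearMap.integral_apply hex,
    ← integral_sub_left_eq_self _ volume x]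
  simp [ContinuousLinearMap.precompL_apply]

/-- The gradient of a mollification of `u` at `x` is the mollification of the weak gradient, if
the translates of `x` by the support of the kernel lie in `Ω`. -/
lemma IsMollifier.gradient_mollify {k : E3 → ℝ} (hk : IsMollifier k) (hΩ : MeasurableSet Ω)
    (u : H1 Ω) {x : E3} (hx : ∀ s ∈ tsupport k, x - s ∈ Ω) :
    gradient (mollify k (zeroExtend u.val)) x = mollify k (zeroExtend u.grad) x := by
  refine ext_inner_right ℝ fun v => ?_
  rw [inner_gradient, hk.fderiv_mollify_apply (locallyIntegrable_zeroExtend hΩ _)]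
  set ψ : E3 → ℝ := fun y => k (x - y) with hψ
  have hψs : ContDiff ℝ ∞ ψ := hk.contDiff.comp (contDiff_const.sub contDiff_id)
  have hψc : HasCompactSupport ψ := hk.hasCompactSupport.comp_homeomorph (Homeomorph.subLeft x)
  have hψt : tsupport ψ ⊆ Ω := by
    intro y hy
    have : x - y ∈ tsupport k := by
      have h1 := tsupport_comp_subset_preimage k (f := fun y => x - y) (by fun_prop)
      exact h1 hy
    simpa using hx _ this
  have hψd : ∀ y, fderiv ℝ ψ y v = - fderiv ℝ k (x - y) v := by
    intro y
    have h1 : HasFDerivAt k (fderiv ℝ k (x - y)) (x - y) :=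
      (hk.contDiff.differentiable (by simp) _).hasFDerivAt
    have h2 : HasFDerivAt (fun y : E3 => x - y) (-ContinuousLinearMap.id ℝ E3) y :=
      (hasFDerivAt_id y).const_sub x
    have := (h1.comp y h2).fderiv
    rw [hψ]
    change fderiv ℝ (k ∘ fun y => x - y) y v = _
    rw [this]
    simp
  have hw := u.2 ψ hψs hψc hψt v
  have e1 : ∫ y, fderiv ℝ k (x - y) v * zeroExtend u.val y
      = - ∫ y in Ω, u.val y * fderiv ℝ ψ y v := by
    rw [← integral_indicator hΩ, ← integral_neg]
    refine integral_congr_ae (ae_of_all _ fun y => ?_)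
    by_cases hy : y ∈ Ω
    · simp [zeroExtend, hy, hψd, mul_comm]
    · simp [zeroExtend, hy]
  have e2 : ⟪mollify k (zeroExtend u.grad) x, v⟫ = ∫ y in Ω, ⟪u.grad y, v⟫ * ψ y := by
    rw [real_inner_comm, ← integral_indicator hΩ, ← integral_sub_left_eq_self _ volume x, mollify,
      convolution_def, ← integral_inner]
    · refine integral_congr_ae (ae_of_all _ fun y => ?_)
      by_cases hy : x - y ∈ Ω
      · simp [zeroExtend, hy, hψ, inner_smul_right, real_inner_comm, mul_comm]
      · simp [zeroExtend, hy]
    · exact hk.integrable_smul (locallyIntegrable_zeroExtend hΩ _) x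
  rw [e1, e2]
  exact (neg_eq_iff_eq_neg.2 hw)

/-- Mollifiers supported near the origin converge to the identity in `L²`. -/
lemma exists_eLpNorm_mollify_sub_le [CompleteSpace V] {F : E3 → V} (hF : MemLp F 2 volume)
    (hFm : StronglyMeasurable F) {η : ℝ≥0∞} (hη : 0 < η) :
    ∃ r > 0, ∀ k : E3 → ℝ, IsMollifier k → (∀ s ∈ tsupport k, ‖s‖ ≤ r) →
      eLpNorm (fun x => mollify k F x - F x) 2 volume ≤ η := by
  have h := (tendsto_eLpNorm_translate_sub hF).eventually (ge_mem_nhds hη)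
  obtain ⟨r, hr, hr'⟩ := Metric.eventually_nhds_iff.1 h
  refine ⟨r / 2, by positivity, fun k hk hs => ?_⟩
  have := hk.eLpNorm_mollify_sub_le (hF.locallyIntegrable (by norm_num)) hFm univ (c := η)
    (fun s hs' => ?_)
  · rwa [Measure.restrict_univ] at this
  · rw [Measure.restrict_univ]
    refine hr' ?_
    rw [dist_zero_right]
    exact lt_of_le_of_lt (hs s (subset_tsupport k hs')) (by linarith)

/-- A mollifier which moves points in the directions of the ball of radius `1/2` about `e`. -/
lemma exists_mollifier (e : E3) {t : ℝ} (ht : 0 < t) :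
    ∃ k : E3 → ℝ, IsMollifier k ∧ ∀ s ∈ tsupport k, ∃ d ∈ Metric.closedBall e (1 / 2),
      s = -(t • d) := by
  let b : ContDiffBump (-(t • e)) := ⟨t / 4, t / 2, by positivity, by linarith⟩
  refine ⟨b.normed volume, ⟨b.contDiff_normed, b.hasCompactSupport_normed, b.nonneg_normed,
    b.integral_normed⟩, fun s hs => ?_⟩
  rw [b.tsupport_normed_eq] at hs
  refine ⟨-(t⁻¹ • s), ?_, by rw [smul_neg, smul_inv_smul₀ ht.ne', neg_neg]⟩
  have h1 : ‖s + t • e‖ ≤ t / 2 := by simpa [dist_eq_norm, b] using hs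
  rw [Metric.mem_closedBall, dist_eq_norm]
  have e1 : -(t⁻¹ • s) - e = -(t⁻¹ • (s + t • e)) := by
    rw [smul_add, inv_smul_smul₀ ht.ne']
    abel
  rw [e1, norm_neg, norm_smul, norm_inv, Real.norm_of_nonneg ht.le, inv_mul_le_iff₀ ht]
  linarith

/-- A finite smooth partition of unity on the closure of `Ω`. On the support of each member, `Ω`
satisfies an interior cone condition with a fixed cone, whose directions form the ball of radius
`1/2` about `e i` and whose height is `r`. -/
structure IsConePartition (Ω : Set E3) {ι : Type} [Fintype ι] (ζ : ι → E3 → ℝ) (e : ι → E3)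
    (r : ℝ) : Prop where
  pos : 0 < r
  contDiff : ∀ i, ContDiff ℝ ∞ (ζ i)
  hasCompactSupport : ∀ i, HasCompactSupport (ζ i)
  nonneg : ∀ i x, 0 ≤ ζ i x
  le_one : ∀ i x, ζ i x ≤ 1
  sum_eq_one : ∀ x ∈ closure Ω, ∑ i, ζ i x = 1
  norm_le_one : ∀ i, ‖e i‖ ≤ 1
  cone : ∀ i, ∀ x ∈ Ω, x ∈ tsupport (ζ i) → ∀ t ∈ Ioo 0 r, ∀ d ∈ Metric.closedBall (e i) (1 / 2),
    x + t • d ∈ Ω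

open Manifold in
/-- The cone condition holds near each point of the compact closure; a partition of unity
subordinate to finitely many of these neighbourhoods is as required. -/
lemma IsSmoothBoundedDomain.exists_conePartition (hΩ : IsSmoothBoundedDomain Ω) :
    ∃ (ι : Type) (_ : Fintype ι) (ζ : ι → E3 → ℝ) (e : ι → E3) (r : ℝ),
      IsConePartition Ω ζ e r := by
  choose! e he r hr h using fun p (hp : p ∈ closure Ω) => hΩ.exists_cone hp
  obtain ⟨s, hs, hcov⟩ := hΩ.isCompact_closure.elim_nhds_subcover (fun p => Metric.ball p (r p))
    (fun p hp => Metric.ball_mem_nhds p (hr p hp))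
  obtain ⟨f, hf⟩ := SmoothPartitionOfUnity.exists_isSubordinate 𝓘(ℝ, E3) isClosed_closure
    (fun i : Fin s.card => Metric.ball (s.equivFin.symm i : E3) (r (s.equivFin.symm i)))
    (fun i => Metric.isOpen_ball) (fun x hx => by
      obtain ⟨p, hp, hxp⟩ := mem_iUnion₂.1 (hcov hx)
      exact mem_iUnion.2 ⟨s.equivFin ⟨p, hp⟩, by simpa using hxp⟩)
  have hmem : ∀ i : Fin s.card, (s.equivFin.symm i : E3) ∈ closure Ω := fun i => hs _ (by simp)
  obtain ⟨r₀, hr₀, hr₀'⟩ : ∃ r₀ > 0, ∀ i : Fin s.card, r₀ ≤ r (s.equivFin.symm i) := by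
    obtain ⟨r₀, hr₀, hmin⟩ := exists_min_image _ id
      ((finite_range fun i : Fin s.card => r (s.equivFin.symm i)).insert 1) (insert_nonempty _ _)
    refine ⟨r₀, ?_, fun i => hmin _ (Or.inr ⟨i, rfl⟩)⟩
    rcases hr₀ with h1 | ⟨i, hi⟩
    · rw [h1]; exact one_pos
    · rw [← hi]; exact hr _ (hmem i)
  refine ⟨Fin s.card, inferInstance, fun i => f i, fun i => e (s.equivFin.symm i), r₀, hr₀,
    fun i => (f i).contMDiff.contDiff, fun i => ?_, fun i x => f.nonneg i x, fun i x => f.le_one i x,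
    fun x hx => ?_, fun i => he _ (hmem i), fun i x hx hxi t ht d hd => ?_⟩
  · exact HasCompactSupport.of_support_subset_isCompact (isCompact_closedBall _ _)
      ((subset_tsupport _).trans ((hf i).trans Metric.ball_subset_closedBall))
  · rw [← f.sum_eq_one hx, finsum_eq_sum_of_fintype]
  · exact h _ (hmem i) x ⟨subset_closure hx, hf i hxi⟩ t ⟨ht.1, ht.2.trans_le (hr₀' i)⟩ d hd

/-! ### Density of smooth functions in `H¹(Ω)` -/

lemma H1.norm_sq_eq (u : H1 Ω) : ‖u‖ ^ 2 = ‖u.val‖ ^ 2 + ‖u.grad‖ ^ 2 :=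
  WithLp.prod_norm_sq_eq_of_L2 u.1

lemma H1.norm_val_le (u : H1 Ω) : ‖u.val‖ ≤ ‖u‖ :=
  (le_abs_self _).trans (abs_le_of_sq_le_sq
    (by rw [u.norm_sq_eq]; nlinarith [sq_nonneg ‖u.grad‖]) (norm_nonneg _))

lemma H1.norm_grad_le (u : H1 Ω) : ‖u.grad‖ ≤ ‖u‖ := by
  refine (le_abs_self _).trans (abs_le_of_sq_le_sq ?_ (norm_nonneg _))
  rw [u.norm_sq_eq]
  nlinarith [sq_nonneg ‖u.val‖]

lemma H1.norm_le (u : H1 Ω) : ‖u‖ ≤ ‖u.val‖ + ‖u.grad‖ := by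
  refine (le_abs_self _).trans (abs_le_of_sq_le_sq ?_ (by positivity))
  rw [u.norm_sq_eq]
  nlinarith [mul_nonneg (norm_nonneg u.val) (norm_nonneg u.grad)]

namespace IsConePartition

variable {ι : Type} [Fintype ι] {ζ : ι → E3 → ℝ} {e : ι → E3} {r : ℝ}
  (hζ : IsConePartition Ω ζ e r)
include hζ

/-- The members of the partition add up to a constant on the open set `Ω`, so their gradients
cancel. -/
lemma sum_gradient_eq_zero (hΩ : IsOpen Ω) {x : E3} (hx : x ∈ Ω) : ∑ i, gradient (ζ i) x = 0 := by
  have hd : ∀ i ∈ Finset.univ, DifferentiableAt ℝ (ζ i) x :=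
    fun i _ => (hζ.contDiff i).differentiable (by simp) x
  have h1 : (fun y => ∑ i, ζ i y) =ᶠ[𝓝 x] fun _ => 1 := by
    filter_upwards [hΩ.mem_nhds hx] with y hy using hζ.sum_eq_one y (subset_closure hy)
  have h2 : fderiv ℝ (fun y => ∑ i, ζ i y) x = 0 := by
    rw [h1.fderiv_eq]
    simp
  rw [fderiv_fun_sum hd] at h2
  simp only [gradient]
  rw [← map_sum, h2, map_zero]

lemma exists_norm_gradient_le : ∃ M ≥ (0 : ℝ), ∀ i x, ‖gradient (ζ i) x‖ ≤ M := by
  have h : ∀ i, ∃ M, ∀ x, ‖fderiv ℝ (ζ i) x‖ ≤ M := fun i =>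
    ((hζ.hasCompactSupport i).fderiv (𝕜 := ℝ)).exists_bound_of_continuous
      ((hζ.contDiff i).continuous_fderiv (by simp))
  choose M hM using h
  have hM0 : ∀ i, 0 ≤ M i := fun i => (norm_nonneg _).trans (hM i 0)
  refine ⟨∑ i, M i, Finset.sum_nonneg fun i _ => hM0 i, fun i x => ?_⟩
  refine le_trans ?_ (Finset.single_le_sum (fun i _ => hM0 i) (Finset.mem_univ i))
  simpa [gradient] using hM i x

end IsConePartition

lemma gradient_mul {f g : E3 → ℝ} {x : E3} (hf : DifferentiableAt ℝ f x)
    (hg : DifferentiableAt ℝ g x) :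
    gradient (fun y => f y * g y) x = f x • gradient g x + g x • gradient f x := by
  simp only [gradient]
  rw [fderiv_fun_mul hf hg, map_add, map_smulₛₗ, map_smulₛₗ]
  simp

lemma gradient_sum {ι : Type*} (s : Finset ι) {f : ι → E3 → ℝ} {x : E3}
    (hf : ∀ i ∈ s, DifferentiableAt ℝ (f i) x) :
    gradient (fun y => ∑ i ∈ s, f i y) x = ∑ i ∈ s, gradient (f i) x := by
  simp only [gradient]
  rw [fderiv_fun_sum hf, map_sum]

lemma toH1_val_ae_eq (φ : smoothFunctions Ω) : (toH1 φ).val =ᵐ[volume.restrict Ω] φ.1 :=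
  (memLp_val φ).coeFn_toLp

lemma toH1_grad_ae_eq (φ : smoothFunctions Ω) :
    (toH1 φ).grad =ᵐ[volume.restrict Ω] gradient φ.1 :=
  (memLp_gradient φ).coeFn_toLp

lemma toH1_sub_val_ae_eq (φ : smoothFunctions Ω) (u : H1 Ω) :
    (toH1 φ - u).val =ᵐ[volume.restrict Ω] fun x => φ.1 x - u.val x := by
  have h : (toH1 φ - u).val = (toH1 φ).val - u.val := rfl
  rw [h]
  filter_upwards [Lp.coeFn_sub (toH1 φ).val u.val, toH1_val_ae_eq φ] with x hx1 hx2
  rw [hx1, Pi.sub_apply, hx2]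

lemma toH1_sub_grad_ae_eq (φ : smoothFunctions Ω) (u : H1 Ω) :
    (toH1 φ - u).grad =ᵐ[volume.restrict Ω] fun x => gradient φ.1 x - u.grad x := by
  have h : (toH1 φ - u).grad = (toH1 φ).grad - u.grad := rfl
  rw [h]
  filter_upwards [Lp.coeFn_sub (toH1 φ).grad u.grad, toH1_grad_ae_eq φ] with x hx1 hx2
  rw [hx1, Pi.sub_apply, hx2]

lemma norm_Lp_le_of_eLpNorm_le {X V : Type*} [MeasurableSpace X] [NormedAddCommGroup V]
    {μ : Measure X} {w : Lp V 2 μ} {f : X → V} (hw : w =ᵐ[μ] f) {c : ℝ} (hc : 0 ≤ c)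
    (h : eLpNorm f 2 μ ≤ ENNReal.ofReal c) : ‖w‖ ≤ c := by
  rw [Lp.norm_def, eLpNorm_congr_ae hw]
  exact ENNReal.toReal_le_of_le_ofReal hc h

lemma eLpNorm_sum_le_card_mul {X V ι : Type*} [MeasurableSpace X] [NormedAddCommGroup V]
    [Fintype ι] {μ : Measure X} {f : ι → X → V} (hf : ∀ i, AEStronglyMeasurable (f i) μ)
    {c : ℝ≥0∞} (h : ∀ i, eLpNorm (f i) 2 μ ≤ c) :
    eLpNorm (fun x => ∑ i, f i x) 2 μ ≤ Fintype.card ι * c := by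
  have e : (fun x => ∑ i, f i x) = ∑ i, f i := by funext x; simp
  rw [e]
  refine (eLpNorm_sum_le (fun i _ => hf i) (by norm_num)).trans ?_
  refine (Finset.sum_le_card_nsmul _ _ c fun i _ => h i).trans (le_of_eq ?_)
  simp

namespace IsConePartition

variable {ι : Type} [Fintype ι] {ζ : ι → E3 → ℝ} {e : ι → E3} {r : ℝ}
  (hζ : IsConePartition Ω ζ e r) {V : Type*} [NormedAddCommGroup V] [NormedSpace ℝ V]
include hζ

/-- Mollifiers adapted to a partition, at a scale below `δ`: the translations in their supports move
the points of `Ω` in the support of `ζ i` along segments inside `Ω`. Hence the mollification at such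
points only takes values in `Ω` into account. -/
lemma exists_mollifiers {δ : ℝ} (hδ : 0 < δ) :
    ∃ k : ι → E3 → ℝ, (∀ i, IsMollifier (k i)) ∧ (∀ i, ∀ s ∈ tsupport (k i), ‖s‖ ≤ δ) ∧
      ∀ i, ∀ x ∈ Ω, x ∈ tsupport (ζ i) → ∀ s ∈ tsupport (k i), ∀ τ ∈ Icc (0 : ℝ) 1,
        x - τ • s ∈ Ω := by
  have hr := hζ.pos
  obtain ⟨t, ht0, ht⟩ : ∃ t > 0, t < min r (δ / 2) := exists_between (by positivity)
  choose k hk hks using fun i => exists_mollifier (e i) ht0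
  refine ⟨k, hk, fun i s hs => ?_, fun i x hx hxi s hs τ hτ => ?_⟩
  · obtain ⟨d, hd, rfl⟩ := hks i s hs
    have hd2 : ‖d‖ ≤ 2 := by
      have := norm_le_norm_add_norm_sub' d (e i)
      rw [Metric.mem_closedBall, dist_eq_norm] at hd
      linarith [hζ.norm_le_one i]
    rw [norm_neg, norm_smul, Real.norm_of_nonneg ht0.le]
    have := ht.le.trans (min_le_right _ _)
    nlinarith
  · rcases hτ.1.eq_or_lt with rfl | hτ0
    · simpa using hx
    · obtain ⟨d, hd, rfl⟩ := hks i s hs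
      rw [smul_neg, sub_neg_eq_add, smul_smul]
      have := ht.trans_le (min_le_left _ _)
      exact hζ.cone i x hx hxi _ ⟨by positivity, by nlinarith [hτ.2]⟩ d hd

/-- Local approximations glued by the partition approximate globally. -/
lemma eLpNorm_sum_smul_sub_le {F : E3 → V} {m : ι → E3 → V} (hΩ : MeasurableSet Ω)
    (hm : ∀ i, StronglyMeasurable (m i)) (hF : StronglyMeasurable F) {c : ℝ≥0∞}
    (h : ∀ i, eLpNorm (fun x => m i x - F x) 2 (volume.restrict (Ω ∩ tsupport (ζ i))) ≤ c) :
    eLpNorm (fun x => (∑ i, ζ i x • m i x) - F x) 2 (volume.restrict Ω)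
      ≤ Fintype.card ι * c := by
  have e1 : (fun x => (∑ i, ζ i x • m i x) - F x) =ᵐ[volume.restrict Ω]
      fun x => ∑ i, ζ i x • (m i x - F x) := by
    filter_upwards [ae_restrict_mem hΩ] with x hx
    simp only [smul_sub, Finset.sum_sub_distrib]
    rw [← Finset.sum_smul, hζ.sum_eq_one x (subset_closure hx), one_smul]
  rw [eLpNorm_congr_ae e1]
  refine eLpNorm_sum_le_card_mul (fun i => (hζ.contDiff i).continuous.aestronglyMeasurable.smul
    ((hm i).sub hF).aestronglyMeasurable) fun i => ?_
  have hms : MeasurableSet (tsupport (ζ i)) := (isClosed_tsupport _).measurableSet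
  calc eLpNorm (fun x => ζ i x • (m i x - F x)) 2 (volume.restrict Ω)
      ≤ eLpNorm ((tsupport (ζ i)).indicator fun x => m i x - F x) 2 (volume.restrict Ω) := by
        refine eLpNorm_mono fun x => ?_
        by_cases hx : x ∈ tsupport (ζ i)
        · rw [indicator_of_mem hx, norm_smul, Real.norm_of_nonneg (hζ.nonneg i x)]
          exact mul_le_of_le_one_left (norm_nonneg _) (hζ.le_one i x)
        · rw [image_eq_zero_of_notMem_tsupport hx, zero_smul, norm_zero]
          positivity
    _ ≤ c := by
        rw [eLpNorm_indicator_eq_eLpNorm_restrict hms, Measure.restrict_restrict hms, inter_comm]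
        exact h i

/-- The gradient of the glued mollifications of `u`. Since the gradients of the partition add up
to zero, `u` may be subtracted from the functions that they multiply. -/
lemma gradient_sum_mollify (hΩ : IsOpen Ω) (u : H1 Ω) {k : ι → E3 → ℝ}
    (hk : ∀ i, IsMollifier (k i))
    (hcone : ∀ i, ∀ x ∈ Ω, x ∈ tsupport (ζ i) → ∀ s ∈ tsupport (k i), x - s ∈ Ω)
    {x : E3} (hx : x ∈ Ω) :
    gradient (fun x => ∑ i, ζ i x * mollify (k i) (zeroExtend u.val) x) x =
      ∑ i, ζ i x • mollify (k i) (zeroExtend u.grad) x +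
        ∑ i, (mollify (k i) (zeroExtend u.val) x - zeroExtend u.val x) • gradient (ζ i) x := by
  have hmU : ∀ i, ContDiff ℝ ∞ (mollify (k i) (zeroExtend u.val)) :=
    fun i => (hk i).contDiff_mollify (locallyIntegrable_zeroExtend hΩ.measurableSet _)
  rw [gradient_sum _ fun i _ => ((hζ.contDiff i).mul (hmU i)).differentiable (by simp) x]
  simp only [sub_smul, Finset.sum_sub_distrib]
  rw [← Finset.smul_sum, hζ.sum_gradient_eq_zero hΩ hx, smul_zero, sub_zero,
    ← Finset.sum_add_distrib]
  refine Finset.sum_congr rfl fun i _ => ?_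
  rw [gradient_mul ((hζ.contDiff i).differentiable (by simp) x)
    ((hmU i).differentiable (by simp) x)]
  by_cases hxi : x ∈ tsupport (ζ i)
  · rw [(hk i).gradient_mollify hΩ.measurableSet u (hcone i x hx hxi)]
  · rw [image_eq_zero_of_notMem_tsupport hxi]
    simp

end IsConePartition

lemma continuous_gradient {φ : E3 → ℝ} (hφ : ContDiff ℝ ∞ φ) : Continuous (gradient φ) :=
  (InnerProductSpace.toDual ℝ E3).symm.continuous.comp (hφ.continuous_fderiv (by simp))

namespace IsSmoothBoundedDomain

variable (hΩ : IsSmoothBoundedDomain Ω)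
include hΩ

lemma memLp_surface {φ : E3 → ℝ} (hφ : Continuous φ) (hc : HasCompactSupport φ) :
    MemLp φ 2 (surface Ω) := by
  have := hΩ.isFiniteMeasure_surface
  exact hφ.memLp_of_hasCompactSupport hc

set_option maxHeartbeats 800000 in
/-- Restrictions of smooth functions are dense in `H¹(Ω)`: mollify `u` on the support of each member
of a cone partition with a kernel supported in the opposite cone, and glue the results. The gradient
of the glued function differs from the glued mollifications of `∇u` by `∑ (k i * u) ∇ζ i`, and as
`∑ ∇ζ i = 0` each `k i * u` may be replaced by the small difference `k i * u - u`. -/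
theorem denseRange_toH1 : DenseRange (toH1 : smoothFunctions Ω →ₗ[ℝ] H1 Ω) := by
  obtain ⟨ι, _, ζ, e, r, hζ⟩ := hΩ.exists_conePartition
  obtain ⟨M, hM0, hM⟩ := hζ.exists_norm_gradient_le
  have hm := hΩ.isOpen.measurableSet
  refine Metric.dense_iff.2 fun u η hη => ?_
  set c : ℝ := η / 4 / ((Fintype.card ι + 1) * (M + 1)) with hc
  have hc0 : 0 < c := by positivity
  have hcc : Fintype.card ι * c + Fintype.card ι * (M * c) ≤ η / 4 := by
    have : (Fintype.card ι + 1 : ℝ) * ((M + 1) * c) = η / 4 := by rw [hc]; field_simp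
    nlinarith [mul_nonneg hM0 hc0.le]
  set U := zeroExtend u.val with hU
  set G := zeroExtend u.grad with hG
  have hUm : StronglyMeasurable U := stronglyMeasurable_zeroExtend hm _
  have hGm : StronglyMeasurable G := stronglyMeasurable_zeroExtend hm _
  obtain ⟨r₁, hr₁, h₁⟩ := exists_eLpNorm_mollify_sub_le (memLp_zeroExtend hm u.val) hUm
    (ENNReal.ofReal_pos.2 hc0)
  obtain ⟨r₂, hr₂, h₂⟩ := exists_eLpNorm_mollify_sub_le (memLp_zeroExtend hm u.grad) hGm
    (ENNReal.ofReal_pos.2 hc0)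
  obtain ⟨k, hk, hks, hcone⟩ := hζ.exists_mollifiers (lt_min hr₁ hr₂)
  have hcone' : ∀ i, ∀ x ∈ Ω, x ∈ tsupport (ζ i) → ∀ s ∈ tsupport (k i), x - s ∈ Ω :=
    fun i x hx hxi s hs => by simpa using hcone i x hx hxi s hs 1 (by simp)
  have hmU : ∀ i, ContDiff ℝ ∞ (mollify (k i) U) :=
    fun i => (hk i).contDiff_mollify (locallyIntegrable_zeroExtend hm u.val)
  have hmG : ∀ i, ContDiff ℝ ∞ (mollify (k i) G) :=
    fun i => (hk i).contDiff_mollify (locallyIntegrable_zeroExtend hm u.grad)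
  have hUc : ∀ i, ∀ A : Set E3, eLpNorm (fun x => mollify (k i) U x - U x) 2 (volume.restrict A)
      ≤ ENNReal.ofReal c := fun i A =>
    (eLpNorm_mono_measure _ Measure.restrict_le_self).trans
      (h₁ (k i) (hk i) fun s hs => (hks i s hs).trans (min_le_left _ _))
  have hGc : ∀ i, ∀ A : Set E3, eLpNorm (fun x => mollify (k i) G x - G x) 2 (volume.restrict A)
      ≤ ENNReal.ofReal c := fun i A =>
    (eLpNorm_mono_measure _ Measure.restrict_le_self).trans
      (h₂ (k i) (hk i) fun s hs => (hks i s hs).trans (min_le_right _ _))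
  set v : E3 → ℝ := fun x => ∑ i, ζ i x * mollify (k i) U x with hv
  have hvs : ContDiff ℝ ∞ v := ContDiff.sum fun i _ => (hζ.contDiff i).mul (hmU i)
  have hvc : HasCompactSupport v := by
    refine HasCompactSupport.intro (K := ⋃ i, tsupport (ζ i)) (isCompact_iUnion hζ.hasCompactSupport)
      fun x hx => Finset.sum_eq_zero fun i _ => ?_
    rw [image_eq_zero_of_notMem_tsupport fun h => hx (mem_iUnion.2 ⟨i, h⟩), zero_mul]
  let φ : smoothFunctions Ω := ⟨v, hvs, hvc, hΩ.memLp_surface hvs.continuous hvc⟩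
  have hφ : φ.1 = v := rfl
  clear_value φ
  refine ⟨toH1 φ, mem_ball_iff_norm.2 ?_, mem_range_self φ⟩
  have b1 : ‖(toH1 φ - u).val‖ ≤ Fintype.card ι * c := by
    have e1 : (toH1 φ - u).val =ᵐ[volume.restrict Ω]
        fun x => (∑ i, ζ i x • mollify (k i) U x) - U x := by
      filter_upwards [toH1_sub_val_ae_eq φ u, zeroExtend_ae_eq hm u.val] with x hx1 hx2
      have hUx : U x = u.val x := hx2
      rw [hx1, hφ, hUx]
      rfl
    refine norm_Lp_le_of_eLpNorm_le e1 (by positivity) ?_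
    rw [ENNReal.ofReal_mul (by positivity), ENNReal.ofReal_natCast]
    exact hζ.eLpNorm_sum_smul_sub_le hm (fun i => (hmU i).continuous.stronglyMeasurable) hUm
      fun i => hUc i _
  have b2 : ‖(toH1 φ - u).grad‖ ≤ Fintype.card ι * c + Fintype.card ι * (M * c) := by
    have e1 : (toH1 φ - u).grad =ᵐ[volume.restrict Ω]
        fun x => ((∑ i, ζ i x • mollify (k i) G x) - G x)
          + ∑ i, (mollify (k i) U x - U x) • gradient (ζ i) x := by
      filter_upwards [toH1_sub_grad_ae_eq φ u, ae_restrict_mem hm] with x hx1 hx3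
      have hg : gradient v x = ∑ i, ζ i x • mollify (k i) G x
          + ∑ i, (mollify (k i) U x - U x) • gradient (ζ i) x :=
        hζ.gradient_sum_mollify hΩ.isOpen u hk hcone' hx3
      have hGx : G x = u.grad x := zeroExtend_of_mem u.grad hx3
      rw [hx1, hφ, hg, hGx]
      exact add_sub_right_comm _ _ _
    refine norm_Lp_le_of_eLpNorm_le e1 (by positivity) ?_
    have m1 : StronglyMeasurable fun x => (∑ i, ζ i x • mollify (k i) G x) - G x := by
      refine StronglyMeasurable.sub (Continuous.stronglyMeasurable ?_) hGm
      exact continuous_finsetSum _ fun i _ => (hζ.contDiff i).continuous.smul (hmG i).continuous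
    have m2 : ∀ i, AEStronglyMeasurable (fun x => (mollify (k i) U x - U x) • gradient (ζ i) x)
        (volume.restrict Ω) := fun i =>
      (((hmU i).continuous.stronglyMeasurable.sub hUm).smul
        (continuous_gradient (hζ.contDiff i)).stronglyMeasurable).aestronglyMeasurable
    refine (eLpNorm_add_le m1.aestronglyMeasurable
      (Finset.aestronglyMeasurable_fun_sum _ fun i _ => m2 i) (by norm_num)).trans ?_
    rw [ENNReal.ofReal_add (by positivity) (by positivity), ENNReal.ofReal_mul (by positivity),
      ENNReal.ofReal_mul (by positivity), ENNReal.ofReal_natCast]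
    refine add_le_add (hζ.eLpNorm_sum_smul_sub_le hm
      (fun i => (hmG i).continuous.stronglyMeasurable) hGm fun i => hGc i _)
      (eLpNorm_sum_le_card_mul m2 fun i => ?_)
    rw [ENNReal.ofReal_mul hM0]
    refine (eLpNorm_le_mul_eLpNorm_of_ae_le_mul (g := fun x => mollify (k i) U x - U x) (c := M)
      (ae_of_all _ fun x => ?_) 2).trans ?_
    · rw [norm_smul, mul_comm]
      gcongr
      exact hM i x
    · gcongr
      exact hUc i _
  have b3 : Fintype.card ι * c ≤ η / 4 := by
    have : 0 ≤ Fintype.card ι * (M * c) := by positivity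
    linarith
  calc _ ≤ _ := H1.norm_le _
    _ ≤ η / 4 + η / 4 := add_le_add (b1.trans b3) (b2.trans hcc)
    _ < η := by linarith

end IsSmoothBoundedDomain

/-! ### Rellich's theorem -/

lemma mollify_apply (k : E3 → ℝ) (F : E3 → ℝ) (x : E3) :
    mollify k F x = ∫ y, k (x - y) * F y := by
  rw [mollify, convolution_lsmul_swap]
  rfl

lemma mollify_congr_ae {k F G : E3 → ℝ} (h : F =ᵐ[volume] G) : mollify k F = mollify k G := by
  funext x
  rw [mollify_apply, mollify_apply]
  refine integral_congr_ae ?_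
  filter_upwards [h] with y hy
  rw [hy]

lemma zeroExtend_toH1_val_ae_eq (hΩ : MeasurableSet Ω) (φ : smoothFunctions Ω) :
    zeroExtend (toH1 φ).val =ᵐ[volume] Ω.indicator φ.1 :=
  (ae_eq_restrict_iff_indicator_ae_eq hΩ).1 (toH1_val_ae_eq φ)

lemma eLpNorm_gradient_le (φ : smoothFunctions Ω) :
    eLpNorm (gradient φ.1) 2 (volume.restrict Ω) ≤ ENNReal.ofReal ‖toH1 φ‖ := by
  have h1 : eLpNorm (gradient φ.1) 2 (volume.restrict Ω) = ‖(toH1 φ).grad‖ₑ := by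
    rw [Lp.enorm_def, eLpNorm_congr_ae (toH1_grad_ae_eq φ)]
  rw [h1, ← ofReal_norm]
  exact ENNReal.ofReal_le_ofReal (H1.norm_grad_le _)

/-- Glued mollifications at scale `δ` change a smooth function by `O(δ)` in `L²(Ω)`, relative to
its norm in `H¹(Ω)`. -/
lemma IsConePartition.eLpNorm_sum_mollify_sub_le {ι : Type} [Fintype ι] {ζ : ι → E3 → ℝ}
    {e : ι → E3} {r : ℝ} (hζ : IsConePartition Ω ζ e r) (hΩ : MeasurableSet Ω) {k : ι → E3 → ℝ}
    (hk : ∀ i, IsMollifier (k i)) {δ : ℝ} (hδ : ∀ i, ∀ s ∈ tsupport (k i), ‖s‖ ≤ δ)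
    (hcone : ∀ i, ∀ x ∈ Ω, x ∈ tsupport (ζ i) → ∀ s ∈ tsupport (k i), ∀ τ ∈ Icc (0 : ℝ) 1,
        x - τ • s ∈ Ω) (φ : smoothFunctions Ω) :
    eLpNorm (fun x => (∑ i, ζ i x • mollify (k i) (zeroExtend (toH1 φ).val) x) - (toH1 φ).val x)
      2 (volume.restrict Ω) ≤ Fintype.card ι * (ENNReal.ofReal δ * ENNReal.ofReal ‖toH1 φ‖) := by
  set F : E3 → ℝ := Ω.indicator φ.1 with hF
  have hφc : Continuous φ.1 := φ.2.1.continuous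
  have hFm : StronglyMeasurable F := hφc.stronglyMeasurable.indicator hΩ
  have hFl : LocallyIntegrable F := by
    refine (locallyIntegrable_zeroExtend hΩ (toH1 φ).val).congr ?_
    exact zeroExtend_toH1_val_ae_eq hΩ φ
  have e1 : (fun x => (∑ i, ζ i x • mollify (k i) (zeroExtend (toH1 φ).val) x) - (toH1 φ).val x)
      =ᵐ[volume.restrict Ω] fun x => (∑ i, ζ i x • mollify (k i) F x) - F x := by
    filter_upwards [toH1_val_ae_eq φ, ae_restrict_mem hΩ] with x hx hxΩ
    have : F x = φ.1 x := indicator_of_mem hxΩ _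
    rw [hx, this]
    simp_rw [mollify_congr_ae (zeroExtend_toH1_val_ae_eq hΩ φ), hF]
  rw [eLpNorm_congr_ae e1]
  refine hζ.eLpNorm_sum_smul_sub_le hΩ
    (fun i => ((hk i).contDiff_mollify hFl).continuous.stronglyMeasurable) hFm fun i => ?_
  refine (hk i).eLpNorm_mollify_sub_le hFl hFm _ fun s hs => ?_
  have hst : s ∈ tsupport (k i) := subset_tsupport _ hs
  have hA : MeasurableSet (Ω ∩ tsupport (ζ i)) := hΩ.inter (isClosed_tsupport _).measurableSet
  have e2 : (fun x => F (x - s) - F x) =ᵐ[volume.restrict (Ω ∩ tsupport (ζ i))]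
      fun x => φ.1 (x - s) - φ.1 x := by
    filter_upwards [ae_restrict_mem hA] with x hx
    have h1 := hcone i x hx.1 hx.2 s hst 1 (by simp)
    rw [one_smul] at h1
    rw [hF, indicator_of_mem h1, indicator_of_mem hx.1]
  rw [eLpNorm_congr_ae e2]
  refine (eLpNorm_translate_sub_le φ.2.1 hA hΩ fun x hx τ hτ =>
    hcone i x hx.1 hx.2 s hst τ hτ).trans ?_
  refine mul_le_mul' ?_ (eLpNorm_gradient_le φ)
  rw [← ofReal_norm]
  exact ENNReal.ofReal_le_ofReal (hδ i s hst)

/-- Mollification maps bounded sets of `L²(Ω)` to bounded and uniformly Lipschitz functions. -/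
lemma IsMollifier.exists_bound {k : E3 → ℝ} (hk : IsMollifier k) (hΩ : MeasurableSet Ω)
    (hb : Bornology.IsBounded Ω) :
    ∃ C > 0, ∀ w : Lp ℝ 2 (volume.restrict Ω),
      (∀ x, |mollify k (zeroExtend w) x| ≤ C * ‖w‖) ∧ ∀ x y,
        |mollify k (zeroExtend w) x - mollify k (zeroExtend w) y| ≤ C * ‖w‖ * ‖x - y‖ := by
  have hfin : IsFiniteMeasure (volume.restrict Ω) := ⟨by
    rw [Measure.restrict_apply_univ]; exact hb.measure_lt_top⟩
  set B := (volume.restrict Ω).real univ ^ (1 / 2 : ℝ) with hB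
  have hB0 : 0 ≤ B := by positivity
  have hint : ∀ w : Lp ℝ 2 (volume.restrict Ω), Integrable (zeroExtend w) ∧
      ∫ y, ‖zeroExtend w y‖ ≤ B * ‖w‖ := by
    intro w
    have h1 : Integrable w (volume.restrict Ω) := (Lp.memLp w).integrable (by norm_num)
    refine ⟨(integrable_indicator_iff hΩ).2 h1, ?_⟩
    have e1 : ∫ y, ‖zeroExtend w y‖ = ∫ y in Ω, ‖w y‖ := by
      rw [← integral_indicator hΩ]
      refine integral_congr_ae (ae_of_all _ fun y => ?_)
      simp only [zeroExtend, norm_indicator_eq_indicator_norm]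
    have e2 := eLpNorm_le_eLpNorm_mul_rpow_measure_univ (p := 1) (q := 2) (by norm_num)
      (Lp.aestronglyMeasurable w)
    rw [e1, integral_norm_eq_lintegral_enorm h1.aestronglyMeasurable,
      ← eLpNorm_one_eq_lintegral_enorm]
    refine (ENNReal.toReal_mono ?_ e2).trans (le_of_eq ?_)
    · exact ENNReal.mul_ne_top (Lp.eLpNorm_ne_top w)
        (ENNReal.rpow_ne_top_of_nonneg (by norm_num) (measure_ne_top _ _))
    · rw [ENNReal.toReal_mul, ← ENNReal.toReal_rpow, ← Lp.norm_def, mul_comm, hB, Measure.real]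
      norm_num
  obtain ⟨M, hM⟩ := hk.hasCompactSupport.exists_bound_of_continuous hk.contDiff.continuous
  obtain ⟨L, hL⟩ := (hk.contDiff.of_le (m := 1) (by norm_cast)).lipschitzWith_of_hasCompactSupport
    hk.hasCompactSupport one_ne_zero
  have hM0 : 0 ≤ M := (norm_nonneg _).trans (hM 0)
  have hkint : ∀ (w : Lp ℝ 2 (volume.restrict Ω)) x, Integrable fun y => k (x - y) * zeroExtend w y :=
    fun w x => (hint w).1.bdd_mul
      (hk.contDiff.continuous.comp (by fun_prop)).aestronglyMeasurable (ae_of_all _ fun y => hM (x - y))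
  refine ⟨(M + L) * B + 1, by positivity, fun w => ⟨fun x => ?_, fun x y => ?_⟩⟩
  · rw [mollify_apply, ← Real.norm_eq_abs]
    calc ‖∫ y, k (x - y) * zeroExtend w y‖ ≤ ∫ y, M * ‖zeroExtend w y‖ := by
          refine norm_integral_le_of_norm_le ((hint w).1.norm.const_mul M) (ae_of_all _ fun y => ?_)
          rw [norm_mul]
          gcongr
          exact hM _
      _ = M * ∫ y, ‖zeroExtend w y‖ := integral_const_mul _ _
      _ ≤ M * (B * ‖w‖) := by gcongr; exact (hint w).2
      _ ≤ ((M + L) * B + 1) * ‖w‖ := by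
          have : 0 ≤ (L : ℝ) * B * ‖w‖ := by positivity
          nlinarith [norm_nonneg w]
  · rw [mollify_apply, mollify_apply, ← integral_sub (hkint w x) (hkint w y), ← Real.norm_eq_abs]
    calc ‖∫ z, (k (x - z) * zeroExtend w z - k (y - z) * zeroExtend w z)‖
        ≤ ∫ z, L * ‖x - y‖ * ‖zeroExtend w z‖ := by
          refine norm_integral_le_of_norm_le ((hint w).1.norm.const_mul _) (ae_of_all _ fun z => ?_)
          rw [← sub_mul, norm_mul]
          gcongr
          have := hL.dist_le_mul (x - z) (y - z)
          rwa [dist_sub_right, dist_eq_norm, dist_eq_norm] at this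
      _ = L * ‖x - y‖ * ∫ z, ‖zeroExtend w z‖ := integral_const_mul _ _
      _ ≤ L * ‖x - y‖ * (B * ‖w‖) := by gcongr; exact (hint w).2
      _ = (L * B) * ‖w‖ * ‖x - y‖ := by ring
      _ ≤ ((M + L) * B + 1) * ‖w‖ * ‖x - y‖ := by
          gcongr
          nlinarith [mul_nonneg hM0 hB0]

/-- A set is totally bounded if, up to a small error, its points are determined by the approximate
values of finitely many bounded functions. -/
lemma totallyBounded_of_finite_values {E : Type} [PseudoMetricSpace E] {S : Set E}
    (h : ∀ η > 0, ∃ (J : Type) (_ : Finite J) (q : E → J → ℝ) (M : ℝ) (c : ℝ), 0 < c ∧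
      (∀ w ∈ S, ∀ j, |q w j| ≤ M) ∧
      ∀ w ∈ S, ∀ w' ∈ S, (∀ j, |q w j - q w' j| ≤ c) → dist w w' < η) : TotallyBounded S := by
  classical
  refine Metric.totallyBounded_of_finite_discretization fun η hη => ?_
  obtain ⟨J, _, q, M, c, hc, hM, hd⟩ := h η hη
  have := Fintype.ofFinite J
  set N : ℤ := ⌈M / c⌉ + 1 with hN
  have hQ : ∀ w ∈ S, ∀ j, ⌊q w j / c⌋ ∈ Finset.Icc (-N) N := by
    intro w hw j
    have h2 : |q w j / c| ≤ M / c := by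
      rw [abs_div, abs_of_pos hc]
      exact div_le_div_of_nonneg_right (hM w hw j) hc.le
    obtain ⟨h3, h4⟩ := abs_le.1 h2
    have h5 := Int.le_ceil (M / c)
    refine Finset.mem_Icc.2 ⟨Int.le_floor.2 ?_, ?_⟩
    · push_cast [hN]
      linarith
    · have h6 := Int.floor_le_floor h4
      have h7 : ⌊M / c⌋ ≤ ⌈M / c⌉ := Int.floor_le_ceil _
      linarith
  refine ⟨J → Finset.Icc (-N) N, inferInstance, fun w j => ⟨⌊q w.1 j / c⌋, hQ _ w.2 j⟩, ?_⟩
  rintro ⟨w, hw⟩ ⟨w', hw'⟩ hF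
  refine hd w hw w' hw' fun j => ?_
  have h1 : ⌊q w j / c⌋ = ⌊q w' j / c⌋ := congrArg Subtype.val (congrFun hF j)
  have h2 := (Int.abs_sub_lt_one_of_floor_eq_floor h1).le
  rwa [← sub_div, abs_div, abs_of_pos hc, div_le_one hc] at h2

/-- If `w` and `w'` are approximated in `L²` by functions which are uniformly close, they are close
in `L²`. -/
lemma norm_sub_le_of_approx {X : Type*} [MeasurableSpace X] {μ : Measure X} [IsFiniteMeasure μ]
    {w w' : Lp ℝ 2 μ} {a a' : X → ℝ} (ha : AEStronglyMeasurable a μ)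
    (ha' : AEStronglyMeasurable a' μ) {δ c : ℝ} (hδ : 0 ≤ δ) (hc : 0 ≤ c)
    (h : eLpNorm (fun x => a x - w x) 2 μ ≤ ENNReal.ofReal δ)
    (h' : eLpNorm (fun x => a' x - w' x) 2 μ ≤ ENNReal.ofReal δ)
    (hb : ∀ᵐ x ∂μ, ‖a x - a' x‖ ≤ c) :
    ‖w - w'‖ ≤ μ.real univ ^ (1 / 2 : ℝ) * c + δ + δ := by
  refine norm_Lp_le_of_eLpNorm_le (f := fun x => (a x - a' x) - (a x - w x)
      + (a' x - w' x)) ?_ (by positivity) ?_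
  · filter_upwards [Lp.coeFn_sub w w'] with x hx
    rw [hx, Pi.sub_apply]
    ring
  · have m1 : AEStronglyMeasurable (fun x => a x - w x) μ := ha.sub (Lp.aestronglyMeasurable _)
    have m2 : AEStronglyMeasurable (fun x => a' x - w' x) μ := ha'.sub (Lp.aestronglyMeasurable _)
    refine (eLpNorm_add_le ((ha.sub ha').sub m1) m2 (by norm_num)).trans ?_
    rw [ENNReal.ofReal_add (by positivity) (by positivity),
      ENNReal.ofReal_add (by positivity) (by positivity)]
    refine add_le_add ((eLpNorm_sub_le (ha.sub ha') m1 (by norm_num)).trans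
      (add_le_add ?_ h)) h'
    refine (eLpNorm_le_of_ae_bound hb).trans (le_of_eq ?_)
    rw [ENNReal.ofReal_mul (by positivity), Measure.real, ENNReal.toReal_rpow,
      ENNReal.ofReal_toReal (ENNReal.rpow_ne_top_of_nonneg (by norm_num) (measure_ne_top _ _))]
    norm_num

/-- Uniformly Lipschitz functions that are close at the points of a fine net are close. -/
lemma abs_sub_le_of_net {f g : E3 → ℝ} {L ρ c : ℝ} {x y : E3} (hxy : ‖x - y‖ ≤ ρ)
    (hρ : L * ρ ≤ c) (hL : 0 ≤ L) (hf : |f x - f y| ≤ L * ‖x - y‖)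
    (hg : |g x - g y| ≤ L * ‖x - y‖) (h : |f y - g y| ≤ c) : |f x - g x| ≤ 3 * c := by
  have h0 : L * ‖x - y‖ ≤ c := (mul_le_mul_of_nonneg_left hxy hL).trans hρ
  have h1 := abs_le.1 (hf.trans h0)
  have h2 := abs_le.1 (hg.trans h0)
  have h3 := abs_le.1 h
  rw [abs_le]
  constructor <;> linarith [h1.1, h1.2, h2.1, h2.2, h3.1, h3.2]

/-- Gluing by a partition of unity does not increase uniform distances. -/
lemma IsConePartition.norm_sum_smul_sub_le {ι : Type} [Fintype ι] {ζ : ι → E3 → ℝ}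
    {e : ι → E3} {r : ℝ} (hζ : IsConePartition Ω ζ e r) {m m' : ι → E3 → ℝ} {c : ℝ} {x : E3}
    (hx : x ∈ Ω) (h : ∀ i, |m i x - m' i x| ≤ c) :
    ‖(∑ i, ζ i x • m i x) - ∑ i, ζ i x • m' i x‖ ≤ c := by
  rw [← Finset.sum_sub_distrib]
  simp_rw [← smul_sub]
  calc _ ≤ ∑ i, ζ i x * c := by
        refine norm_sum_le_of_le _ fun i _ => ?_
        rw [norm_smul, Real.norm_of_nonneg (hζ.nonneg i x)]
        exact mul_le_mul_of_nonneg_left (h i) (hζ.nonneg i x)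
    _ = c := by rw [← Finset.sum_mul, hζ.sum_eq_one x (subset_closure hx), one_mul]

namespace IsSmoothBoundedDomain

variable (hΩ : IsSmoothBoundedDomain Ω)
include hΩ

lemma isFiniteMeasure_restrict : IsFiniteMeasure ((volume : Measure E3).restrict Ω) :=
  ⟨by rw [Measure.restrict_apply_univ]; exact hΩ.isBounded.measure_lt_top⟩

set_option maxHeartbeats 1600000 in
/-- Rellich's theorem, for smooth functions: a smooth function bounded in `H¹(Ω)` is determined in
`L²(Ω)`, up to a small error, by approximate values of finitely many mollifications at finitely
many points. -/
lemma totallyBounded_smooth :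
    TotallyBounded {w : Lp ℝ 2 (volume.restrict Ω) |
      ∃ φ : smoothFunctions Ω, ‖toH1 φ‖ ≤ 2 ∧ (toH1 φ).val = w} := by
  obtain ⟨ι, _, ζ, e, r, hζ⟩ := hΩ.exists_conePartition
  have hm := hΩ.isOpen.measurableSet
  have hfin := hΩ.isFiniteMeasure_restrict
  refine totallyBounded_of_finite_values fun η hη => ?_
  obtain ⟨δ, hδ0, hδη⟩ : ∃ δ > 0, Fintype.card ι * (δ * 2) ≤ η / 4 := by
    refine ⟨η / 4 / ((Fintype.card ι + 1) * 2), by positivity, ?_⟩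
    rw [div_mul_eq_mul_div, mul_div_assoc', div_le_iff₀ (by positivity)]
    nlinarith
  obtain ⟨k, hk, hks, hcone⟩ := hζ.exists_mollifiers hδ0
  choose C hC0 hC using fun i => (hk i).exists_bound hm hΩ.isBounded
  obtain ⟨C₀, hC₀, hCC⟩ : ∃ C₀ > 0, ∀ i, C i ≤ C₀ :=
    ⟨∑ i, C i + 1, add_pos_of_nonneg_of_pos (Finset.sum_nonneg fun i _ => (hC0 i).le) one_pos,
      fun i => (Finset.single_le_sum (fun i _ => (hC0 i).le) (Finset.mem_univ i)).trans
        (le_add_of_nonneg_right zero_le_one)⟩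
  -- `c` is the admissible error in the values, `ρ` the mesh size of the sample points
  obtain ⟨c, hc0, hc⟩ : ∃ c > 0,
      (volume.restrict Ω).real univ ^ (1 / 2 : ℝ) * (3 * c) ≤ η / 4 := by
    refine ⟨η / 4 / (((volume.restrict Ω).real univ ^ (1 / 2 : ℝ) + 1) * 3), by positivity, ?_⟩
    rw [mul_div_assoc', mul_div_assoc', div_le_iff₀ (by positivity)]
    nlinarith
  obtain ⟨ρ, hρ0, hρ⟩ : ∃ ρ > 0, C₀ * 2 * ρ ≤ c :=
    ⟨c / (C₀ * 2), by positivity, (mul_div_cancel₀ _ (by positivity)).le⟩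
  obtain ⟨T, -, hTf, hT⟩ := (hΩ.isCompact_closure.totallyBounded.subset subset_closure).exists_subset
    (Metric.dist_mem_uniformity hρ0)
  have := hTf.to_subtype
  refine ⟨ι × T, inferInstance, fun w j => mollify (k j.1) (zeroExtend w) j.2, C₀ * 2, c, hc0,
    ?_, ?_⟩
  · rintro _ ⟨φ, hφ, rfl⟩ ⟨i, y⟩
    exact ((hC i (toH1 φ).val).1 y).trans (mul_le_mul (hCC i) ((H1.norm_val_le _).trans hφ)
      (norm_nonneg _) hC₀.le)
  rintro _ ⟨φ, hφ, rfl⟩ _ ⟨φ', hφ', rfl⟩ hF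
  have hlip : ∀ ψ : smoothFunctions Ω, ‖toH1 ψ‖ ≤ 2 → ∀ i x y,
      |mollify (k i) (zeroExtend (toH1 ψ).val) x - mollify (k i) (zeroExtend (toH1 ψ).val) y|
        ≤ C₀ * 2 * ‖x - y‖ := by
    intro ψ hψ i x y
    refine ((hC i (toH1 ψ).val).2 x y).trans ?_
    exact mul_le_mul_of_nonneg_right (mul_le_mul (hCC i) ((H1.norm_val_le _).trans hψ)
      (norm_nonneg _) hC₀.le) (norm_nonneg _)
  have hpt : ∀ x ∈ Ω, ∀ i, |mollify (k i) (zeroExtend (toH1 φ).val) x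
      - mollify (k i) (zeroExtend (toH1 φ').val) x| ≤ 3 * c := by
    intro x hx i
    obtain ⟨y, hy, hxy⟩ := mem_iUnion₂.1 (hT hx)
    have hxy : dist x y < ρ := hxy
    rw [dist_eq_norm] at hxy
    exact abs_sub_le_of_net hxy.le hρ (by positivity) (hlip φ hφ i x y) (hlip φ' hφ' i x y)
      (hF (i, ⟨y, hy⟩))
  have happ : ∀ ψ : smoothFunctions Ω, ‖toH1 ψ‖ ≤ 2 →
      eLpNorm (fun x => (∑ i, ζ i x • mollify (k i) (zeroExtend (toH1 ψ).val) x)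
        - (toH1 ψ).val x) 2 (volume.restrict Ω) ≤ ENNReal.ofReal (η / 4) := by
    intro ψ hψ
    refine (hζ.eLpNorm_sum_mollify_sub_le hm hk hks hcone ψ).trans ?_
    rw [← ENNReal.ofReal_mul hδ0.le, ← ENNReal.ofReal_natCast, ← ENNReal.ofReal_mul (by positivity)]
    refine ENNReal.ofReal_le_ofReal (le_trans ?_ hδη)
    exact mul_le_mul_of_nonneg_left (mul_le_mul_of_nonneg_left hψ hδ0.le) (by positivity)
  have hac : ∀ ψ : smoothFunctions Ω, Continuous fun x =>
      ∑ i, ζ i x • mollify (k i) (zeroExtend (toH1 ψ).val) x :=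
    fun ψ => continuous_finsetSum _ fun i _ => (hζ.contDiff i).continuous.smul
      ((hk i).contDiff_mollify (locallyIntegrable_zeroExtend hm _)).continuous
  have hfinal := norm_sub_le_of_approx (c := 3 * c) (hac φ).aestronglyMeasurable (hac φ').aestronglyMeasurable
    (by positivity) (by positivity) (happ φ hφ) (happ φ' hφ') (by
      filter_upwards [ae_restrict_mem hm] with x hx
      exact hζ.norm_sum_smul_sub_le hx (hpt x hx))
  rw [dist_eq_norm]
  linarith

/-- Rellich's theorem: the unit ball of `H¹(Ω)` is covered by finitely many small balls of `L²(Ω)`,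
with smooth centres. -/
theorem exists_finite_net {η : ℝ} (hη : 0 < η) :
    ∃ T : Set (smoothFunctions Ω), T.Finite ∧
      ∀ u : H1 Ω, ‖u‖ ≤ 1 → ∃ φ ∈ T, ‖toH1 φ‖ ≤ 2 ∧ ‖(u - toH1 φ).val‖ ≤ η := by
  obtain ⟨S, hS, hSf, hcov⟩ := hΩ.totallyBounded_smooth.exists_subset
    (Metric.dist_mem_uniformity (half_pos hη))
  choose! φ hφ using fun w (hw : w ∈ S) => hS hw
  refine ⟨φ '' S, hSf.image φ, fun u hu => ?_⟩
  obtain ⟨_, hd, ψ, rfl⟩ := Metric.dense_iff.1 hΩ.denseRange_toH1 u (min 1 (η / 2)) (by positivity)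
  have hd' : ‖toH1 ψ - u‖ < min 1 (η / 2) := mem_ball_iff_norm.1 hd
  have hψ : ‖toH1 ψ‖ ≤ 2 := by
    have := norm_le_norm_add_norm_sub' (toH1 ψ) u
    linarith [hd'.le.trans (min_le_left _ _)]
  obtain ⟨w, hw, hdw⟩ := mem_iUnion₂.1 (hcov ⟨ψ, hψ, rfl⟩)
  have hdw : ‖(toH1 ψ).val - w‖ < η / 2 := by simpa [dist_eq_norm] using hdw
  refine ⟨φ w, mem_image_of_mem _ hw, (hφ w hw).1, ?_⟩
  have e1 : (u - toH1 (φ w)).val = ((toH1 ψ).val - w) - (toH1 ψ - u).val := by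
    have h1 : (u - toH1 (φ w)).val = u.val - (toH1 (φ w)).val := rfl
    have h2 : (toH1 ψ - u).val = (toH1 ψ).val - u.val := rfl
    rw [h1, h2, (hφ w hw).2]
    abel
  rw [e1]
  refine (norm_sub_le _ _).trans ?_
  linarith [H1.norm_val_le (toH1 ψ - u), hd'.le.trans (min_le_right _ _)]

end IsSmoothBoundedDomain

/-! ### Interpolated trace inequalities -/

/-- The Cauchy–Schwarz inequality. -/
lemma lintegral_enorm_mul_le {X V V' : Type*} [MeasurableSpace X] {μ : Measure X}
    [NormedAddCommGroup V] [NormedAddCommGroup V'] {f : X → V} {g : X → V'}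
    (hf : AEStronglyMeasurable f μ) (hg : AEStronglyMeasurable g μ) :
    ∫⁻ x, ‖f x‖ₑ * ‖g x‖ₑ ∂μ ≤ eLpNorm f 2 μ * eLpNorm g 2 μ := by
  have h := ENNReal.lintegral_mul_le_Lp_mul_Lq μ Real.HolderConjugate.two_two hf.enorm hg.enorm
  rw [eLpNorm_eq_lintegral_rpow_enorm_toReal two_ne_zero (by simp),
    eLpNorm_eq_lintegral_rpow_enorm_toReal two_ne_zero (by simp)]
  simpa using h

lemma contDiff_one_continuous_gradient {W : E3 → ℝ} (hW : ContDiff ℝ 1 W) :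
    Continuous (gradient W) :=
  (InnerProductSpace.toDual ℝ E3).symm.continuous.comp (hW.continuous_fderiv (by simp))

/-- The normalised Lebesgue measure `ε⁻¹ dx` on the part of the boundary strip inside `Ω`. -/
def stripMeasure (Ω : Set E3) (ε : ℝ) : Measure E3 :=
  ENNReal.ofReal ε⁻¹ • volume.restrict (Ω ∩ strip Ω ε)

lemma enorm_gradient_sq_le {φ : E3 → ℝ} (hφ : ContDiff ℝ ∞ φ) (x : E3) :
    ‖gradient (fun y => φ y * φ y) x‖ₑ ≤ 2 * (‖φ x‖ₑ * ‖gradient φ x‖ₑ) := by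
  have hd := hφ.differentiable (by simp) x
  rw [gradient_mul hd hd, two_mul, ← enorm_smul]
  exact enorm_add_le _ _

lemma eLpNorm_val (φ : smoothFunctions Ω) :
    eLpNorm φ.1 2 (volume.restrict Ω) = ‖(toH1 φ).val‖ₑ :=
  (Lp.enorm_toLp (memLp_val φ)).symm

lemma eLpNorm_gradient (φ : smoothFunctions Ω) :
    eLpNorm (gradient φ.1) 2 (volume.restrict Ω) = ‖(toH1 φ).grad‖ₑ :=
  (Lp.enorm_toLp (memLp_gradient φ)).symm

namespace IsSmoothBoundedDomain

variable (hΩ : IsSmoothBoundedDomain Ω)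
include hΩ

lemma lintegral_tubeMeasure {F : E3 → ℝ≥0∞} (hF : Measurable F) (ε : ℝ) :
    ∫⁻ y, F y ∂(tubeMeasure Ω ε) =
      ∫⁻ x, (∫⁻ τ in Ioo 0 ε, F (tube Ω (x, τ))) ∂(surface Ω) := by
  have := hΩ.isFiniteMeasure_surface
  rw [tubeMeasure, lintegral_map hF hΩ.measurable_tube,
    lintegral_prod (fun z => F (tube Ω z)) (hF.comp hΩ.measurable_tube).aemeasurable]

/-- Along a normal line, the oscillation of a function is controlled by its gradient. -/
lemma enorm_tube_sub_le {W : E3 → ℝ} (hW : ContDiff ℝ 1 W) {x : E3} (hx : x ∈ frontier Ω)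
    {ρ σ σ' : ℝ} (hσ : σ ∈ Icc 0 ρ) (hσ' : σ' ∈ Icc 0 ρ) :
    ‖W (tube Ω (x, σ)) - W (tube Ω (x, σ'))‖ₑ
      ≤ ∫⁻ τ in Ioo 0 ρ, ‖gradient W (tube Ω (x, τ))‖ₑ := by
  have hgc := contDiff_one_continuous_gradient hW
  have hd : ∀ τ ∈ uIcc σ' σ, HasDerivAt (fun τ : ℝ => W (tube Ω (x, τ)))
      (-⟪gradient W (tube Ω (x, τ)), normal Ω x⟫) τ := by
    intro τ _
    have h1 : HasFDerivAt W (fderiv ℝ W (x - τ • normal Ω x)) (x - τ • normal Ω x) :=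
      (hW.differentiable (by simp) _).hasFDerivAt
    have h2 : HasDerivAt (fun τ : ℝ => x - τ • normal Ω x) (-((1 : ℝ) • normal Ω x)) τ :=
      ((hasDerivAt_id τ).smul_const _).const_sub x
    have e : -⟪gradient W (tube Ω (x, τ)), normal Ω x⟫
        = fderiv ℝ W (x - τ • normal Ω x) (-((1 : ℝ) • normal Ω x)) := by
      simp [tube]
    rw [e]
    exact h1.comp_hasDerivAt τ h2
  have hcont : Continuous fun τ : ℝ => -⟪gradient W (tube Ω (x, τ)), normal Ω x⟫ := by
    have : Continuous fun τ : ℝ => gradient W (tube Ω (x, τ)) :=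
      hgc.comp (show Continuous fun τ : ℝ => x - τ • normal Ω x by fun_prop)
    fun_prop
  rw [← intervalIntegral.integral_eq_sub_of_hasDerivAt hd (hcont.intervalIntegrable _ _),
    ← ofReal_norm, intervalIntegral.norm_integral_eq_norm_integral_uIoc,
    ofReal_norm]
  refine (enorm_integral_le_lintegral_enorm _).trans ?_
  have hsub : uIoc σ' σ ⊆ Ioc 0 ρ :=
    Ioc_subset_Ioc (le_min hσ'.1 hσ.1) (max_le hσ'.2 hσ.2)
  refine (lintegral_mono_set hsub).trans ?_
  rw [setLIntegral_congr Ioo_ae_eq_Ioc.symm]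
  refine lintegral_mono fun τ => ?_
  rw [enorm_neg]
  refine enorm_le_iff_norm_le.2 ?_
  refine (norm_inner_le_norm _ _).trans ?_
  rw [hΩ.norm_normal hx, mul_one]

/-- Parallel surfaces: a function varies in `L¹` between them by at most the integral of its
gradient. -/
lemma lintegral_surface_tube_sub_le {W : E3 → ℝ} (hW : ContDiff ℝ 1 W) {ρ σ σ' : ℝ}
    (hσ : σ ∈ Icc 0 ρ) (hσ' : σ' ∈ Icc 0 ρ) :
    ∫⁻ x, ‖W (tube Ω (x, σ)) - W (tube Ω (x, σ'))‖ₑ ∂(surface Ω)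
      ≤ ∫⁻ y, ‖gradient W y‖ₑ ∂(tubeMeasure Ω ρ) := by
  rw [hΩ.lintegral_tubeMeasure (contDiff_one_continuous_gradient hW).enorm.measurable]
  refine lintegral_mono_ae ?_
  filter_upwards [ae_restrict_mem isClosed_frontier.measurableSet] with x hx
  exact hΩ.enorm_tube_sub_le hW hx hσ hσ'

/-- The integral of `W` over a surface parallel to the boundary is controlled by the integrals of
`W` and its gradient over the layer: average the preceding estimate over the layer. -/
lemma lintegral_surface_tube_le {W : E3 → ℝ} (hW : ContDiff ℝ 1 W) {r σ : ℝ}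
    (hσ : σ ∈ Icc 0 r) :
    ENNReal.ofReal r * ∫⁻ x, ‖W (tube Ω (x, σ))‖ₑ ∂(surface Ω)
      ≤ ∫⁻ y, ‖W y‖ₑ ∂(tubeMeasure Ω r)
        + ENNReal.ofReal r * ∫⁻ y, ‖gradient W y‖ₑ ∂(tubeMeasure Ω r) := by
  have hWm : Measurable fun y => ‖W y‖ₑ := hW.continuous.enorm.measurable
  have hgm : Measurable fun y => ‖gradient W y‖ₑ :=
    (contDiff_one_continuous_gradient hW).enorm.measurable
  have hm : Measurable fun x => ‖W (tube Ω (x, σ))‖ₑ :=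
    hWm.comp (hΩ.measurable_tube.comp (by fun_prop))
  have hvol : volume (Ioo 0 r) = ENNReal.ofReal r := by simp
  have hmi : Measurable fun x => ∫⁻ τ in Ioo 0 r, ‖gradient W (tube Ω (x, τ))‖ₑ :=
    (hgm.comp hΩ.measurable_tube).lintegral_prod_right' (ν := volume.restrict (Ioo 0 r))
  rw [hΩ.lintegral_tubeMeasure hWm, hΩ.lintegral_tubeMeasure hgm,
    ← lintegral_const_mul _ hm, ← lintegral_const_mul _ hmi,
    ← lintegral_add_right _ (hmi.const_mul _)]
  refine lintegral_mono_ae ?_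
  filter_upwards [ae_restrict_mem isClosed_frontier.measurableSet] with x hx
  calc ENNReal.ofReal r * ‖W (tube Ω (x, σ))‖ₑ
      = ∫⁻ _ in Ioo 0 r, ‖W (tube Ω (x, σ))‖ₑ := by rw [setLIntegral_const, hvol, mul_comm]
    _ ≤ ∫⁻ τ in Ioo 0 r, (‖W (tube Ω (x, τ))‖ₑ
          + ∫⁻ τ in Ioo 0 r, ‖gradient W (tube Ω (x, τ))‖ₑ) := by
        refine setLIntegral_mono' measurableSet_Ioo fun τ hτ => ?_
        refine le_trans ?_ (add_le_add_right (hΩ.enorm_tube_sub_le hW hx hσ ⟨hτ.1.le, hτ.2.le⟩) _)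
        refine le_trans (le_of_eq ?_) (enorm_add_le _ _)
        rw [add_sub_cancel]
    _ = _ := by rw [lintegral_add_right _ measurable_const, setLIntegral_const, hvol, mul_comm]

/-- The `L¹` estimate for parallel surfaces, applied to `φ²`, whose gradient is `2 φ ∇φ`, gives the
interpolated trace inequality `∫_Γ φ² dS ≤ C ‖φ‖_{L²} ‖φ‖_{H¹}`, and its analogue for the
boundary strips, with a constant independent of the width of the strip. -/
lemma exists_lintegral_sq_le : ∃ C : NNReal, ∃ ε₀ > 0, ∀ φ : E3 → ℝ, ContDiff ℝ ∞ φ → ∀ v n : ℝ≥0∞,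
    v ≤ n → eLpNorm φ 2 (volume.restrict Ω) = v → eLpNorm (gradient φ) 2 (volume.restrict Ω) ≤ n →
    ∫⁻ x, ‖φ x‖ₑ ^ 2 ∂(surface Ω) ≤ C * (v * n) ∧
    ∀ ε ∈ Ioc 0 ε₀, ∫⁻ x, ‖φ x‖ₑ ^ 2 ∂(stripMeasure Ω ε) ≤ C * (v * n) := by
  have := hΩ.isFiniteMeasure_surface
  obtain ⟨r, hr, hstrip⟩ := hΩ.exists_restrict_strip_le (C := 2) (by norm_num)
  obtain ⟨C, hC⟩ : ∃ C : NNReal, ENNReal.ofReal r * C = 2 + 4 * ENNReal.ofReal r := by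
    refine ⟨(2 + 4 * r.toNNReal) / r.toNNReal, ?_⟩
    have h0 : r.toNNReal ≠ 0 := (Real.toNNReal_pos.2 hr).ne'
    rw [ENNReal.ofReal]
    norm_cast
    field_simp
  have hle : tubeMeasure Ω r ≤ (2 : NNReal) • volume.restrict Ω :=
    (hstrip r ⟨hr, le_rfl⟩).2.trans (by
      gcongr
      exact inter_subset_left)
  refine ⟨2 * C, r, hr, fun φ hφ v n hv ev hg => ?_⟩
  have m1 : AEStronglyMeasurable φ (volume.restrict Ω) := hφ.continuous.aestronglyMeasurable
  have m2 : AEStronglyMeasurable (gradient φ) (volume.restrict Ω) :=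
    (continuous_gradient hφ).aestronglyMeasurable
  have hW : ContDiff ℝ 1 fun y => φ y * φ y := (hφ.mul hφ).of_le (by simp)
  have e2 : ∀ y, ‖φ y * φ y‖ₑ = ‖φ y‖ₑ ^ 2 := fun y => by rw [enorm_mul, sq]
  have i1 : ∫⁻ y, ‖φ y * φ y‖ₑ ∂(tubeMeasure Ω r)
      ≤ 2 * (v * n) := by
    refine (lintegral_mono' hle le_rfl).trans ?_
    rw [lintegral_smul_measure]
    refine mul_le_mul' le_rfl ?_
    simp only [enorm_mul]
    refine (lintegral_enorm_mul_le m1 m1).trans ?_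
    rw [ev]
    gcongr
  have i2 : ∫⁻ y, ‖gradient (fun y => φ y * φ y) y‖ₑ ∂(tubeMeasure Ω r)
      ≤ 4 * (v * n) := by
    refine (lintegral_mono' hle (enorm_gradient_sq_le hφ)).trans ?_
    rw [lintegral_smul_measure, lintegral_const_mul' _ _ (by simp)]
    refine (mul_le_mul' le_rfl (mul_le_mul' le_rfl
      (lintegral_enorm_mul_le m1 m2))).trans ?_
    rw [ev]
    have : (4 : ℝ≥0∞) = (2 : NNReal) * 2 := by norm_num
    rw [this, mul_assoc]
    exact mul_le_mul' le_rfl (mul_le_mul' le_rfl (mul_le_mul' le_rfl hg))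
  have key : ∀ σ ∈ Icc 0 r, ∫⁻ x, ‖φ (tube Ω (x, σ))‖ₑ ^ 2 ∂(surface Ω)
      ≤ C * (v * n) := by
    intro σ hσ
    have h := hΩ.lintegral_surface_tube_le hW hσ
    simp only [e2] at h
    have hr0 : ENNReal.ofReal r ≠ 0 := by simpa using hr
    refine (ENNReal.mul_le_mul_iff_right hr0 ENNReal.ofReal_ne_top).1 (h.trans ?_)
    rw [← mul_assoc, hC, add_mul]
    simp only [e2] at i1
    refine add_le_add i1 ((mul_le_mul' le_rfl i2).trans (le_of_eq ?_))
    ring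
  have hC2 : ∀ t : ℝ≥0∞, C * t ≤ (2 * C : NNReal) * t := fun t => by
    gcongr
    exact_mod_cast (le_mul_of_one_le_left zero_le one_le_two)
  refine ⟨le_trans ?_ (hC2 _), fun ε hε => ?_⟩
  · simpa [tube_zero] using key 0 ⟨le_rfl, hr.le⟩
  have hm : Measurable fun y => ‖φ y‖ₑ ^ 2 := hφ.continuous.enorm.measurable.pow_const 2
  have h0 : ENNReal.ofReal ε⁻¹ * ENNReal.ofReal ε = 1 := by
    rw [← ENNReal.ofReal_mul (inv_nonneg.2 hε.1.le), inv_mul_cancel₀ hε.1.ne', ENNReal.ofReal_one]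
  calc ∫⁻ x, ‖φ x‖ₑ ^ 2 ∂(stripMeasure Ω ε)
      = ENNReal.ofReal ε⁻¹ * ∫⁻ x, ‖φ x‖ₑ ^ 2 ∂(volume.restrict (Ω ∩ strip Ω ε)) := by
        rw [stripMeasure, lintegral_smul_measure, smul_eq_mul]
    _ ≤ ENNReal.ofReal ε⁻¹ * (2 * ∫⁻ x, ‖φ x‖ₑ ^ 2 ∂(tubeMeasure Ω ε)) := by
        refine mul_le_mul' le_rfl ((lintegral_mono' (hstrip ε hε).1 le_rfl).trans ?_)
        rw [lintegral_smul_measure]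
        rfl
    _ ≤ ENNReal.ofReal ε⁻¹ * (2 * (ENNReal.ofReal ε
          * (C * (v * n)))) := by
        refine mul_le_mul' le_rfl (mul_le_mul' le_rfl ?_)
        rw [hΩ.lintegral_tubeMeasure hm, lintegral_lintegral_swap
          (f := fun x τ => ‖φ (tube Ω (x, τ))‖ₑ ^ 2) (hm.comp hΩ.measurable_tube).aemeasurable]
        refine (setLIntegral_mono' measurableSet_Ioo
          fun τ hτ => key τ ⟨hτ.1.le, hτ.2.le.trans hε.2⟩).trans ?_
        rw [setLIntegral_const, Real.volume_Ioo, sub_zero, mul_comm]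
    _ = (2 * C : NNReal) * (v * n) := by
        rw [mul_left_comm (2 : ℝ≥0∞), ← mul_assoc, h0, one_mul, ENNReal.coe_mul, mul_assoc]
        rfl

/-- The interpolated trace inequality for smooth functions as elements of `H¹(Ω)`. -/
theorem exists_trace_bound : ∃ C : NNReal, ∃ ε₀ > 0, ∀ φ : smoothFunctions Ω,
    ∫⁻ x, ‖φ.1 x‖ₑ ^ 2 ∂(surface Ω) ≤ C * (‖(toH1 φ).val‖ₑ * ‖toH1 φ‖ₑ) ∧
    ∀ ε ∈ Ioc 0 ε₀, ∫⁻ x, ‖φ.1 x‖ₑ ^ 2 ∂(stripMeasure Ω ε)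
      ≤ C * (‖(toH1 φ).val‖ₑ * ‖toH1 φ‖ₑ) := by
  obtain ⟨C, ε₀, hε₀, h⟩ := hΩ.exists_lintegral_sq_le
  refine ⟨C, ε₀, hε₀, fun φ => h φ.1 φ.2.1 _ _ (enorm_le_iff_norm_le.2 (H1.norm_val_le _))
    (eLpNorm_val φ) ?_⟩
  rw [eLpNorm_gradient]
  exact enorm_le_iff_norm_le.2 (H1.norm_grad_le _)

end IsSmoothBoundedDomain

/-! ### Strip integrals and surface integrals -/

/-- For nonnegative functions the difference is at most `(C - 1)` times the smaller integral, and
the two integrals differ at most by the factor `C`. -/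
lemma abs_integral_sub_le_of_nonneg {X : Type*} [MeasurableSpace X] {μ ν : Measure X}
    {C : NNReal} (hC : 1 ≤ C) (h1 : μ ≤ C • ν) (h2 : ν ≤ C • μ) {F : X → ℝ} (hF : ∀ x, 0 ≤ F x)
    (hμ : Integrable F μ) :
    |∫ x, F x ∂μ - ∫ x, F x ∂ν| ≤ (C - 1) * C * ∫ x, F x ∂μ := by
  have hν : Integrable F ν := (hμ.smul_measure_nnreal (c := C)).mono_measure h2
  have i1 : ∫ x, F x ∂μ ≤ C * ∫ x, F x ∂ν :=
    (integral_mono_measure h1 (ae_of_all _ hF) (hν.smul_measure_nnreal (c := C))).trans_eq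
      (integral_smul_nnreal_measure F C)
  have i2 : ∫ x, F x ∂ν ≤ C * ∫ x, F x ∂μ :=
    (integral_mono_measure h2 (ae_of_all _ hF) (hμ.smul_measure_nnreal (c := C))).trans_eq
      (integral_smul_nnreal_measure F C)
  have i3 : 0 ≤ ∫ x, F x ∂μ := integral_nonneg hF
  have hC' : (1 : ℝ) ≤ C := by exact_mod_cast hC
  rw [abs_le]
  constructor <;> nlinarith [mul_nonneg (sub_nonneg.2 hC') i3,
    mul_nonneg (mul_nonneg (sub_nonneg.2 hC') (sub_nonneg.2 hC')) i3]

/-- Measures which are comparable with a constant close to one have nearby integrals. -/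
lemma abs_integral_sub_le_of_comparable {X : Type*} [MeasurableSpace X] {μ ν : Measure X}
    {C : NNReal} (hC : 1 ≤ C) (h1 : μ ≤ C • ν) (h2 : ν ≤ C • μ) {W : X → ℝ}
    (hμ : Integrable W μ) :
    |∫ x, W x ∂μ - ∫ x, W x ∂ν| ≤ (C - 1) * C * ∫ x, |W x| ∂μ := by
  have hν : Integrable W ν := (hμ.smul_measure_nnreal (c := C)).mono_measure h2
  have p := abs_integral_sub_le_of_nonneg hC h1 h2 (F := fun x => max (W x) 0)
    (fun x => le_max_right _ _) hμ.pos_part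
  have n := abs_integral_sub_le_of_nonneg hC h1 h2 (F := fun x => max (-W x) 0)
    (fun x => le_max_right _ _) hμ.neg_part
  have e : ∀ x, W x = max (W x) 0 - max (-W x) 0 := fun x => by
    rcases le_total (W x) 0 with h | h <;> simp [h]
  have e' : ∀ x, |W x| = max (W x) 0 + max (-W x) 0 := fun x => by
    rcases le_total (W x) 0 with h | h <;> simp [h, abs_of_nonneg, abs_of_nonpos]
  rw [integral_congr_ae (ae_of_all _ e'), integral_add hμ.pos_part hμ.neg_part,
    integral_congr_ae (μ := μ) (ae_of_all _ e), integral_sub hμ.pos_part hμ.neg_part,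
    integral_congr_ae (μ := ν) (ae_of_all _ e), integral_sub hν.pos_part hν.neg_part]
  rw [abs_le] at *
  constructor <;> nlinarith [p.1, p.2, n.1, n.2]

lemma enorm_integral_sub_le_of_comparable {X : Type*} [MeasurableSpace X] {μ ν : Measure X}
    {C : NNReal} (hC : 1 ≤ C) (h1 : μ ≤ C • ν) (h2 : ν ≤ C • μ) {W : X → ℝ}
    (hμ : Integrable W μ) :
    ‖∫ x, W x ∂μ - ∫ x, W x ∂ν‖ₑ ≤ ENNReal.ofReal ((C - 1) * C) * ∫⁻ x, ‖W x‖ₑ ∂μ := by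
  have hC' : (1 : ℝ) ≤ C := by exact_mod_cast hC
  rw [← ofReal_integral_norm_eq_lintegral_enorm hμ,
    ← ENNReal.ofReal_mul (mul_nonneg (sub_nonneg.2 hC') (by positivity)), ← ofReal_norm]
  exact ENNReal.ofReal_le_ofReal (abs_integral_sub_le_of_comparable hC h1 h2 hμ)

namespace IsSmoothBoundedDomain

variable (hΩ : IsSmoothBoundedDomain Ω)
include hΩ

lemma isFiniteMeasure_tubeMeasure (ε : ℝ) : IsFiniteMeasure (tubeMeasure Ω ε) := by
  have := hΩ.isFiniteMeasure_surface
  have : IsFiniteMeasure (volume.restrict (Ioo (0 : ℝ) ε)) := ⟨by simp⟩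
  unfold tubeMeasure
  infer_instance

/-- Shrinking a layer onto the boundary changes the mean value over the layer by at most the
integral of the gradient. -/
lemma enorm_integral_tube_sub_le {W : E3 → ℝ} (hW : ContDiff ℝ 1 W) (hc : HasCompactSupport W)
    {ε : ℝ} (hε : 0 < ε) :
    ‖∫ y, W y ∂(tubeMeasure Ω ε) - ε * ∫ x, W x ∂(surface Ω)‖ₑ
      ≤ ENNReal.ofReal ε * ∫⁻ y, ‖gradient W y‖ₑ ∂(tubeMeasure Ω ε) := by
  have := hΩ.isFiniteMeasure_surface
  have := hΩ.isFiniteMeasure_tubeMeasure ε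
  have : IsFiniteMeasure (volume.restrict (Ioo (0 : ℝ) ε)) := ⟨by simp⟩
  have hWi : Integrable W (tubeMeasure Ω ε) := hW.continuous.integrable_of_hasCompactSupport hc
  have hWs : Integrable W (surface Ω) := hW.continuous.integrable_of_hasCompactSupport hc
  have i1 : Integrable (fun z => W (tube Ω z)) ((surface Ω).prod (volume.restrict (Ioo 0 ε))) :=
    hWi.comp_measurable hΩ.measurable_tube
  have i2 : Integrable (fun z : E3 × ℝ => W z.1) ((surface Ω).prod (volume.restrict (Ioo 0 ε))) :=
    hWs.comp_fst _
  have e1 : ∫ y, W y ∂(tubeMeasure Ω ε)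
      = ∫ z, W (tube Ω z) ∂((surface Ω).prod (volume.restrict (Ioo 0 ε))) :=
    integral_map hΩ.measurable_tube.aemeasurable hWi.1
  have e2 : ε * ∫ x, W x ∂(surface Ω)
      = ∫ z, W z.1 ∂((surface Ω).prod (volume.restrict (Ioo 0 ε))) := by
    rw [integral_fun_fst]
    simp [hε.le]
  rw [e1, e2, ← integral_sub i1 i2]
  refine (enorm_integral_le_lintegral_enorm _).trans ?_
  have hm : Measurable fun z : E3 × ℝ => ‖W (tube Ω z) - W z.1‖ₑ :=
    ((hW.continuous.measurable.comp hΩ.measurable_tube).sub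
      (hW.continuous.measurable.comp measurable_fst)).enorm
  rw [lintegral_prod_symm' _ hm]
  refine (setLIntegral_mono' measurableSet_Ioo (fun τ hτ => ?_)
    (g := fun _ => ∫⁻ y, ‖gradient W y‖ₑ ∂(tubeMeasure Ω ε))).trans ?_
  · simpa [tube_zero] using hΩ.lintegral_surface_tube_sub_le hW (σ' := 0)
      ⟨hτ.1.le, hτ.2.le⟩ ⟨le_rfl, hε.le⟩
  · rw [setLIntegral_const, Real.volume_Ioo, sub_zero, mul_comm]

/-- Comparison of the strip and surface integrals of a smooth function. The first term is the error
made by passing from Lebesgue measure to the product measure in normal coordinates, the second one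
the error made by shrinking the layer onto the boundary. -/
lemma enorm_integral_strip_sub_le {W : E3 → ℝ} (hW : ContDiff ℝ 1 W) (hc : HasCompactSupport W)
    {ε : ℝ} (hε : 0 < ε) {C : NNReal} (hC : 1 ≤ C)
    (h1 : volume.restrict (Ω ∩ strip Ω ε) ≤ C • tubeMeasure Ω ε)
    (h2 : tubeMeasure Ω ε ≤ C • volume.restrict (Ω ∩ strip Ω ε)) :
    ‖∫ y, W y ∂(stripMeasure Ω ε) - ∫ x, W x ∂(surface Ω)‖ₑ
      ≤ ENNReal.ofReal ((C - 1) * C) * ∫⁻ x, ‖W x‖ₑ ∂(stripMeasure Ω ε)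
        + C * ∫⁻ x in Ω ∩ strip Ω ε, ‖gradient W x‖ₑ := by
  have hWi : Integrable W (volume.restrict (Ω ∩ strip Ω ε)) :=
    hW.continuous.integrable_of_hasCompactSupport hc
  have h0 : ENNReal.ofReal ε⁻¹ * ENNReal.ofReal ε = 1 := by
    rw [← ENNReal.ofReal_mul (inv_nonneg.2 hε.le), inv_mul_cancel₀ hε.ne', ENNReal.ofReal_one]
  have e1 : ∫ y, W y ∂(stripMeasure Ω ε) - ∫ x, W x ∂(surface Ω)
      = ε⁻¹ * (∫ y, W y ∂(volume.restrict (Ω ∩ strip Ω ε)) - ∫ y, W y ∂(tubeMeasure Ω ε))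
        + ε⁻¹ * (∫ y, W y ∂(tubeMeasure Ω ε) - ε * ∫ x, W x ∂(surface Ω)) := by
    rw [stripMeasure, integral_smul_measure, ENNReal.toReal_ofReal (inv_nonneg.2 hε.le),
      smul_eq_mul]
    field_simp
    ring
  have e3 : ‖ε⁻¹‖ₑ = ENNReal.ofReal ε⁻¹ := Real.enorm_of_nonneg (inv_nonneg.2 hε.le)
  rw [e1]
  refine (enorm_add_le _ _).trans (add_le_add ?_ ?_)
  · rw [enorm_mul, e3, stripMeasure, lintegral_smul_measure, smul_eq_mul, mul_left_comm]
    exact mul_le_mul' le_rfl (enorm_integral_sub_le_of_comparable hC h1 h2 hWi)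
  · rw [enorm_mul, e3]
    refine (mul_le_mul' le_rfl (hΩ.enorm_integral_tube_sub_le hW hc hε)).trans ?_
    rw [← mul_assoc, h0, one_mul]
    refine (lintegral_mono' h2 le_rfl).trans ?_
    rw [lintegral_smul_measure]
    rfl

end IsSmoothBoundedDomain

/-! ### Trace operators -/

lemma norm_sq_le_of_enorm {E E' E'' : Type*} [NormedAddCommGroup E] [NormedAddCommGroup E']
    [NormedAddCommGroup E''] {w : E} {a : E'} {b : E''} {C : NNReal}
    (h : ‖w‖ₑ ^ 2 ≤ C * (‖a‖ₑ * ‖b‖ₑ)) : ‖w‖ ^ 2 ≤ C * (‖a‖ * ‖b‖) := by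
  simp only [enorm_eq_nnnorm] at h
  exact_mod_cast h

lemma enorm_sq_eq_lintegral {μ : Measure E3} {w : Lp ℝ 2 μ} {f : E3 → ℝ} (h : w =ᵐ[μ] f) :
    ‖w‖ₑ ^ 2 = ∫⁻ x, ‖f x‖ₑ ^ 2 ∂μ := by
  rw [← eLpNorm_two_sq, ← eLpNorm_congr_ae h, Lp.enorm_def]

/-- `B` is a trace operator from `H¹(Ω)` to `L²(μ)`: it is restriction on smooth functions, and
satisfies the interpolated trace inequality with constant `C`. The inclusion of `H¹(Ω)` into
`L²(Ω)`, the trace on the boundary, and the restriction to a boundary strip are examples. -/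
structure IsTrace (μ : Measure E3) (C : ℝ) (B : H1 Ω →L[ℝ] Lp ℝ 2 μ) : Prop where
  nonneg : 0 ≤ C
  ae_eq : ∀ φ : smoothFunctions Ω, B (toH1 φ) =ᵐ[μ] φ.1
  norm_sq_le : ∀ u, ‖B u‖ ^ 2 ≤ C * (‖u.val‖ * ‖u‖)

/-- The inclusion of `H¹(Ω)` into `L²(Ω)`. -/
def valL : H1 Ω →L[ℝ] Lp ℝ 2 (volume.restrict Ω) :=
  LinearMap.mkContinuous ⟨⟨H1.val, fun _ _ => rfl⟩, fun _ _ => rfl⟩ 1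
    fun u => (H1.norm_val_le u).trans_eq (one_mul _).symm

lemma IsTrace.mono {μ : Measure E3} {C C' : ℝ} {B : H1 Ω →L[ℝ] Lp ℝ 2 μ} (h : IsTrace μ C B)
    (hC : C ≤ C') : IsTrace μ C' B :=
  ⟨h.nonneg.trans hC, h.ae_eq, fun u => (h.norm_sq_le u).trans (by gcongr)⟩

lemma isTrace_valL : IsTrace (volume.restrict Ω) 1 (valL (Ω := Ω)) where
  nonneg := zero_le_one
  ae_eq := toH1_val_ae_eq
  norm_sq_le u := by
    rw [one_mul, sq]
    exact mul_le_mul_of_nonneg_left (H1.norm_val_le u) (norm_nonneg _)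

lemma stripMeasure_le (ε : ℝ) :
    stripMeasure Ω ε ≤ ENNReal.ofReal ε⁻¹ • volume.restrict Ω := by
  unfold stripMeasure
  gcongr
  exact inter_subset_left

lemma stripMeasure_absolutelyContinuous (ε : ℝ) : stripMeasure Ω ε ≪ volume.restrict Ω :=
  Measure.absolutelyContinuous_of_le_smul (stripMeasure_le ε)

lemma memLp_stripMeasure (ε : ℝ) (w : Lp ℝ 2 (volume.restrict Ω)) :
    MemLp w 2 (stripMeasure Ω ε) :=
  (Lp.memLp w).of_measure_le_smul ENNReal.ofReal_ne_top (stripMeasure_le ε)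

/-- The restriction of elements of `H¹(Ω)` to the boundary strip. -/
def stripTrace (Ω : Set E3) (ε : ℝ) : H1 Ω →L[ℝ] Lp ℝ 2 (stripMeasure Ω ε) :=
  LinearMap.mkContinuous
    { toFun := fun u => (memLp_stripMeasure ε u.val).toLp u.val
      map_add' := fun u v => by
        rw [← MemLp.toLp_add]
        exact MemLp.toLp_congr _ _
          ((stripMeasure_absolutelyContinuous ε).ae_eq (Lp.coeFn_add u.val v.val))
      map_smul' := fun c u => by
        rw [RingHom.id_apply, ← MemLp.toLp_const_smul]
        exact MemLp.toLp_congr _ _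
          ((stripMeasure_absolutelyContinuous ε).ae_eq (Lp.coeFn_smul c u.val)) }
    (ENNReal.ofReal ε⁻¹ ^ (1 / 2 : ℝ)).toReal fun u => by
      refine le_trans ?_ (mul_le_mul_of_nonneg_left (H1.norm_val_le u) ENNReal.toReal_nonneg)
      have h : eLpNorm u.val 2 (stripMeasure Ω ε)
          ≤ ENNReal.ofReal ε⁻¹ ^ (1 / 2 : ℝ) * eLpNorm u.val 2 (volume.restrict Ω) := by
        refine (eLpNorm_mono_measure _ (stripMeasure_le ε)).trans_eq ?_
        rw [eLpNorm_smul_measure_of_ne_top (by simp)]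
        simp
      have hfin : ENNReal.ofReal ε⁻¹ ^ (1 / 2 : ℝ) * eLpNorm u.val 2 (volume.restrict Ω) ≠ ⊤ :=
        ENNReal.mul_ne_top (ENNReal.rpow_ne_top_of_nonneg (by norm_num) ENNReal.ofReal_ne_top)
          (Lp.eLpNorm_ne_top _)
      have := ENNReal.toReal_mono hfin h
      rw [ENNReal.toReal_mul] at this
      change ‖(memLp_stripMeasure ε u.val).toLp u.val‖ ≤ _
      rwa [Lp.norm_toLp, Lp.norm_def]

lemma stripTrace_ae_eq (ε : ℝ) (u : H1 Ω) : stripTrace Ω ε u =ᵐ[stripMeasure Ω ε] u.val :=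
  (memLp_stripMeasure ε u.val).coeFn_toLp

/-- The interpolated inequality extends from smooth functions by density, its two sides being
continuous. -/
lemma isTrace_of_dense {μ : Measure E3} {C : NNReal} {B : H1 Ω →L[ℝ] Lp ℝ 2 μ}
    (hd : DenseRange (toH1 : smoothFunctions Ω →ₗ[ℝ] H1 Ω))
    (hB : ∀ φ : smoothFunctions Ω, B (toH1 φ) =ᵐ[μ] φ.1)
    (h : ∀ φ : smoothFunctions Ω,
      ∫⁻ x, ‖φ.1 x‖ₑ ^ 2 ∂μ ≤ C * (‖(toH1 φ).val‖ₑ * ‖toH1 φ‖ₑ)) :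
    IsTrace μ C B := by
  refine ⟨C.2, hB, fun u => ?_⟩
  have hv : Continuous fun u : H1 Ω => ‖u.val‖ := (valL (Ω := Ω)).continuous.norm
  refine hd.induction_on (p := fun u => ‖B u‖ ^ 2 ≤ C * (‖u.val‖ * ‖u‖)) u
    (isClosed_le (B.continuous.norm.pow 2) (continuous_const.mul (hv.mul continuous_norm)))
    fun φ => norm_sq_le_of_enorm ?_
  rw [enorm_sq_eq_lintegral (hB φ)]
  exact h φ

namespace IsSmoothBoundedDomain

variable (hΩ : IsSmoothBoundedDomain Ω)
include hΩ

/-- The three trace operators, with a common constant. -/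
theorem exists_isTrace : ∃ C : ℝ, 1 ≤ C ∧ ∃ ε₀ > 0,
    IsTrace (volume.restrict Ω) C (valL (Ω := Ω)) ∧ IsTrace (surface Ω) C (trace (Ω := Ω)) ∧
    ∀ ε ∈ Ioc 0 ε₀, IsTrace (stripMeasure Ω ε) C (stripTrace Ω ε) := by
  obtain ⟨C, ε₀, hε₀, h⟩ := hΩ.exists_trace_bound
  have hd := hΩ.denseRange_toH1
  have hb : ∀ φ : smoothFunctions Ω, ‖toBoundary φ‖ ≤ Real.sqrt C * ‖toH1 φ‖ := by
    intro φ
    have h1 : (toBoundary φ : Lp ℝ 2 (surface Ω)) =ᵐ[surface Ω] φ.1 := φ.2.2.2.coeFn_toLp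
    have h2 := norm_sq_le_of_enorm ((enorm_sq_eq_lintegral h1).trans_le (h φ).1)
    refine abs_le_of_sq_le_sq' ?_ (by positivity) |>.2
    rw [mul_pow, Real.sq_sqrt C.coe_nonneg, sq ‖toH1 φ‖]
    exact h2.trans (by gcongr; exact H1.norm_val_le _)
  refine ⟨max 1 C, le_max_left _ _, ε₀, hε₀, isTrace_valL.mono (le_max_left _ _), ?_,
    fun ε hε => ?_⟩
  · refine (isTrace_of_dense hd (fun φ => ?_) fun φ => (h φ).1).mono (le_max_right _ _)
    rw [trace, LinearMap.extendOfNorm_eq hd ⟨_, hb⟩]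
    exact φ.2.2.2.coeFn_toLp
  · refine (isTrace_of_dense hd (fun φ => ?_) fun φ => (h φ).2 ε hε).mono (le_max_right _ _)
    exact (stripTrace_ae_eq ε _).trans
      ((stripMeasure_absolutelyContinuous ε).ae_eq (toH1_val_ae_eq φ))

end IsSmoothBoundedDomain

/-! ### Weighted forms and a compactness estimate -/

section WeightedForm

variable {X : Type*} [MeasurableSpace X] {μ : Measure X}

lemma integrable_abs_mul_abs (f g : Lp ℝ 2 μ) : Integrable (fun x => |f x| * |g x|) μ :=
  (Lp.memLp f).abs.integrable_mul (Lp.memLp g).abs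

lemma integral_abs_mul_abs_le (f g : Lp ℝ 2 μ) : ∫ x, |f x| * |g x| ∂μ ≤ ‖f‖ * ‖g‖ := by
  have h := lintegral_enorm_mul_le (Lp.aestronglyMeasurable f) (Lp.aestronglyMeasurable g)
  have e : ∀ x, |f x| * |g x| = ‖f x * g x‖ := fun x => by rw [Real.norm_eq_abs, abs_mul]
  simp only [e]
  rw [integral_norm_eq_lintegral_enorm (f := fun x => f x * g x)
    ((Lp.aestronglyMeasurable f).mul (Lp.aestronglyMeasurable g)), Lp.norm_def, Lp.norm_def,
    ← ENNReal.toReal_mul]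
  simp only [enorm_mul]
  exact ENNReal.toReal_mono (ENNReal.mul_ne_top (Lp.eLpNorm_ne_top f) (Lp.eLpNorm_ne_top g)) h

lemma integrable_weight_mul {h : X → ℝ} {K : ℝ} (hm : AEStronglyMeasurable h μ)
    (hb : ∀ x, |h x| ≤ K) (f g : Lp ℝ 2 μ) : Integrable (fun x => h x * f x * g x) μ := by
  have h1 : Integrable (fun x => f x * g x) μ := (Lp.memLp f).integrable_mul (Lp.memLp g)
  have h2 := h1.bdd_mul hm (ae_of_all _ hb)
  simpa only [mul_assoc] using h2

lemma abs_integral_weight_mul_le {h : X → ℝ} {K : ℝ} (hb : ∀ x, |h x| ≤ K) (f g : Lp ℝ 2 μ) :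
    |∫ x, h x * f x * g x ∂μ| ≤ K * ‖f‖ * ‖g‖ := by
  by_cases hμ : μ = 0
  · subst hμ
    have : ‖f‖ = 0 := by simp [Lp.norm_def]
    simp [this]
  have : Nonempty X := not_isEmpty_iff.1 fun _ => hμ (Measure.eq_zero_of_isEmpty μ)
  have hK : 0 ≤ K := (abs_nonneg _).trans (hb this.some)
  have hle : ‖∫ x, h x * f x * g x ∂μ‖ ≤ ∫ x, K * (|f x| * |g x|) ∂μ := by
    refine norm_integral_le_of_norm_le ((integrable_abs_mul_abs f g).const_mul K)
      (ae_of_all _ fun x => ?_)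
    rw [Real.norm_eq_abs, abs_mul, abs_mul, mul_assoc]
    exact mul_le_mul_of_nonneg_right (hb x) (by positivity)
  refine hle.trans ?_
  rw [integral_const_mul, mul_assoc]
  exact mul_le_mul_of_nonneg_left (integral_abs_mul_abs_le f g) hK

/-- The bilinear form `(f, g) ↦ ∫ h f g dμ` on `L²(μ)`, for a bounded weight `h`. -/
def weightedForm {h : X → ℝ} {K : ℝ} (hm : AEStronglyMeasurable h μ)
    (hb : ∀ x, |h x| ≤ K) : Lp ℝ 2 μ →L[ℝ] Lp ℝ 2 μ →L[ℝ] ℝ :=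
  LinearMap.mkContinuous₂ (LinearMap.mk₂ ℝ (fun f g : Lp ℝ 2 μ => ∫ x, h x * f x * g x ∂μ)
    (fun f f' g => by
      rw [← integral_add (integrable_weight_mul hm hb f g) (integrable_weight_mul hm hb f' g)]
      refine integral_congr_ae ?_
      filter_upwards [Lp.coeFn_add f f'] with x hx
      rw [hx, Pi.add_apply]
      ring)
    (fun c f g => by
      rw [smul_eq_mul, ← integral_const_mul]
      refine integral_congr_ae ?_
      filter_upwards [Lp.coeFn_smul c f] with x hx
      rw [hx, Pi.smul_apply, smul_eq_mul]
      ring)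
    (fun f g g' => by
      rw [← integral_add (integrable_weight_mul hm hb f g) (integrable_weight_mul hm hb f g')]
      refine integral_congr_ae ?_
      filter_upwards [Lp.coeFn_add g g'] with x hx
      rw [hx, Pi.add_apply]
      ring)
    (fun c f g => by
      rw [smul_eq_mul, ← integral_const_mul]
      refine integral_congr_ae ?_
      filter_upwards [Lp.coeFn_smul c g] with x hx
      rw [hx, Pi.smul_apply, smul_eq_mul]
      ring)) K (fun f g => abs_integral_weight_mul_le hb f g)

end WeightedForm

lemma IsTrace.norm_le {μ : Measure E3} {C : ℝ} {B : H1 Ω →L[ℝ] Lp ℝ 2 μ} (h : IsTrace μ C B)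
    (u : H1 Ω) : ‖B u‖ ≤ Real.sqrt C * ‖u‖ := by
  refine (abs_le_of_sq_le_sq' ?_ (by positivity [h.nonneg])).2
  rw [mul_pow, Real.sq_sqrt h.nonneg, sq ‖u‖]
  refine (h.norm_sq_le u).trans (mul_le_mul_of_nonneg_left ?_ h.nonneg)
  exact mul_le_mul_of_nonneg_right (H1.norm_val_le u) (norm_nonneg _)

lemma integrable_min_mul {X : Type*} [MeasurableSpace X] {μ : Measure X} (z w p : Lp ℝ 2 μ) :
    Integrable (fun x => min 1 |z x| * (|w x| * |p x|)) μ := by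
  refine (integrable_abs_mul_abs w p).bdd_mul (c := 1) ?_ (ae_of_all _ fun x => ?_)
  · exact aestronglyMeasurable_const.inf (Lp.aestronglyMeasurable z).norm
  · rw [Real.norm_eq_abs, abs_of_nonneg (le_min zero_le_one (abs_nonneg _))]
    exact min_le_left _ _

/-- A bound for the integral of `min (1, |z|) |w| |p|` if `w` is close to a bounded function. -/
lemma integral_min_mul_le {X : Type*} [MeasurableSpace X] {μ : Measure X} (z w w' p : Lp ℝ 2 μ) {M : ℝ} (hM : 0 ≤ M)
    (hw' : ∀ᵐ x ∂μ, |w' x| ≤ M) :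
    ∫ x, min 1 |z x| * (|w x| * |p x|) ∂μ ≤ (‖w - w'‖ + M * ‖z‖) * ‖p‖ := by
  have i1 := integrable_abs_mul_abs (w - w') p
  have i2 := (integrable_abs_mul_abs z p).const_mul M
  refine (integral_mono_ae (integrable_min_mul z w p) (i1.add i2) ?_).trans ?_
  · filter_upwards [hw', Lp.coeFn_sub w w'] with x h1 h2
    simp only [Pi.add_apply, h2, Pi.sub_apply]
    have m0 : 0 ≤ min 1 |z x| := le_min zero_le_one (abs_nonneg _)
    have m1 : min 1 |z x| ≤ 1 := min_le_left _ _
    have m2 : min 1 |z x| ≤ |z x| := min_le_right _ _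
    have h3 : |w x| ≤ |w x - w' x| + |w' x| := by
      simpa using abs_add_le (w x - w' x) (w' x)
    have h4 : min 1 |z x| * |w x| ≤ |w x - w' x| + M * |z x| :=
      calc min 1 |z x| * |w x| ≤ min 1 |z x| * (|w x - w' x| + |w' x|) := by gcongr
        _ = min 1 |z x| * |w x - w' x| + min 1 |z x| * |w' x| := by ring
        _ ≤ 1 * |w x - w' x| + |z x| * M := by gcongr
        _ = _ := by ring
    calc min 1 |z x| * (|w x| * |p x|) = (min 1 |z x| * |w x|) * |p x| := by ring
      _ ≤ (|w x - w' x| + M * |z x|) * |p x| := by gcongr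
      _ = _ := by ring
  · rw [integral_add' i1 i2, integral_const_mul]
    have j1 := integral_abs_mul_abs_le (w - w') p
    have j2 := mul_le_mul_of_nonneg_left (integral_abs_mul_abs_le z p) hM
    linarith

namespace IsSmoothBoundedDomain

variable (hΩ : IsSmoothBoundedDomain Ω)
include hΩ

set_option maxHeartbeats 1000000 in
/-- `u ↦ j'(u)`, as a map from `H¹(Ω)` to bilinear forms on `H¹(Ω)`, is continuous, uniformly with
respect to the trace operator. By Rellich's theorem one of the factors may be assumed to be one of
finitely many bounded functions. -/
theorem exists_integral_min_mul_le {C η : ℝ} (hC : 0 ≤ C) (hη : 0 < η) :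
    ∃ δ > 0, ∀ (μ : Measure E3) (B : H1 Ω →L[ℝ] Lp ℝ 2 μ), IsTrace μ C B →
      ∀ z w p : H1 Ω, ‖z‖ ≤ δ →
        ∫ x, min 1 |B z x| * (|B w x| * |B p x|) ∂μ ≤ η * (‖w‖ * ‖p‖) := by
  set A := Real.sqrt C with hA
  have hA0 : 0 ≤ A := Real.sqrt_nonneg _
  set κ : ℝ := η / (2 * (A + 1)) with hκ
  have hκ0 : 0 < κ := by positivity
  have hκA : κ * A ≤ η / 2 := by
    rw [hκ, div_mul_eq_mul_div, div_le_iff₀ (by positivity)]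
    nlinarith
  obtain ⟨η', hη', hη'κ⟩ : ∃ η' > 0, C * (η' * 3) ≤ κ ^ 2 := by
    refine ⟨κ ^ 2 / ((C + 1) * 3), by positivity, ?_⟩
    rw [div_mul_eq_mul_div, mul_div_assoc', div_le_iff₀ (by positivity)]
    nlinarith [sq_nonneg κ]
  obtain ⟨T, hTf, hT⟩ := hΩ.exists_finite_net hη'
  obtain ⟨M, hM0, hM⟩ : ∃ M ≥ 0, ∀ φ ∈ T, ∀ x, |φ.1 x| ≤ M := by
    have h1 : ∀ φ : smoothFunctions Ω, ∃ M, ∀ x, ‖φ.1 x‖ ≤ M := fun φ =>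
      φ.2.1.continuous.bounded_above_of_compact_support φ.2.2.1
    choose M hM using h1
    obtain ⟨M', hM'⟩ := (hTf.image M).bddAbove
    exact ⟨max M' 0, le_max_right _ _, fun φ hφ x => (hM φ x).trans
      ((hM' (mem_image_of_mem _ hφ)).trans (le_max_left _ _))⟩
  obtain ⟨δ, hδ, hδη⟩ : ∃ δ > 0, M * (A * δ) * A ≤ η / 2 := by
    refine ⟨η / (2 * (M * A * A + 1)), by positivity, ?_⟩
    rw [mul_div_assoc', mul_div_assoc', div_mul_eq_mul_div, div_le_iff₀ (by positivity)]
    nlinarith [mul_nonneg (mul_nonneg hM0 hA0) hA0]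
  refine ⟨δ, hδ, fun μ B hB z w p hz => ?_⟩
  have key : ∀ w : H1 Ω, ‖w‖ ≤ 1 →
      ∫ x, min 1 |B z x| * (|B w x| * |B p x|) ∂μ ≤ η * ‖p‖ := by
    intro w hw
    obtain ⟨φ, hφ, hφ2, hφη⟩ := hT w hw
    have hb : ‖B w - B (toH1 φ)‖ ≤ κ := by
      rw [← map_sub]
      refine (abs_le_of_sq_le_sq' ((hB.norm_sq_le _).trans (le_trans ?_ hη'κ)) hκ0.le).2
      refine mul_le_mul_of_nonneg_left (mul_le_mul hφη ?_ (norm_nonneg _) hη'.le) hC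
      exact (norm_sub_le _ _).trans (by linarith)
    refine (integral_min_mul_le (B z) (B w) (B (toH1 φ)) (B p) hM0 ?_).trans ?_
    · filter_upwards [hB.ae_eq φ] with x hx
      rw [hx]
      exact hM φ hφ x
    · calc (‖B w - B (toH1 φ)‖ + M * ‖B z‖) * ‖B p‖ ≤ (κ + M * (A * δ)) * (A * ‖p‖) := by
            gcongr
            · exact (hB.norm_le z).trans (by gcongr)
            · exact hB.norm_le p
        _ = (κ * A + M * (A * δ) * A) * ‖p‖ := by ring
        _ ≤ η * ‖p‖ := by gcongr; linarith
  by_cases hw : ‖w‖ = 0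
  · have h0 : w = 0 := norm_eq_zero.1 hw
    have := key 0 (by simp)
    have e : ∫ x, min 1 |B z x| * (|B w x| * |B p x|) ∂μ = 0 := by
      refine integral_eq_zero_of_ae ?_
      rw [h0, map_zero]
      filter_upwards [Lp.coeFn_zero ℝ 2 μ] with x hx
      simp only [hx, Pi.zero_apply, abs_zero, zero_mul, mul_zero]
    rw [e]
    positivity
  · have h1 := key (‖w‖⁻¹ • w) (by rw [norm_smul, norm_inv, norm_norm, inv_mul_cancel₀ hw])
    have e : ∫ x, min 1 |B z x| * (|B (‖w‖⁻¹ • w) x| * |B p x|) ∂μ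
        = ‖w‖⁻¹ * ∫ x, min 1 |B z x| * (|B w x| * |B p x|) ∂μ := by
      rw [← integral_const_mul]
      refine integral_congr_ae ?_
      rw [map_smul]
      filter_upwards [Lp.coeFn_smul ‖w‖⁻¹ (B w)] with x hx
      rw [hx, Pi.smul_apply, smul_eq_mul, abs_mul, abs_inv, abs_norm]
      ring
    rw [e] at h1
    have hw' : 0 < ‖w‖ := lt_of_le_of_ne (norm_nonneg _) (Ne.symm hw)
    rw [inv_mul_le_iff₀ hw'] at h1
    linarith

end IsSmoothBoundedDomain

/-! ### Convergence of the forms of the strips -/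

/-- The gradient of a product with a bounded factor `H` is small in `L¹` of a set on which `φ` and
`ψ` are small in `L²`. -/
lemma lintegral_gradient_mul_mul_le {μ : Measure E3} {H φ ψ : E3 → ℝ} (hH : ContDiff ℝ 1 H)
    (hφ : ContDiff ℝ 1 φ) (hψ : ContDiff ℝ 1 ψ) {M s p q : ℝ≥0∞} (hM : M ≠ ⊤)
    (hH0 : ∀ x, ‖H x‖ₑ ≤ M) (hH1 : ∀ x, ‖gradient H x‖ₑ ≤ M)
    (h1 : eLpNorm φ 2 μ ≤ s * p) (h2 : eLpNorm ψ 2 μ ≤ s * q) (h3 : eLpNorm ψ 2 μ ≤ q)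
    (h4 : eLpNorm (gradient φ) 2 μ ≤ p) (h5 : eLpNorm (gradient ψ) 2 μ ≤ q) :
    ∫⁻ x, ‖gradient (fun y => H y * (φ y * ψ y)) x‖ₑ ∂μ ≤ 3 * M * s * (p * q) := by
  have hgφ := contDiff_one_continuous_gradient hφ
  have hgψ := contDiff_one_continuous_gradient hψ
  have hpt : ∀ x, ‖gradient (fun y => H y * (φ y * ψ y)) x‖ₑ
      ≤ M * (‖φ x‖ₑ * ‖ψ x‖ₑ + (‖φ x‖ₑ * ‖gradient ψ x‖ₑ + ‖ψ x‖ₑ * ‖gradient φ x‖ₑ)) := by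
    intro x
    have d1 := hφ.differentiable (by simp) x
    have d2 := hψ.differentiable (by simp) x
    rw [gradient_mul (hH.differentiable (by simp) x) (d1.fun_mul d2), gradient_mul d1 d2,
      add_comm, mul_add]
    refine (enorm_add_le _ _).trans (add_le_add ?_ ?_)
    · rw [enorm_smul, enorm_mul, mul_comm]
      exact mul_le_mul' (hH1 x) le_rfl
    · rw [enorm_smul]
      refine mul_le_mul' (hH0 x) ((enorm_add_le _ _).trans ?_)
      rw [enorm_smul, enorm_smul]
  have m1 : Measurable fun x => ‖φ x‖ₑ * ‖ψ x‖ₑ :=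
    hφ.continuous.enorm.measurable.mul hψ.continuous.enorm.measurable
  have m2 : Measurable fun x => ‖φ x‖ₑ * ‖gradient ψ x‖ₑ :=
    hφ.continuous.enorm.measurable.mul hgψ.enorm.measurable
  have i1 : ∫⁻ x, ‖φ x‖ₑ * ‖ψ x‖ₑ ∂μ ≤ s * p * q :=
    (lintegral_enorm_mul_le hφ.continuous.aestronglyMeasurable
      hψ.continuous.aestronglyMeasurable).trans (mul_le_mul' h1 h3)
  have i2 : ∫⁻ x, ‖φ x‖ₑ * ‖gradient ψ x‖ₑ ∂μ ≤ s * p * q :=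
    (lintegral_enorm_mul_le hφ.continuous.aestronglyMeasurable
      hgψ.aestronglyMeasurable).trans (mul_le_mul' h1 h5)
  have i3 : ∫⁻ x, ‖ψ x‖ₑ * ‖gradient φ x‖ₑ ∂μ ≤ s * q * p :=
    (lintegral_enorm_mul_le hψ.continuous.aestronglyMeasurable
      hgφ.aestronglyMeasurable).trans (mul_le_mul' h2 h4)
  refine (lintegral_mono hpt).trans ?_
  rw [lintegral_const_mul' _ _ hM, lintegral_add_left m1, lintegral_add_left m2]
  calc M * _ ≤ M * (s * p * q + (s * p * q + s * q * p)) := by gcongr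
    _ = 3 * M * s * (p * q) := by ring

/-- With respect to Lebesgue measure, the norm on a strip gains a factor `√ε` over the normalised
one. -/
lemma eLpNorm_restrict_strip {V : Type*} [NormedAddCommGroup V] {φ : E3 → V} {ε : ℝ} (hε : 0 < ε) :
    eLpNorm φ 2 (volume.restrict (Ω ∩ strip Ω ε))
      = ENNReal.ofReal (Real.sqrt ε) * eLpNorm φ 2 (stripMeasure Ω ε) := by
  have e : volume.restrict (Ω ∩ strip Ω ε) = ENNReal.ofReal ε • stripMeasure Ω ε := by
    rw [stripMeasure, smul_smul, ← ENNReal.ofReal_mul hε.le, mul_inv_cancel₀ hε.ne',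
      ENNReal.ofReal_one, one_smul]
  rw [e, eLpNorm_smul_measure_of_ne_top (by simp), Real.sqrt_eq_rpow]
  rw [smul_eq_mul, ENNReal.ofReal_rpow_of_pos hε]
  norm_num

lemma IsTrace.eLpNorm_le {μ : Measure E3} {C : ℝ} {B : H1 Ω →L[ℝ] Lp ℝ 2 μ} (h : IsTrace μ C B)
    (φ : smoothFunctions Ω) :
    eLpNorm φ.1 2 μ ≤ ENNReal.ofReal (Real.sqrt C) * ‖toH1 φ‖ₑ := by
  rw [← eLpNorm_congr_ae (h.ae_eq φ), ← Lp.enorm_def, ← ofReal_norm, ← ofReal_norm,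
    ← ENNReal.ofReal_mul (Real.sqrt_nonneg _)]
  exact ENNReal.ofReal_le_ofReal (h.norm_le _)

namespace IsSmoothBoundedDomain

variable (hΩ : IsSmoothBoundedDomain Ω)
include hΩ

/-- The form of a strip with weight `H`, on smooth functions, compared with the form of the
boundary. In the gradient of `H φ ψ` each term has a factor without derivative, whose `L²` norm on
the strip is `O(√ε)` by the trace inequality. -/
lemma enorm_integral_strip_mul_sub_le {C : ℝ} {ε : ℝ} (hε : 0 < ε)
    (hB : IsTrace (stripMeasure Ω ε) C (stripTrace Ω ε)) {c : NNReal} (hc : 1 ≤ c)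
    (h1 : volume.restrict (Ω ∩ strip Ω ε) ≤ c • tubeMeasure Ω ε)
    (h2 : tubeMeasure Ω ε ≤ c • volume.restrict (Ω ∩ strip Ω ε))
    {H : E3 → ℝ} (hH : ContDiff ℝ 1 H) {M : ℝ≥0∞} (hM : M ≠ ⊤)
    (hH0 : ∀ x, ‖H x‖ₑ ≤ M) (hH1 : ∀ x, ‖gradient H x‖ₑ ≤ M) (φ ψ : smoothFunctions Ω) :
    ‖∫ y, H y * (φ.1 y * ψ.1 y) ∂(stripMeasure Ω ε)
        - ∫ x, H x * (φ.1 x * ψ.1 x) ∂(surface Ω)‖ₑ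
      ≤ (ENNReal.ofReal ((c - 1) * c) * (M * ENNReal.ofReal (Real.sqrt C) ^ 2)
        + c * (3 * M * (ENNReal.ofReal (Real.sqrt ε) * ENNReal.ofReal (Real.sqrt C))))
        * (‖toH1 φ‖ₑ * ‖toH1 ψ‖ₑ) := by
  have hφ1 : ContDiff ℝ 1 φ.1 := φ.2.1.of_le (by simp)
  have hψ1 : ContDiff ℝ 1 ψ.1 := ψ.2.1.of_le (by simp)
  have hW : ContDiff ℝ 1 fun y => H y * (φ.1 y * ψ.1 y) := hH.mul (hφ1.mul hψ1)
  have hWc : HasCompactSupport fun y => H y * (φ.1 y * ψ.1 y) :=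
    (φ.2.2.1.mul_right (f' := ψ.1)).mul_left
  refine (hΩ.enorm_integral_strip_sub_le hW hWc hε hc h1 h2).trans ?_
  have b1 := hB.eLpNorm_le φ
  have b2 := hB.eLpNorm_le ψ
  have hle : volume.restrict (Ω ∩ strip Ω ε) ≤ volume.restrict Ω := by
    gcongr
    exact inter_subset_left
  have n1 : ‖(toH1 φ).grad‖ₑ ≤ ‖toH1 φ‖ₑ := enorm_le_iff_norm_le.2 (H1.norm_grad_le _)
  have n2 : ‖(toH1 ψ).grad‖ₑ ≤ ‖toH1 ψ‖ₑ := enorm_le_iff_norm_le.2 (H1.norm_grad_le _)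
  have n3 : ‖(toH1 ψ).val‖ₑ ≤ ‖toH1 ψ‖ₑ := enorm_le_iff_norm_le.2 (H1.norm_val_le _)
  have i1 : ∫⁻ x, ‖H x * (φ.1 x * ψ.1 x)‖ₑ ∂(stripMeasure Ω ε)
      ≤ M * ENNReal.ofReal (Real.sqrt C) ^ 2 * (‖toH1 φ‖ₑ * ‖toH1 ψ‖ₑ) := by
    simp only [enorm_mul]
    refine (lintegral_mono fun x => mul_le_mul' (hH0 x) le_rfl).trans ?_
    rw [lintegral_const_mul' _ _ hM, mul_assoc]
    refine mul_le_mul' le_rfl ((lintegral_enorm_mul_le hφ1.continuous.aestronglyMeasurable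
      hψ1.continuous.aestronglyMeasurable).trans ((mul_le_mul' b1 b2).trans_eq ?_))
    ring
  have i2 : ∫⁻ x in Ω ∩ strip Ω ε, ‖gradient (fun y => H y * (φ.1 y * ψ.1 y)) x‖ₑ
      ≤ 3 * M * (ENNReal.ofReal (Real.sqrt ε) * ENNReal.ofReal (Real.sqrt C))
        * (‖toH1 φ‖ₑ * ‖toH1 ψ‖ₑ) := by
    refine lintegral_gradient_mul_mul_le hH hφ1 hψ1 hM hH0 hH1 ?_ ?_ ?_ ?_ ?_
    · rw [eLpNorm_restrict_strip hε, mul_assoc]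
      exact mul_le_mul' le_rfl b1
    · rw [eLpNorm_restrict_strip hε, mul_assoc]
      exact mul_le_mul' le_rfl b2
    · exact (eLpNorm_mono_measure _ hle).trans ((eLpNorm_val ψ).trans_le n3)
    · exact (eLpNorm_mono_measure _ hle).trans ((eLpNorm_gradient φ).trans_le n1)
    · exact (eLpNorm_mono_measure _ hle).trans ((eLpNorm_gradient ψ).trans_le n2)
  refine (add_le_add (mul_le_mul' le_rfl i1) (mul_le_mul' le_rfl i2)).trans_eq ?_
  ring

end IsSmoothBoundedDomain

/-- Choice of the constants in the comparison of strip and surface integrals. -/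
lemma exists_comparison_constants {A M η : ℝ} (hA : 0 ≤ A) (hM : 0 ≤ M) (hη : 0 < η) :
    ∃ c : NNReal, 1 < c ∧ ∃ ε₁ > 0, ∀ ε ∈ Ioc 0 ε₁,
      (c - 1) * c * (M * A ^ 2) + c * (3 * M * (Real.sqrt ε * A)) ≤ η := by
  obtain ⟨κ, hκ, hκ1, hκη⟩ : ∃ κ : ℝ, 0 < κ ∧ κ ≤ 1 ∧ κ * (4 * (M * A ^ 2)) ≤ η := by
    refine ⟨min 1 (η / (4 * (M * A ^ 2) + 1)), by positivity, min_le_left _ _, ?_⟩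
    refine (mul_le_mul_of_nonneg_right (min_le_right _ _) (by positivity)).trans ?_
    rw [div_mul_eq_mul_div, div_le_iff₀ (by positivity)]
    nlinarith
  refine ⟨1 + κ.toNNReal, ?_, (η / (12 * (M * A) + 1)) ^ 2, by positivity,
    fun ε hε => ?_⟩
  · exact lt_add_of_pos_right _ (Real.toNNReal_pos.2 hκ)
  have hs : Real.sqrt ε ≤ η / (12 * (M * A) + 1) := by
    rw [← Real.sqrt_sq (show 0 ≤ η / (12 * (M * A) + 1) by positivity)]
    exact Real.sqrt_le_sqrt hε.2
  have hs' : Real.sqrt ε * (12 * (M * A)) ≤ η := by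
    refine (mul_le_mul_of_nonneg_right hs (by positivity)).trans ?_
    rw [div_mul_eq_mul_div, div_le_iff₀ (by positivity)]
    have : 0 ≤ M * A := by positivity
    nlinarith
  have e : ((1 + κ.toNNReal : NNReal) : ℝ) = 1 + κ := by
    rw [NNReal.coe_add, Real.coe_toNNReal _ hκ.le, NNReal.coe_one]
  rw [e, add_sub_cancel_left]
  have t1 : κ * (1 + κ) * (M * A ^ 2) ≤ κ * 2 * (M * A ^ 2) := by gcongr; linarith
  have t2 : (1 + κ) * (3 * M * (Real.sqrt ε * A)) ≤ 2 * (3 * M * (Real.sqrt ε * A)) := by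
    gcongr
    linarith
  linarith

/-- The estimate for smooth functions, converted from `ℝ≥0∞` to `ℝ`. -/
lemma abs_le_of_enorm_le {E E' : Type*} [NormedAddCommGroup E] [NormedAddCommGroup E']
    {q M A s : ℝ} (hM : 0 ≤ M) (hA : 0 ≤ A) (hs : 0 ≤ s) {c : NNReal} (hc : 1 ≤ c) {u : E} {v : E'}
    (h : ‖q‖ₑ ≤ (ENNReal.ofReal ((c - 1) * c) * (ENNReal.ofReal M * ENNReal.ofReal A ^ 2)
        + c * (3 * ENNReal.ofReal M * (ENNReal.ofReal s * ENNReal.ofReal A))) * (‖u‖ₑ * ‖v‖ₑ)) :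
    |q| ≤ ((c - 1) * c * (M * A ^ 2) + c * (3 * M * (s * A))) * (‖u‖ * ‖v‖) := by
  have hc1 : (0 : ℝ) ≤ c - 1 := sub_nonneg.2 (by exact_mod_cast hc)
  have e3 : (3 : ℝ≥0∞) = ENNReal.ofReal 3 := by simp
  rw [← ofReal_norm, ← ofReal_norm, ← ofReal_norm, e3, ← ENNReal.ofReal_coe_nnreal,
    ← ENNReal.ofReal_pow (by positivity), ← ENNReal.ofReal_mul (by positivity),
    ← ENNReal.ofReal_mul (by positivity), ← ENNReal.ofReal_mul (by positivity),
    ← ENNReal.ofReal_mul (by positivity), ← ENNReal.ofReal_mul (by positivity),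
    ← ENNReal.ofReal_mul (by positivity), ← ENNReal.ofReal_mul (by positivity),
    ← ENNReal.ofReal_add (by positivity) (by positivity), ← ENNReal.ofReal_mul (by positivity),
    ENNReal.ofReal_le_ofReal_iff (by positivity)] at h
  exact h

namespace IsSmoothBoundedDomain

variable (hΩ : IsSmoothBoundedDomain Ω)
include hΩ

set_option maxHeartbeats 1000000 in
/-- With a smooth bounded weight, the bilinear forms of the strips converge to the one of the
boundary, in the norm of bilinear forms on `H¹(Ω)`. -/
theorem exists_abs_integral_strip_sub_le {C ε₀ : ℝ} (hε₀ : 0 < ε₀)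
    (hγ : IsTrace (surface Ω) C (trace (Ω := Ω)))
    (hB : ∀ ε ∈ Ioc 0 ε₀, IsTrace (stripMeasure Ω ε) C (stripTrace Ω ε))
    {H : E3 → ℝ} (hH : ContDiff ℝ 1 H) {M : ℝ} (hH0 : ∀ x, |H x| ≤ M)
    (hH1 : ∀ x, ‖gradient H x‖ ≤ M) {η : ℝ} (hη : 0 < η) :
    ∃ ε₁ > 0, ∀ ε ∈ Ioc 0 ε₁, ∀ w p : H1 Ω,
      |∫ x, H x * stripTrace Ω ε w x * stripTrace Ω ε p x ∂(stripMeasure Ω ε)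
        - ∫ x, H x * trace w x * trace p x ∂(surface Ω)| ≤ η * (‖w‖ * ‖p‖) := by
  have hM : 0 ≤ M := (abs_nonneg _).trans (hH0 0)
  obtain ⟨c, hc, ε₁, hε₁, hcη⟩ := exists_comparison_constants (Real.sqrt_nonneg C) hM hη
  obtain ⟨ε₂, hε₂, hstrip⟩ := hΩ.exists_restrict_strip_le hc
  refine ⟨min ε₀ (min ε₁ ε₂), by positivity, fun ε hε w p => ?_⟩
  have hle0 : ε ∈ Ioc 0 ε₀ := ⟨hε.1, hε.2.trans (min_le_left _ _)⟩
  have hle1 : ε ∈ Ioc 0 ε₁ := ⟨hε.1, hε.2.trans ((min_le_right _ _).trans (min_le_left _ _))⟩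
  have hle2 : ε ∈ Ioc 0 ε₂ := ⟨hε.1, hε.2.trans ((min_le_right _ _).trans (min_le_right _ _))⟩
  have hBε := hB ε hle0
  have hηε := hcη ε hle1
  have hd := hΩ.denseRange_toH1
  have hHc := hH.continuous
  let Q : H1 Ω → H1 Ω → ℝ := fun w p =>
    weightedForm (μ := stripMeasure Ω ε) hHc.aestronglyMeasurable hH0
      (stripTrace Ω ε w) (stripTrace Ω ε p)
    - weightedForm (μ := surface Ω) hHc.aestronglyMeasurable hH0 (trace w) (trace p)
  have hQ : Continuous fun z : H1 Ω × H1 Ω => Q z.1 z.2 := by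
    refine Continuous.sub ?_ ?_ <;>
    · refine Continuous.clm_apply ?_ (by fun_prop)
      fun_prop
  change |Q w p| ≤ η * (‖w‖ * ‖p‖)
  refine hd.induction_on₂ (p := fun w p => |Q w p| ≤ η * (‖w‖ * ‖p‖)) ?_ ?_ w p
  · exact isClosed_le hQ.abs (by fun_prop)
  intro φ ψ
  have e : Q (toH1 φ) (toH1 ψ) = ∫ y, H y * (φ.1 y * ψ.1 y) ∂(stripMeasure Ω ε)
        - ∫ x, H x * (φ.1 x * ψ.1 x) ∂(surface Ω) := by
    refine congrArg₂ (· - ·) (integral_congr_ae ?_) (integral_congr_ae ?_)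
    · filter_upwards [hBε.ae_eq φ, hBε.ae_eq ψ] with x h1 h2
      rw [h1, h2, mul_assoc]
    · filter_upwards [hγ.ae_eq φ, hγ.ae_eq ψ] with x h1 h2
      rw [h1, h2, mul_assoc]
  have hmain := hΩ.enorm_integral_strip_mul_sub_le hε.1 hBε hc.le (hstrip ε hle2).1
    (hstrip ε hle2).2 hH (M := ENNReal.ofReal M) ENNReal.ofReal_ne_top
    (fun x => by rw [← ofReal_norm]; exact ENNReal.ofReal_le_ofReal (hH0 x))
    (fun x => by rw [← ofReal_norm]; exact ENNReal.ofReal_le_ofReal (hH1 x)) φ ψ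
  rw [← e] at hmain
  exact (abs_le_of_enorm_le hM (Real.sqrt_nonneg C) (Real.sqrt_nonneg ε) hc.le hmain).trans
    (mul_le_mul_of_nonneg_right hηε (by positivity))

end IsSmoothBoundedDomain

/-! ### Zeros of perturbed equations and functions bounded in `C²` -/

/-- A quantitative implicit function theorem without differentiability in the parameter: if `G ε` is
close to its linearization `L` at `u₀`, uniformly for small `ε`, and `L` has the bounded inverse
`R`, then `G ε` has exactly one zero near `u₀`. The zeros are the fixed points of the contraction `u
↦ u - R (G ε u)`. -/
theorem exists_unique_zero_near {X Y : Type*} [NormedAddCommGroup X] [NormedSpace ℝ X]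
    [CompleteSpace X] [NormedAddCommGroup Y] [NormedSpace ℝ Y] (R : Y →L[ℝ] X) (L : X →ₗ[ℝ] Y)
    (hRL : ∀ x, R (L x) = x) (hLR : ∀ y, L (R y) = y) (G : ℝ → X → Y) (u₀ : X)
    (hG : ∀ η > 0, ∃ δ > 0, ∃ ε₀ > 0, ∀ ε ∈ Ioc (0 : ℝ) ε₀, ∀ u v : X, ‖u - u₀‖ ≤ δ → ‖v - u₀‖ ≤ δ →
      ‖G ε u - G ε v - L (u - v)‖ ≤ η * ‖u - v‖)
    (hG₀ : Tendsto (fun ε => G ε u₀) (𝓝[>] 0) (𝓝 0)) :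
    ∃ ε₀ > (0 : ℝ), ∃ δ > (0 : ℝ), ∃ u : ℝ → X,
      (∀ ε ∈ Ioc 0 ε₀, {v | G ε v = 0} ∩ {v | ‖v - u₀‖ ≤ δ} = {u ε}) ∧
      Tendsto u (𝓝[>] 0) (𝓝 u₀) := by
  obtain ⟨δ, hδ, ε₁, hε₁, h1⟩ := hG (1 / (2 * (‖R‖ + 1))) (by positivity)
  have hR : ‖R‖ * (1 / (2 * (‖R‖ + 1))) ≤ 1 / 2 := by
    rw [mul_one_div, div_le_iff₀ (by positivity)]
    linarith
  set T : ℝ → X → X := fun ε u => u - R (G ε u) with hT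
  have hTs : ∀ ε ∈ Ioc 0 ε₁, ∀ u v, ‖u - u₀‖ ≤ δ → ‖v - u₀‖ ≤ δ →
      ‖T ε u - T ε v‖ ≤ 1 / 2 * ‖u - v‖ := by
    intro ε hε u v hu hv
    have e : T ε u - T ε v = - R (G ε u - G ε v - L (u - v)) := by
      simp only [hT, map_sub R, hRL]
      abel
    rw [e, norm_neg]
    calc _ ≤ ‖R‖ * (1 / (2 * (‖R‖ + 1)) * ‖u - v‖) :=
          (R.le_opNorm _).trans (by gcongr; exact h1 ε hε u v hu hv)
      _ = ‖R‖ * (1 / (2 * (‖R‖ + 1))) * ‖u - v‖ := by ring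
      _ ≤ _ := by gcongr
  have hzero : ∀ ε u, G ε u = 0 ↔ T ε u = u := by
    intro ε u
    simp only [hT, sub_eq_self]
    refine ⟨fun h => by rw [h, map_zero], fun h => ?_⟩
    rw [← hLR (G ε u), h, map_zero]
  have hr : Tendsto (fun ε => ‖R (G ε u₀)‖) (𝓝[>] 0) (𝓝 0) := by
    simpa using ((R.continuous.tendsto 0).comp hG₀).norm
  obtain ⟨ε₂, hε₂, h2⟩ : ∃ ε₂ > 0, ∀ ε ∈ Ioc 0 ε₂, ‖R (G ε u₀)‖ ≤ δ / 2 := by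
    have h := hr.eventually (ge_mem_nhds (half_pos hδ))
    obtain ⟨ε₂, hε₂, h⟩ := mem_nhdsGT_iff_exists_Ioc_subset.1 h
    exact ⟨ε₂, hε₂, fun ε hε => h hε⟩
  have hex : ∀ ε ∈ Ioc 0 (min ε₁ ε₂), ∃ u, ‖u - u₀‖ ≤ δ ∧ G ε u = 0 := by
    intro ε hε
    have hε1 : ε ∈ Ioc 0 ε₁ := ⟨hε.1, hε.2.trans (min_le_left _ _)⟩
    have hε2 : ε ∈ Ioc 0 ε₂ := ⟨hε.1, hε.2.trans (min_le_right _ _)⟩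
    have hmaps : MapsTo (T ε) (Metric.closedBall u₀ δ) (Metric.closedBall u₀ δ) := by
      intro u hu
      rw [mem_closedBall_iff_norm] at hu ⊢
      have e : T ε u - u₀ = (T ε u - T ε u₀) - R (G ε u₀) := by
        simp only [hT]
        abel
      rw [e]
      refine (norm_sub_le _ _).trans ?_
      have := hTs ε hε1 u u₀ hu (by simpa using hδ.le)
      linarith [h2 ε hε2]
    have hcon : ContractingWith (1 / 2) (hmaps.restrict (T ε) _ _) := by
      refine ⟨by norm_num, LipschitzWith.of_dist_le_mul fun u v => ?_⟩
      rw [Subtype.dist_eq, Subtype.dist_eq, dist_eq_norm, dist_eq_norm]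
      have := hTs ε hε1 u v (mem_closedBall_iff_norm.1 u.2) (mem_closedBall_iff_norm.1 v.2)
      simpa using this
    obtain ⟨u, hu, hfix, -⟩ := hcon.exists_fixedPoint' Metric.isClosed_closedBall.isComplete
      hmaps (Metric.mem_closedBall_self hδ.le) (edist_ne_top _ _)
    exact ⟨u, mem_closedBall_iff_norm.1 hu, (hzero ε u).2 hfix⟩
  choose! u hu hGu using hex
  refine ⟨min ε₁ ε₂, lt_min hε₁ hε₂, δ, hδ, u, fun ε hε => ?_, ?_⟩
  · have hε1 : ε ∈ Ioc 0 ε₁ := ⟨hε.1, hε.2.trans (min_le_left _ _)⟩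
    refine Subset.antisymm ?_ (singleton_subset_iff.2 ⟨hGu ε hε, hu ε hε⟩)
    rintro v ⟨hv, hvδ⟩
    have := hTs ε hε1 v (u ε) hvδ (hu ε hε)
    rw [(hzero ε v).1 hv, (hzero ε (u ε)).1 (hGu ε hε)] at this
    have h0 : ‖v - u ε‖ ≤ 0 := by linarith
    exact sub_eq_zero.1 (norm_le_zero_iff.1 h0)
  · rw [tendsto_iff_norm_sub_tendsto_zero]
    refine squeeze_zero' (Eventually.of_forall fun ε => norm_nonneg _) ?_
      (by simpa using hr.const_mul 2)
    filter_upwards [Ioc_mem_nhdsGT (lt_min hε₁ hε₂)] with ε hε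
    have hε1 : ε ∈ Ioc 0 ε₁ := ⟨hε.1, hε.2.trans (min_le_left _ _)⟩
    have h3 := hTs ε hε1 (u ε) u₀ (hu ε hε) (by simpa using hδ.le)
    have e : u ε - u₀ = (T ε (u ε) - T ε u₀) - R (G ε u₀) := by
      rw [(hzero ε (u ε)).1 (hGu ε hε)]
      simp only [hT]
      abel
    have h4 : ‖u ε - u₀‖ ≤ ‖T ε (u ε) - T ε u₀‖ + ‖R (G ε u₀)‖ := by
      conv_lhs => rw [e]
      exact norm_sub_le _ _
    linarith

/-- `j` is of class `C²` and bounded by `K` together with its first two derivatives. -/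
structure IsC2Bounded (j : ℝ → ℝ) (K : ℝ) : Prop where
  contDiff : ContDiff ℝ 2 j
  abs_le : ∀ s, |j s| ≤ K
  abs_deriv_le : ∀ s, |deriv j s| ≤ K
  abs_deriv_deriv_le : ∀ s, |deriv (deriv j) s| ≤ K

lemma IsAdmissible.exists_isC2Bounded {j : ℝ → ℝ} (hj : IsAdmissible j) :
    ∃ K, IsC2Bounded j K := by
  obtain ⟨K, -, hK⟩ := hj.bounded
  refine ⟨K, hj.contDiff, fun s => ?_, fun s => ?_, fun s => ?_⟩ <;>
    linarith [hK s, abs_nonneg (j s), abs_nonneg (deriv j s), abs_nonneg (deriv (deriv j) s)]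

namespace IsC2Bounded

variable {j : ℝ → ℝ} {K : ℝ} (hj : IsC2Bounded j K)
include hj

lemma nonneg : 0 ≤ K := (abs_nonneg _).trans (hj.abs_le 0)

lemma contDiff_deriv : ContDiff ℝ 1 (deriv j) :=
  (contDiff_succ_iff_deriv (n := 1).1 hj.contDiff).2.2

lemma differentiable : Differentiable ℝ j := hj.contDiff.differentiable (by simp)

lemma abs_sub_le (a b : ℝ) : |j a - j b| ≤ K * |a - b| :=
  convex_univ.norm_image_sub_le_of_norm_deriv_le (fun x _ => hj.differentiable x)
    (fun x _ => hj.abs_deriv_le x) (mem_univ b) (mem_univ a)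

/-- Truncating the Lipschitz bound at `1`, which the boundedness of the derivative permits, is what
keeps products of three functions in `L²` integrable. -/
lemma abs_deriv_sub_le (a b : ℝ) : |deriv j a - deriv j b| ≤ 2 * K * min 1 |a - b| := by
  have h1 : |deriv j a - deriv j b| ≤ K * |a - b| :=
    convex_univ.norm_image_sub_le_of_norm_deriv_le
      (fun x _ => hj.contDiff_deriv.differentiable (by simp) x)
      (fun x _ => hj.abs_deriv_deriv_le x) (mem_univ b) (mem_univ a)
  have h2 : |deriv j a - deriv j b| ≤ 2 * K :=
    (abs_sub _ _).trans (by linarith [hj.abs_deriv_le a, hj.abs_deriv_le b])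
  have hK := hj.nonneg
  rcases le_total 1 |a - b| with h | h
  · rwa [min_eq_left h, mul_one]
  · rw [min_eq_right h]
    nlinarith [mul_nonneg hK (abs_nonneg (a - b))]

/-- First order Taylor expansion, with a remainder adapted to functions that are merely square
integrable. -/
lemma abs_sub_sub_deriv_mul_le (a b c : ℝ) :
    |j a - j b - deriv j c * (a - b)| ≤ 2 * K * (min 1 |a - c| + min 1 |b - c|) * |a - b| := by
  have hK := hj.nonneg
  have hd : ∀ x ∈ uIcc b a, HasDerivWithinAt (fun s => j s - deriv j c * s)
      (deriv j x - deriv j c) (uIcc b a) x := fun x _ => by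
    have := (hj.differentiable x).hasDerivAt.sub ((hasDerivAt_id x).const_mul (deriv j c))
    rw [mul_one] at this
    exact this.hasDerivWithinAt
  have hb : ∀ x ∈ uIcc b a, ‖deriv j x - deriv j c‖
      ≤ 2 * K * (min 1 |a - c| + min 1 |b - c|) := by
    intro x hx
    refine (hj.abs_deriv_sub_le x c).trans (mul_le_mul_of_nonneg_left ?_ (by linarith))
    have hm : |x - c| ≤ max |a - c| |b - c| := by
      rw [mem_uIcc] at hx
      rcases hx with ⟨h1, h2⟩ | ⟨h1, h2⟩
      · rw [max_comm]
        exact abs_le_max_abs_abs (by linarith) (by linarith)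
      · exact abs_le_max_abs_abs (by linarith) (by linarith)
    have p1 : 0 ≤ min 1 |a - c| := le_min zero_le_one (abs_nonneg _)
    have p2 : 0 ≤ min 1 |b - c| := le_min zero_le_one (abs_nonneg _)
    refine (min_le_min_left 1 hm).trans ?_
    rcases le_total |a - c| |b - c| with h | h
    · rw [max_eq_right h]
      linarith
    · rw [max_eq_left h]
      linarith
  have := (convex_uIcc b a).norm_image_sub_le_of_norm_hasDerivWithin_le hd hb
    left_mem_uIcc right_mem_uIcc
  have e : j a - j b - deriv j c * (a - b)
      = j a - deriv j c * a - (j b - deriv j c * b) := by ring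
  rw [e]
  exact this

end IsC2Bounded

/-! ### Superposition operators with values in the dual -/

section Nemytskii

variable {X E : Type*} [MeasurableSpace X] {μ : Measure X} [NormedAddCommGroup E] [NormedSpace ℝ E]
  {j : ℝ → ℝ} {K : ℝ}

lemma IsC2Bounded.aestronglyMeasurable (hj : IsC2Bounded j K) (w : Lp ℝ 2 μ) :
    AEStronglyMeasurable (fun x => j (w x)) μ :=
  hj.contDiff.continuous.comp_aestronglyMeasurable (Lp.aestronglyMeasurable w)

lemma IsC2Bounded.aestronglyMeasurable_deriv (hj : IsC2Bounded j K) (w : Lp ℝ 2 μ) :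
    AEStronglyMeasurable (fun x => deriv j (w x)) μ :=
  hj.contDiff_deriv.continuous.comp_aestronglyMeasurable (Lp.aestronglyMeasurable w)

/-- The functional `φ ↦ ∫ j(Bu) Bφ dμ` on `E`. -/
def nemytskii [IsFiniteMeasure μ] (hj : IsC2Bounded j K) (B : E →L[ℝ] Lp ℝ 2 μ) (u : E) :
    StrongDual ℝ E :=
  (weightedForm (hj.aestronglyMeasurable (B u)) (fun x => hj.abs_le (B u x))
    (Lp.const 2 μ (1 : ℝ))).comp B

/-- The bilinear form `(w, φ) ↦ ∫ j'(Bu) Bw Bφ dμ` on `E`. -/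
def nemytskiiDeriv (hj : IsC2Bounded j K) (B : E →L[ℝ] Lp ℝ 2 μ) (u : E) :
    E →L[ℝ] StrongDual ℝ E :=
  (weightedForm (hj.aestronglyMeasurable_deriv (B u))
    (fun x => hj.abs_deriv_le (B u x))).bilinearComp B B

lemma nemytskii_apply [IsFiniteMeasure μ] (hj : IsC2Bounded j K) (B : E →L[ℝ] Lp ℝ 2 μ)
    (u p : E) : nemytskii hj B u p = ∫ x, j (B u x) * B p x ∂μ := by
  refine integral_congr_ae ?_
  filter_upwards [Lp.coeFn_const (p := 2) (μ := μ) (1 : ℝ)] with x hx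
  rw [hx, Function.const_apply, mul_one]
  rfl

lemma nemytskiiDeriv_apply (hj : IsC2Bounded j K) (B : E →L[ℝ] Lp ℝ 2 μ) (u w p : E) :
    nemytskiiDeriv hj B u w p = ∫ x, deriv j (B u x) * B w x * B p x ∂μ := rfl

lemma integrable_nemytskii [IsFiniteMeasure μ] (hj : IsC2Bounded j K) (w p : Lp ℝ 2 μ) :
    Integrable (fun x => j (w x) * p x) μ :=
  ((Lp.memLp p).integrable (by norm_num)).bdd_mul (hj.aestronglyMeasurable w)
    (ae_of_all _ fun x => hj.abs_le (w x))

variable {A : ℝ} {B : E →L[ℝ] Lp ℝ 2 μ}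

/-- Superposition operators are Lipschitz continuous into the dual. -/
lemma norm_nemytskii_sub_le [IsFiniteMeasure μ] (hj : IsC2Bounded j K) (hA : 0 ≤ A)
    (hB : ∀ u, ‖B u‖ ≤ A * ‖u‖) (u v : E) : ‖nemytskii hj B u - nemytskii hj B v‖ ≤ K * A ^ 2 * ‖u - v‖ := by
  have hK := hj.nonneg
  refine ContinuousLinearMap.opNorm_le_bound _ (by positivity) fun p => ?_
  rw [sub_apply, nemytskii_apply, nemytskii_apply,
    ← integral_sub (integrable_nemytskii hj _ _) (integrable_nemytskii hj _ _)]
  have hle : ‖∫ x, (j (B u x) * B p x - j (B v x) * B p x) ∂μ‖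
      ≤ ∫ x, K * (|B (u - v) x| * |B p x|) ∂μ := by
    refine norm_integral_le_of_norm_le ((integrable_abs_mul_abs _ _).const_mul K) ?_
    rw [map_sub]
    filter_upwards [Lp.coeFn_sub (B u) (B v)] with x hx
    rw [hx, Pi.sub_apply, Real.norm_eq_abs, ← sub_mul, abs_mul, ← mul_assoc]
    exact mul_le_mul_of_nonneg_right (hj.abs_sub_le _ _) (abs_nonneg _)
  refine hle.trans ?_
  rw [integral_const_mul]
  calc K * _ ≤ K * (‖B (u - v)‖ * ‖B p‖) := by gcongr; exact integral_abs_mul_abs_le _ _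
    _ ≤ K * ((A * ‖u - v‖) * (A * ‖p‖)) := by
        gcongr
        · exact hB _
        · exact hB _
    _ = K * A ^ 2 * ‖u - v‖ * ‖p‖ := by ring

/-- Continuity of the derivative, given the smallness of the truncated trilinear form. -/
lemma norm_nemytskiiDeriv_sub_le (hj : IsC2Bounded j K) {η : ℝ} (hη : 0 ≤ η) {u v : E}
    (h : ∀ w p : E, ∫ x, min 1 |B (u - v) x| * (|B w x| * |B p x|) ∂μ ≤ η * (‖w‖ * ‖p‖)) :
    ‖nemytskiiDeriv hj B u - nemytskiiDeriv hj B v‖ ≤ 2 * K * η := by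
  have hK := hj.nonneg
  refine ContinuousLinearMap.opNorm_le_bound₂ _ (by positivity) fun w p => ?_
  rw [sub_apply, sub_apply, nemytskiiDeriv_apply, nemytskiiDeriv_apply,
    ← integral_sub (integrable_weight_mul (hj.aestronglyMeasurable_deriv (B u))
      (fun x => hj.abs_deriv_le (B u x)) _ _)
      (integrable_weight_mul (hj.aestronglyMeasurable_deriv (B v))
      (fun x => hj.abs_deriv_le (B v x)) _ _)]
  have hle : ‖∫ x, (deriv j (B u x) * B w x * B p x - deriv j (B v x) * B w x * B p x) ∂μ‖
      ≤ ∫ x, 2 * K * (min 1 |B (u - v) x| * (|B w x| * |B p x|)) ∂μ := by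
    refine norm_integral_le_of_norm_le ((integrable_min_mul _ _ _).const_mul _) ?_
    rw [map_sub]
    filter_upwards [Lp.coeFn_sub (B u) (B v)] with x hx
    rw [hx, Pi.sub_apply, Real.norm_eq_abs, mul_assoc, mul_assoc, ← sub_mul, abs_mul, ← mul_assoc,
      abs_mul]
    exact mul_le_mul_of_nonneg_right (hj.abs_deriv_sub_le _ _) (by positivity)
  refine hle.trans ?_
  rw [integral_const_mul]
  calc 2 * K * _ ≤ 2 * K * (η * (‖w‖ * ‖p‖)) := by gcongr; exact h w p
    _ = _ := by ring

/-- Strict differentiability of superposition operators at `u₀`, given the smallness of the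
truncated trilinear form. -/
lemma norm_nemytskii_remainder_le [IsFiniteMeasure μ] (hj : IsC2Bounded j K) {η : ℝ} (hη : 0 ≤ η)
    {u v u₀ : E}
    (hu : ∀ w p : E, ∫ x, min 1 |B (u - u₀) x| * (|B w x| * |B p x|) ∂μ ≤ η * (‖w‖ * ‖p‖))
    (hv : ∀ w p : E, ∫ x, min 1 |B (v - u₀) x| * (|B w x| * |B p x|) ∂μ ≤ η * (‖w‖ * ‖p‖)) :
    ‖nemytskii hj B u - nemytskii hj B v - nemytskiiDeriv hj B u₀ (u - v)‖
      ≤ 4 * K * η * ‖u - v‖ := by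
  have hK := hj.nonneg
  refine ContinuousLinearMap.opNorm_le_bound _ (by positivity) fun p => ?_
  have i1 := integrable_nemytskii hj (B u) (B p)
  have i2 := integrable_nemytskii hj (B v) (B p)
  have i12 : Integrable (fun x => j (B u x) * B p x - j (B v x) * B p x) μ := i1.sub i2
  have i3 := integrable_weight_mul (hj.aestronglyMeasurable_deriv (B u₀))
      (fun x => hj.abs_deriv_le (B u₀ x)) (B (u - v)) (B p)
  have i4 := (integrable_min_mul (B (u - u₀)) (B (u - v)) (B p)).add
    (integrable_min_mul (B (v - u₀)) (B (u - v)) (B p))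
  rw [sub_apply, sub_apply, nemytskiiDeriv_apply, nemytskii_apply, nemytskii_apply,
    ← integral_sub i1 i2, ← integral_sub i12 i3]
  refine (norm_integral_le_of_norm_le (i4.const_mul (2 * K)) ?_).trans ?_
  · rw [map_sub, map_sub, map_sub]
    filter_upwards [Lp.coeFn_sub (B u) (B v), Lp.coeFn_sub (B u) (B u₀),
      Lp.coeFn_sub (B v) (B u₀)] with x h1 h2 h3
    simp only [Pi.sub_apply, Pi.add_apply, h1, h2, h3, Real.norm_eq_abs]
    have e : j (B u x) * B p x - j (B v x) * B p x - deriv j (B u₀ x) * (B u x - B v x) * B p x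
        = (j (B u x) - j (B v x) - deriv j (B u₀ x) * (B u x - B v x)) * B p x := by ring
    rw [e, abs_mul]
    refine (mul_le_mul_of_nonneg_right (hj.abs_sub_sub_deriv_mul_le _ _ _)
      (abs_nonneg _)).trans_eq ?_
    ring
  · rw [integral_const_mul, integral_add' (integrable_min_mul _ _ _) (integrable_min_mul _ _ _)]
    calc _ ≤ 2 * K * (η * (‖u - v‖ * ‖p‖) + η * (‖u - v‖ * ‖p‖)) := by
          gcongr
          · exact hu _ _
          · exact hv _ _
      _ = _ := by ring

end Nemytskii

/-- For smooth `φ` the weight `h ∘ φ` is bounded together with its gradient. -/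
lemma exists_gradient_comp_bound {h : ℝ → ℝ} {K : ℝ} (hh : ContDiff ℝ 1 h) (h0 : ∀ s, |h s| ≤ K)
    (h1 : ∀ s, |deriv h s| ≤ K) (φ : smoothFunctions Ω) :
    ContDiff ℝ 1 (fun x => h (φ.1 x)) ∧
      ∃ M, (∀ x, |h (φ.1 x)| ≤ M) ∧ ∀ x, ‖gradient (fun y => h (φ.1 y)) x‖ ≤ M := by
  have hφ : ContDiff ℝ 1 φ.1 := φ.2.1.of_le (by simp)
  refine ⟨hh.comp hφ, ?_⟩
  obtain ⟨N, hN⟩ := (continuous_gradient φ.2.1).bounded_above_of_compact_support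
    ((φ.2.2.1.fderiv (𝕜 := ℝ)).comp_left (map_zero (InnerProductSpace.toDual ℝ E3).symm))
  have hK : 0 ≤ K := (abs_nonneg _).trans (h0 0)
  refine ⟨max K (K * N), fun x => (h0 _).trans (le_max_left _ _), fun x => ?_⟩
  refine le_trans ?_ (le_max_right _ _)
  have e : gradient (fun y => h (φ.1 y)) x = deriv h (φ.1 x) • gradient φ.1 x := by
    have h3 : HasFDerivAt (fun y => h (φ.1 y)) (deriv h (φ.1 x) • fderiv ℝ φ.1 x) x :=
      ((hh.differentiable (by simp) _).hasDerivAt).comp_hasFDerivAt x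
        (hφ.differentiable (by simp) x).hasFDerivAt
    simp only [gradient]
    rw [h3.fderiv, map_smulₛₗ]
    rfl
  rw [e, norm_smul]
  exact mul_le_mul (h1 _) (hN x) (norm_nonneg _) hK

/-! ### Perturbation of semilinear equations -/

lemma norm_add_sub_le_add {E : Type*} [SeminormedAddCommGroup E] (a b c : E) :
    ‖a + b - c‖ ≤ ‖a‖ + ‖b‖ + ‖c‖ :=
  (norm_sub_le _ _).trans (by gcongr; exact norm_add_le _ _)

section AbstractTraces

variable {X E : Type*} [MeasurableSpace X] [NormedAddCommGroup E] [NormedSpace ℝ E]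

/-- The operators `B ε : E → L²(μ ε)` converge to `B₀ : E → L²(μ₀)` as `ε → 0⁺`, in the sense that
for `u` in a dense set `D` the forms `p ↦ ∫ h(B ε u) B ε p dμ` and `(w, p) ↦ ∫ h(B ε u) B ε w B ε p
dμ` converge uniformly on bounded sets, while `small` and `norm_le` make them equicontinuous in `u`.
-/
structure TracesConverge (μ : ℝ → Measure X) (μ₀ : Measure X)
    (B : ∀ ε, E →L[ℝ] Lp ℝ 2 (μ ε)) (B₀ : E →L[ℝ] Lp ℝ 2 μ₀) (A ε₀ : ℝ) (D : Set E) : Prop where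
  nonneg : 0 ≤ A
  pos : 0 < ε₀
  norm_le : ∀ ε ∈ Ioc 0 ε₀, ∀ u, ‖B ε u‖ ≤ A * ‖u‖
  norm_le₀ : ∀ u, ‖B₀ u‖ ≤ A * ‖u‖
  small : ∀ η > 0, ∃ δ > 0, ∀ ε ∈ Ioc 0 ε₀, ∀ z w p : E, ‖z‖ ≤ δ →
    ∫ x, min 1 |B ε z x| * (|B ε w x| * |B ε p x|) ∂(μ ε) ≤ η * (‖w‖ * ‖p‖)
  small₀ : ∀ η > 0, ∃ δ > 0, ∀ z w p : E, ‖z‖ ≤ δ →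
    ∫ x, min 1 |B₀ z x| * (|B₀ w x| * |B₀ p x|) ∂μ₀ ≤ η * (‖w‖ * ‖p‖)
  dense : Dense D
  tendsto_linear : ∀ u ∈ D, ∀ (h : ℝ → ℝ) (K : ℝ), ContDiff ℝ 1 h → (∀ s, |h s| ≤ K) →
    (∀ s, |deriv h s| ≤ K) → ∀ η > 0, ∃ ε₁ > 0, ∀ ε ∈ Ioc 0 ε₁, ∀ p : E,
      |∫ x, h (B ε u x) * B ε p x ∂(μ ε) - ∫ x, h (B₀ u x) * B₀ p x ∂μ₀| ≤ η * ‖p‖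
  tendsto_bilinear : ∀ u ∈ D, ∀ (h : ℝ → ℝ) (K : ℝ), ContDiff ℝ 1 h → (∀ s, |h s| ≤ K) →
    (∀ s, |deriv h s| ≤ K) → ∀ η > 0, ∃ ε₁ > 0, ∀ ε ∈ Ioc 0 ε₁, ∀ w p : E,
      |∫ x, h (B ε u x) * B ε w x * B ε p x ∂(μ ε)
        - ∫ x, h (B₀ u x) * B₀ w x * B₀ p x ∂μ₀| ≤ η * (‖w‖ * ‖p‖)

namespace TracesConverge

variable {μ : ℝ → Measure X} {μ₀ : Measure X}
  {B : ∀ ε, E →L[ℝ] Lp ℝ 2 (μ ε)} {B₀ : E →L[ℝ] Lp ℝ 2 μ₀} {A ε₀ : ℝ} {D : Set E}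
  (hB : TracesConverge μ μ₀ B B₀ A ε₀ D) {j : ℝ → ℝ} {K : ℝ} (hj : IsC2Bounded j K)
include hB

/-- Convergence of the superposition operators at every point, by density of `D` and equicontinuity.
-/
lemma exists_norm_nemytskii_sub_le [∀ ε, IsFiniteMeasure (μ ε)] [IsFiniteMeasure μ₀] (u₀ : E)
    {η : ℝ} (hη : 0 < η) : ∃ ε₁ > 0, ∀ ε ∈ Ioc 0 ε₁,
      ‖nemytskii hj (B ε) u₀ - nemytskii hj B₀ u₀‖ ≤ η := by
  have hK := hj.nonneg
  have hA := hB.nonneg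
  obtain ⟨u, hu, huD⟩ := Metric.dense_iff.1 hB.dense u₀ (η / (4 * (K * A ^ 2 + 1)))
    (by positivity)
  have hu' : ‖u₀ - u‖ ≤ η / (4 * (K * A ^ 2 + 1)) := by
    rw [norm_sub_rev]
    exact (mem_ball_iff_norm.1 hu).le
  have hKA : K * A ^ 2 * ‖u₀ - u‖ ≤ η / 4 := by
    refine (mul_le_mul_of_nonneg_left hu' (by positivity)).trans ?_
    rw [mul_div_assoc', div_le_iff₀ (by positivity)]
    nlinarith [mul_nonneg hK (sq_nonneg A)]
  obtain ⟨ε₁, hε₁, h⟩ := hB.tendsto_linear u huD j K (hj.contDiff.of_le (by norm_num)) hj.abs_le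
    hj.abs_deriv_le (η / 2) (by positivity)
  refine ⟨min ε₀ ε₁, lt_min hB.pos hε₁, fun ε hε => ?_⟩
  have b1 := norm_nemytskii_sub_le hj hA
    (hB.norm_le ε ⟨hε.1, hε.2.trans (min_le_left _ _)⟩) u₀ u
  have b2 := norm_nemytskii_sub_le hj hA hB.norm_le₀ u₀ u
  have b3 : ‖nemytskii hj (B ε) u - nemytskii hj B₀ u‖ ≤ η / 2 := by
    refine ContinuousLinearMap.opNorm_le_bound _ (by positivity) fun p => ?_
    rw [sub_apply, nemytskii_apply, nemytskii_apply]
    exact h ε ⟨hε.1, hε.2.trans (min_le_right _ _)⟩ p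
  have e : nemytskii hj (B ε) u₀ - nemytskii hj B₀ u₀
      = (nemytskii hj (B ε) u₀ - nemytskii hj (B ε) u)
        + (nemytskii hj (B ε) u - nemytskii hj B₀ u)
        - (nemytskii hj B₀ u₀ - nemytskii hj B₀ u) := by abel
  rw [e]
  exact (norm_add_sub_le_add _ _ _).trans (by linarith)

/-- Convergence of the derivatives at every point, by density of `D` and equicontinuity. -/
lemma exists_norm_nemytskiiDeriv_sub_le (u₀ : E) {η : ℝ} (hη : 0 < η) :
    ∃ ε₁ > 0, ∀ ε ∈ Ioc 0 ε₁,
      ‖nemytskiiDeriv hj (B ε) u₀ - nemytskiiDeriv hj B₀ u₀‖ ≤ η := by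
  have hK := hj.nonneg
  set κ : ℝ := η / (8 * (K + 1)) with hκ
  have hκ0 : 0 < κ := by positivity
  have hκη : 2 * K * κ ≤ η / 4 := by
    rw [hκ, mul_div_assoc', div_le_iff₀ (by positivity)]
    nlinarith
  obtain ⟨δ, hδ, h1⟩ := hB.small κ hκ0
  obtain ⟨δ₀, hδ₀, h2⟩ := hB.small₀ κ hκ0
  obtain ⟨u, hu, huD⟩ := Metric.dense_iff.1 hB.dense u₀ (min δ δ₀) (lt_min hδ hδ₀)
  have hu' : ‖u₀ - u‖ ≤ min δ δ₀ := by
    rw [norm_sub_rev]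
    exact (mem_ball_iff_norm.1 hu).le
  obtain ⟨ε₁, hε₁, h⟩ := hB.tendsto_bilinear u huD (deriv j) K hj.contDiff_deriv hj.abs_deriv_le
    hj.abs_deriv_deriv_le (η / 2) (by positivity)
  refine ⟨min ε₀ ε₁, lt_min hB.pos hε₁, fun ε hε => ?_⟩
  have b1 := norm_nemytskiiDeriv_sub_le hj hκ0.le (u := u₀) (v := u) fun w p =>
    h1 ε ⟨hε.1, hε.2.trans (min_le_left _ _)⟩ _ w p (hu'.trans (min_le_left _ _))
  have b2 := norm_nemytskiiDeriv_sub_le hj hκ0.le (u := u₀) (v := u) fun w p =>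
    h2 _ w p (hu'.trans (min_le_right _ _))
  have b3 : ‖nemytskiiDeriv hj (B ε) u - nemytskiiDeriv hj B₀ u‖ ≤ η / 2 := by
    refine ContinuousLinearMap.opNorm_le_bound₂ _ (by positivity) fun w p => ?_
    rw [sub_apply, sub_apply, nemytskiiDeriv_apply, nemytskiiDeriv_apply, mul_assoc]
    exact h ε ⟨hε.1, hε.2.trans (min_le_right _ _)⟩ w p
  have e : nemytskiiDeriv hj (B ε) u₀ - nemytskiiDeriv hj B₀ u₀
      = (nemytskiiDeriv hj (B ε) u₀ - nemytskiiDeriv hj (B ε) u)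
        + (nemytskiiDeriv hj (B ε) u - nemytskiiDeriv hj B₀ u)
        - (nemytskiiDeriv hj B₀ u₀ - nemytskiiDeriv hj B₀ u) := by abel
  have t := norm_add_sub_le_add (nemytskiiDeriv hj (B ε) u₀ - nemytskiiDeriv hj (B ε) u)
    (nemytskiiDeriv hj (B ε) u - nemytskiiDeriv hj B₀ u)
    (nemytskiiDeriv hj B₀ u₀ - nemytskiiDeriv hj B₀ u)
  rw [e]
  linarith

/-- Near `u₀` and for small `ε`, the superposition operators are close to the linearization of the
limit operator. -/
lemma exists_norm_remainder_le [∀ ε, IsFiniteMeasure (μ ε)] (u₀ : E) {η : ℝ} (hη : 0 < η) :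
    ∃ δ > 0, ∃ ε₁ > 0, ∀ ε ∈ Ioc 0 ε₁, ∀ u v : E, ‖u - u₀‖ ≤ δ → ‖v - u₀‖ ≤ δ →
      ‖nemytskii hj (B ε) u - nemytskii hj (B ε) v - nemytskiiDeriv hj B₀ u₀ (u - v)‖
        ≤ η * ‖u - v‖ := by
  have hK := hj.nonneg
  set κ : ℝ := η / (8 * (K + 1)) with hκ
  have hκ0 : 0 < κ := by positivity
  have hκη : 4 * K * κ ≤ η / 2 := by
    rw [hκ, mul_div_assoc', div_le_iff₀ (by positivity)]
    nlinarith
  obtain ⟨δ, hδ, h1⟩ := hB.small κ hκ0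
  obtain ⟨ε₁, hε₁, h2⟩ := hB.exists_norm_nemytskiiDeriv_sub_le hj u₀ (half_pos hη)
  refine ⟨δ, hδ, min ε₀ ε₁, lt_min hB.pos hε₁, fun ε hε u v hu hv => ?_⟩
  have hε0 : ε ∈ Ioc 0 ε₀ := ⟨hε.1, hε.2.trans (min_le_left _ _)⟩
  have b1 := norm_nemytskii_remainder_le hj hκ0.le (u := u) (v := v) (u₀ := u₀)
    (fun w p => h1 ε hε0 _ w p hu) (fun w p => h1 ε hε0 _ w p hv)
  have b2 : ‖(nemytskiiDeriv hj (B ε) u₀ - nemytskiiDeriv hj B₀ u₀) (u - v)‖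
      ≤ η / 2 * ‖u - v‖ :=
    (ContinuousLinearMap.le_opNorm _ _).trans
      (by gcongr; exact h2 ε ⟨hε.1, hε.2.trans (min_le_right _ _)⟩)
  have e : nemytskii hj (B ε) u - nemytskii hj (B ε) v - nemytskiiDeriv hj B₀ u₀ (u - v)
      = (nemytskii hj (B ε) u - nemytskii hj (B ε) v - nemytskiiDeriv hj (B ε) u₀ (u - v))
        + (nemytskiiDeriv hj (B ε) u₀ - nemytskiiDeriv hj B₀ u₀) (u - v) := by
    rw [sub_apply]
    abel
  rw [e]
  refine (norm_add_le _ _).trans ((add_le_add b1 b2).trans ?_)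
  nlinarith [norm_nonneg (u - v)]

end TracesConverge

/-- A semilinear equation `Λ u = f(u) + g(B ε u)`, in weak form, has exactly one solution near a
nondegenerate solution of the limit equation. -/
theorem exists_unique_solution_near [CompleteSpace E] {μ : ℝ → Measure X} {μ₀ ν : Measure X}
    [∀ ε, IsFiniteMeasure (μ ε)] [IsFiniteMeasure μ₀] [IsFiniteMeasure ν]
    {B : ∀ ε, E →L[ℝ] Lp ℝ 2 (μ ε)} {B₀ : E →L[ℝ] Lp ℝ 2 μ₀} {A ε₀ : ℝ} {D : Set E}
    (hB : TracesConverge μ μ₀ B B₀ A ε₀ D) (V : E →L[ℝ] Lp ℝ 2 ν)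
    (hV : TracesConverge (fun _ => ν) ν (fun _ => V) V A ε₀ D)
    {f g : ℝ → ℝ} {K K' : ℝ} (hf : IsC2Bounded f K) (hg : IsC2Bounded g K')
    (Λ : E →L[ℝ] StrongDual ℝ E) (u₀ : E)
    (hu₀ : Λ u₀ - nemytskii hf V u₀ - nemytskii hg B₀ u₀ = 0) (R : StrongDual ℝ E →L[ℝ] E)
    (hRL : ∀ w, R (Λ w - nemytskiiDeriv hf V u₀ w - nemytskiiDeriv hg B₀ u₀ w) = w)
    (hLR : ∀ l, Λ (R l) - nemytskiiDeriv hf V u₀ (R l) - nemytskiiDeriv hg B₀ u₀ (R l) = l) :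
    ∃ ε₀ > (0 : ℝ), ∃ δ > (0 : ℝ), ∃ u : ℝ → E,
      (∀ ε ∈ Ioc 0 ε₀, {v | Λ v - nemytskii hf V v - nemytskii hg (B ε) v = 0}
        ∩ {v | ‖v - u₀‖ ≤ δ} = {u ε}) ∧
      Tendsto u (𝓝[>] 0) (𝓝 u₀) := by
  refine exists_unique_zero_near R
    (Λ - nemytskiiDeriv hf V u₀ - nemytskiiDeriv hg B₀ u₀ : E →L[ℝ] StrongDual ℝ E).toLinearMap
    hRL hLR (fun ε v => Λ v - nemytskii hf V v - nemytskii hg (B ε) v) u₀ (fun η hη => ?_) ?_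
  · obtain ⟨δ₁, hδ₁, ε₁, hε₁, h1⟩ := hV.exists_norm_remainder_le hf u₀ (half_pos hη)
    obtain ⟨δ₂, hδ₂, ε₂, hε₂, h2⟩ := hB.exists_norm_remainder_le hg u₀ (half_pos hη)
    refine ⟨min δ₁ δ₂, lt_min hδ₁ hδ₂, min ε₁ ε₂, lt_min hε₁ hε₂, fun ε hε u v hu hv => ?_⟩
    have b1 := h1 ε ⟨hε.1, hε.2.trans (min_le_left _ _)⟩ u v (hu.trans (min_le_left _ _))
      (hv.trans (min_le_left _ _))
    have b2 := h2 ε ⟨hε.1, hε.2.trans (min_le_right _ _)⟩ u v (hu.trans (min_le_right _ _))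
      (hv.trans (min_le_right _ _))
    have e : Λ u - nemytskii hf V u - nemytskii hg (B ε) u
          - (Λ v - nemytskii hf V v - nemytskii hg (B ε) v)
          - (Λ - nemytskiiDeriv hf V u₀ - nemytskiiDeriv hg B₀ u₀) (u - v)
        = -(nemytskii hf V u - nemytskii hf V v - nemytskiiDeriv hf V u₀ (u - v))
          - (nemytskii hg (B ε) u - nemytskii hg (B ε) v - nemytskiiDeriv hg B₀ u₀ (u - v)) := by
      rw [sub_apply, sub_apply, map_sub Λ]
      abel
    refine (congrArg norm e).trans_le ((norm_sub_le _ _).trans ?_)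
    rw [norm_neg]
    linarith
  · rw [Metric.tendsto_nhds]
    intro η hη
    obtain ⟨ε₁, hε₁, h⟩ := hB.exists_norm_nemytskii_sub_le hg u₀ (half_pos hη)
    filter_upwards [Ioc_mem_nhdsGT hε₁] with ε hε
    have e : Λ u₀ - nemytskii hf V u₀ - nemytskii hg (B ε) u₀
        = -(nemytskii hg (B ε) u₀ - nemytskii hg B₀ u₀) := by
      rw [← sub_eq_zero.1 hu₀]
      abel
    rw [e, dist_zero_right, norm_neg]
    exact (h ε hε).trans_lt (half_lt_self hη)

end AbstractTraces

/-! ### Precompactness of solution sets and lower semicontinuity -/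

/-- Approximability of each single point of a precompact limit set gives lower semicontinuity: it is
enough to approximate the points of a finite net. -/
lemma lowerSemicontinuousAtZero_of_totallyBounded {X : Type*} [PseudoEMetricSpace X]
    {S : ℝ → Set X} {S₀ : Set X} (h₀ : TotallyBounded S₀)
    (h : ∀ u ∈ S₀, ∃ w : ℝ → X, (∀ᶠ ε in 𝓝[>] 0, w ε ∈ S ε) ∧ Tendsto w (𝓝[>] 0) (𝓝 u)) :
    LowerSemicontinuousAtZero S S₀ := by
  refine ENNReal.tendsto_nhds_zero.2 fun η hη => ?_
  obtain ⟨t, ht, htf, hcov⟩ := EMetric.totallyBounded_iff'.1 h₀ (η / 2) (ENNReal.half_pos hη.ne')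
  choose! w hw hwt using h
  have hev : ∀ᶠ ε in 𝓝[>] 0, ∀ y ∈ t, w y ε ∈ S ε ∧ edist (w y ε) y < η / 2 :=
    (Filter.eventually_all_finite htf).2 fun y hy => (hw y (ht hy)).and
      ((hwt y (ht hy)).eventually (Metric.eball_mem_nhds y (ENNReal.half_pos hη.ne')))
  filter_upwards [hev] with ε hε
  refine iSup₂_le fun u hu => ?_
  obtain ⟨y, hy, huy⟩ := mem_iUnion₂.1 (hcov hu)
  obtain ⟨hyS, hyd⟩ := hε y hy
  refine (Metric.infEDist_le_edist_of_mem hyS).trans ((edist_triangle u y (w y ε)).trans ?_)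
  rw [edist_comm y]
  exact (add_le_add (Metric.mem_eball.1 huy).le hyd.le).trans_eq (ENNReal.add_halves η)

/-- A bounded set on which the norm is controlled by a norm for which bounded sets are
precompact is precompact. -/
lemma totallyBounded_of_compact_norm {E F : Type*} [NormedAddCommGroup E] [NormedSpace ℝ E]
    [NormedAddCommGroup F] [NormedSpace ℝ F] (V : E →L[ℝ] F)
    (hV : ∀ η > 0, ∃ T : Set E, T.Finite ∧ ∀ u, ‖u‖ ≤ 1 → ∃ φ ∈ T, ‖V (u - φ)‖ ≤ η)
    {S : Set E} {M : ℝ} (hM : 0 < M) (hSM : ∀ u ∈ S, ‖u‖ ≤ M)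
    (hS : ∀ η > 0, ∃ δ > 0, ∀ u ∈ S, ∀ v ∈ S, ‖V (u - v)‖ ≤ δ → ‖u - v‖ < η) :
    TotallyBounded S := by
  refine Metric.totallyBounded_of_finite_discretization fun η hη => ?_
  obtain ⟨δ, hδ, hSδ⟩ := hS η hη
  obtain ⟨T, hTf, hT⟩ := hV (δ / (2 * M)) (by positivity)
  have hnorm : ∀ u : S, ‖M⁻¹ • (u : E)‖ ≤ 1 := fun u => by
    rw [norm_smul, norm_inv, Real.norm_of_nonneg hM.le, inv_mul_le_iff₀ hM, mul_one]
    exact hSM u u.2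
  choose φ hφT hφ using fun u : S => hT _ (hnorm u)
  refine ⟨T, hTf.fintype, fun u => ⟨φ u, hφT u⟩, fun u v huv => ?_⟩
  have huv' : φ u = φ v := congrArg Subtype.val huv
  rw [dist_eq_norm]
  refine hSδ u u.2 v v.2 ?_
  have e : (u : E) - v = M • ((M⁻¹ • (u : E) - φ u) - (M⁻¹ • (v : E) - φ v)) := by
    rw [huv', sub_sub_sub_cancel_right, ← smul_sub, smul_inv_smul₀ hM.ne']
  rw [e, map_smul, map_sub, norm_smul, Real.norm_of_nonneg hM.le]
  have h1 := norm_sub_le (V (M⁻¹ • (u : E) - φ u)) (V (M⁻¹ • (v : E) - φ v))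
  have h2 : ‖V (M⁻¹ • (u : E) - φ u) - V (M⁻¹ • (v : E) - φ v)‖ ≤ δ / M := by
    have e2 : δ / M = δ / (2 * M) + δ / (2 * M) := by field_simp; norm_num
    linarith [hφ u, hφ v]
  calc M * _ ≤ M * (δ / M) := by gcongr
    _ = δ := mul_div_cancel₀ _ hM.ne'

section Solutions

variable {X E : Type*} [MeasurableSpace X] [NormedAddCommGroup E] [NormedSpace ℝ E]

/-- As `j` is bounded, superposition takes bounded values, uniformly in `u`. -/
lemma exists_abs_nemytskii_le {μ : Measure X} [IsFiniteMeasure μ] {j : ℝ → ℝ} {K : ℝ}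
    (hj : IsC2Bounded j K) (B : E →L[ℝ] Lp ℝ 2 μ) :
    ∃ L ≥ 0, ∀ u p, |nemytskii hj B u p| ≤ L * ‖B p‖ :=
  ⟨K * ‖Lp.const 2 μ (1 : ℝ)‖, mul_nonneg hj.nonneg (norm_nonneg _), fun u _ =>
    abs_integral_weight_mul_le (fun x => hj.abs_le (B u x)) _ _⟩

/-- The solutions of the semilinear limit equation form a precompact set, as the right-hand side is
bounded in a compact way. -/
theorem totallyBounded_solutions {μ₀ ν : Measure X} [IsFiniteMeasure μ₀] [IsFiniteMeasure ν]
    (B₀ : E →L[ℝ] Lp ℝ 2 μ₀) (V : E →L[ℝ] Lp ℝ 2 ν) {C : ℝ} (hC : 0 ≤ C)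
    (hB : ∀ u, ‖B₀ u‖ ^ 2 ≤ C * (‖V u‖ * ‖u‖))
    (hV : ∀ η > 0, ∃ T : Set E, T.Finite ∧ ∀ u, ‖u‖ ≤ 1 → ∃ φ ∈ T, ‖V (u - φ)‖ ≤ η)
    {f g : ℝ → ℝ} {K K' : ℝ} (hf : IsC2Bounded f K) (hg : IsC2Bounded g K')
    (Λ : E →L[ℝ] StrongDual ℝ E) {c : ℝ} (hc : 0 < c) (hΛ : ∀ u, c * ‖u‖ ^ 2 ≤ Λ u u) :
    TotallyBounded {u | Λ u - nemytskii hf V u - nemytskii hg B₀ u = 0} := by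
  obtain ⟨L₁, hL₁, h1⟩ := exists_abs_nemytskii_le hf V
  obtain ⟨L₂, hL₂, h2⟩ := exists_abs_nemytskii_le hg B₀
  have heq : ∀ u ∈ {u | Λ u - nemytskii hf V u - nemytskii hg B₀ u = 0}, ∀ p,
      Λ u p = nemytskii hf V u p + nemytskii hg B₀ u p := by
    intro u hu p
    have := DFunLike.congr_fun hu p
    simp only [sub_apply, zero_apply] at this
    linarith
  have hbd : ∀ u ∈ {u | Λ u - nemytskii hf V u - nemytskii hg B₀ u = 0},
      ‖u‖ ≤ (L₁ * ‖V‖ + L₂ * ‖B₀‖) / c + 1 := by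
    intro u hu
    have h3 := hΛ u
    rw [heq u hu] at h3
    have h4 : c * ‖u‖ ^ 2 ≤ (L₁ * ‖V‖ + L₂ * ‖B₀‖) * ‖u‖ := by
      have p1 := (le_abs_self _).trans ((h1 u u).trans
        (mul_le_mul_of_nonneg_left (V.le_opNorm u) hL₁))
      have p2 := (le_abs_self _).trans ((h2 u u).trans
        (mul_le_mul_of_nonneg_left (B₀.le_opNorm u) hL₂))
      linarith
    have h5 : ‖u‖ ≤ (L₁ * ‖V‖ + L₂ * ‖B₀‖) / c := by
      rw [le_div_iff₀ hc]
      rcases (norm_nonneg u).eq_or_lt with h0 | h0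
      · rw [← h0, zero_mul]
        positivity
      · refine le_of_mul_le_mul_right ?_ h0
        linarith
    linarith
  set M := (L₁ * ‖V‖ + L₂ * ‖B₀‖) / c + 1 with hM
  have hM0 : 0 < M := by positivity
  refine totallyBounded_of_compact_norm V hV hM0 hbd fun η hη => ?_
  obtain ⟨δ, hδ, hδη⟩ : ∃ δ > 0, 2 * L₁ * δ + 2 * L₂ * Real.sqrt (C * (δ * (2 * M))) < c * η ^ 2 := by
    have hcont : Continuous fun δ : ℝ => 2 * L₁ * δ + 2 * L₂ * Real.sqrt (C * (δ * (2 * M))) := by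
      fun_prop
    have h0 : ∀ᶠ δ in 𝓝[>] (0 : ℝ), 2 * L₁ * δ + 2 * L₂ * Real.sqrt (C * (δ * (2 * M))) < c * η ^ 2 :=
      nhdsWithin_le_nhds (hcont.continuousAt.eventually (gt_mem_nhds (by
        simpa using (by positivity : 0 < c * η ^ 2))))
    obtain ⟨δ, hδ, hδ'⟩ := (h0.and self_mem_nhdsWithin).exists
    exact ⟨δ, hδ', hδ⟩
  refine ⟨δ, hδ, fun u hu v hv huv => ?_⟩
  have hw : ‖u - v‖ ≤ 2 * M := (norm_sub_le u v).trans (by linarith [hbd u hu, hbd v hv])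
  have hBw : ‖B₀ (u - v)‖ ≤ Real.sqrt (C * (δ * (2 * M))) := by
    refine Real.le_sqrt_of_sq_le ((hB (u - v)).trans ?_)
    gcongr
  have h3 := hΛ (u - v)
  have e : Λ (u - v) (u - v) = nemytskii hf V u (u - v) + nemytskii hg B₀ u (u - v)
      - (nemytskii hf V v (u - v) + nemytskii hg B₀ v (u - v)) := by
    rw [map_sub Λ, sub_apply, heq u hu, heq v hv]
  rw [e] at h3
  have q1 := abs_le.1 (h1 u (u - v))
  have q2 := abs_le.1 (h1 v (u - v))
  have q3 := abs_le.1 (h2 u (u - v))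
  have q4 := abs_le.1 (h2 v (u - v))
  have q5 := mul_le_mul_of_nonneg_left huv hL₁
  have q6 := mul_le_mul_of_nonneg_left hBw hL₂
  have h6 : c * ‖u - v‖ ^ 2 < c * η ^ 2 := by linarith [q1.2, q2.1, q3.2, q4.1]
  exact lt_of_pow_lt_pow_left₀ 2 hη.le (lt_of_mul_lt_mul_left h6 hc.le)

end Solutions

/-! ### The operators of the problem on `H¹(Ω)` -/

section InnerForm

variable {X V : Type*} [MeasurableSpace X] {μ : Measure X} [NormedAddCommGroup V]
  [InnerProductSpace ℝ V]

lemma integrable_weight_inner {h : X → ℝ} {K : ℝ} (hm : AEStronglyMeasurable h μ)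
    (hb : ∀ᵐ x ∂μ, |h x| ≤ K) (f g : Lp V 2 μ) : Integrable (fun x => h x * ⟪f x, g x⟫) μ :=
  (L2.integrable_inner f g).bdd_mul hm hb

lemma abs_integral_weight_inner_le {h : X → ℝ} {K : ℝ} (hb : ∀ᵐ x ∂μ, |h x| ≤ K)
    (hK : 0 ≤ K) (f g : Lp V 2 μ) : |∫ x, h x * ⟪f x, g x⟫ ∂μ| ≤ K * ‖f‖ * ‖g‖ := by
  let F := (Lp.memLp f).norm.toLp
  let G := (Lp.memLp g).norm.toLp
  have hF : F =ᵐ[μ] fun x => ‖f x‖ := (Lp.memLp f).norm.coeFn_toLp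
  have hG : G =ᵐ[μ] fun x => ‖g x‖ := (Lp.memLp g).norm.coeFn_toLp
  have nF : ‖F‖ = ‖f‖ := by rw [Lp.norm_toLp, eLpNorm_norm, Lp.norm_def]
  have nG : ‖G‖ = ‖g‖ := by rw [Lp.norm_toLp, eLpNorm_norm, Lp.norm_def]
  have hle : ‖∫ x, h x * ⟪f x, g x⟫ ∂μ‖ ≤ ∫ x, K * (|F x| * |G x|) ∂μ := by
    refine norm_integral_le_of_norm_le ((integrable_abs_mul_abs F G).const_mul K) ?_
    filter_upwards [hb, hF, hG] with x h1 h2 h3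
    rw [h2, h3, abs_norm, abs_norm, norm_mul]
    exact mul_le_mul h1 (norm_inner_le_norm _ _) (norm_nonneg _) hK
  refine hle.trans ?_
  rw [integral_const_mul, mul_assoc, ← nF, ← nG]
  exact mul_le_mul_of_nonneg_left (integral_abs_mul_abs_le F G) hK

/-- The bilinear form `(f, g) ↦ ∫ h ⟪f, g⟫ dμ` on vector valued functions, for a bounded weight. -/
def innerForm {h : X → ℝ} {K : ℝ} (hm : AEStronglyMeasurable h μ)
    (hb : ∀ᵐ x ∂μ, |h x| ≤ K) (hK : 0 ≤ K) : Lp V 2 μ →L[ℝ] Lp V 2 μ →L[ℝ] ℝ :=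
  LinearMap.mkContinuous₂ (LinearMap.mk₂ ℝ (fun f g : Lp V 2 μ => ∫ x, h x * ⟪f x, g x⟫ ∂μ)
    (fun f f' g => by
      rw [← integral_add (integrable_weight_inner hm hb f g) (integrable_weight_inner hm hb f' g)]
      refine integral_congr_ae ?_
      filter_upwards [Lp.coeFn_add f f'] with x hx
      rw [hx, Pi.add_apply, inner_add_left]
      ring)
    (fun c f g => by
      rw [smul_eq_mul, ← integral_const_mul]
      refine integral_congr_ae ?_
      filter_upwards [Lp.coeFn_smul c f] with x hx
      rw [hx, Pi.smul_apply, real_inner_smul_left]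
      ring)
    (fun f g g' => by
      rw [← integral_add (integrable_weight_inner hm hb f g) (integrable_weight_inner hm hb f g')]
      refine integral_congr_ae ?_
      filter_upwards [Lp.coeFn_add g g'] with x hx
      rw [hx, Pi.add_apply, inner_add_right]
      ring)
    (fun c f g => by
      rw [smul_eq_mul, ← integral_const_mul]
      refine integral_congr_ae ?_
      filter_upwards [Lp.coeFn_smul c g] with x hx
      rw [hx, Pi.smul_apply, real_inner_smul_right]
      ring)) K (fun f g => abs_integral_weight_inner_le hb hK f g)

lemma innerForm_apply {h : X → ℝ} {K : ℝ} (hm : AEStronglyMeasurable h μ)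
    (hb : ∀ᵐ x ∂μ, |h x| ≤ K) (hK : 0 ≤ K) (f g : Lp V 2 μ) :
    innerForm hm hb hK f g = ∫ x, h x * ⟪f x, g x⟫ ∂μ := rfl

lemma mul_norm_sq_le_innerForm {h : X → ℝ} {K c : ℝ} (hm : AEStronglyMeasurable h μ)
    (hb : ∀ᵐ x ∂μ, |h x| ≤ K) (hK : 0 ≤ K) (hc : ∀ᵐ x ∂μ, c ≤ h x) (f : Lp V 2 μ) :
    c * ‖f‖ ^ 2 ≤ innerForm hm hb hK f f := by
  rw [innerForm_apply, ← real_inner_self_eq_norm_sq, L2.inner_def, ← integral_const_mul]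
  refine integral_mono_ae ((L2.integrable_inner f f).const_mul c)
    (integrable_weight_inner hm hb f f) ?_
  filter_upwards [hc] with x hx
  exact mul_le_mul_of_nonneg_right hx real_inner_self_nonneg

end InnerForm

/-- The weak gradient, as an operator from `H¹(Ω)` to `L²(Ω)³`. -/
def gradL : H1 Ω →L[ℝ] Lp E3 2 (volume.restrict Ω) :=
  LinearMap.mkContinuous ⟨⟨H1.grad, fun _ _ => rfl⟩, fun _ _ => rfl⟩ 1
    fun u => (H1.norm_grad_le u).trans_eq (one_mul _).symm

/-- `Λ` as a bounded and coercive operator from `H¹(Ω)` to its dual. -/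
lemma exists_LamL {a : E3 → ℝ} {a₀ a₁ : ℝ} (ham : AEStronglyMeasurable a (volume.restrict Ω))
    (ha₀ : 0 < a₀) (hb : ∀ᵐ x ∂(volume.restrict Ω), a₀ ≤ a x ∧ a x ≤ a₁) :
    ∃ Λ : H1 Ω →L[ℝ] StrongDual ℝ (H1 Ω), (∀ u p, Λ u p = Lam a u p) ∧
      ∀ u, min a₀ 1 * ‖u‖ ^ 2 ≤ Λ u u := by
  have hb1 : ∀ᵐ x ∂(volume.restrict Ω), |a x| ≤ max a₁ 0 := by
    filter_upwards [hb] with x hx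
    rw [abs_of_nonneg (ha₀.le.trans hx.1)]
    exact hx.2.trans (le_max_left _ _)
  have hb2 : ∀ᵐ x ∂((volume : Measure E3).restrict Ω), |(fun _ : E3 => (1 : ℝ)) x| ≤ 1 :=
    ae_of_all _ fun _ => by simp
  let P : Lp E3 2 (volume.restrict Ω) →L[ℝ] Lp E3 2 (volume.restrict Ω) →L[ℝ] ℝ :=
    innerForm ham hb1 (le_max_right _ _)
  let Q : Lp ℝ 2 (volume.restrict Ω) →L[ℝ] Lp ℝ 2 (volume.restrict Ω) →L[ℝ] ℝ :=
    innerForm (aestronglyMeasurable_const (b := (1 : ℝ))) hb2 zero_le_one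
  have e : ∀ u p : H1 Ω, P u.grad p.grad + Q u.val p.val = Lam a u p := by
    intro u p
    refine congrArg₂ (· + ·) rfl (integral_congr_ae (ae_of_all _ fun x => ?_))
    change 1 * (p.val x * u.val x) = u.val x * p.val x
    ring
  refine ⟨P.bilinearComp gradL gradL + Q.bilinearComp valL valL, e, fun u => ?_⟩
  have h1 : a₀ * ‖u.grad‖ ^ 2 ≤ P u.grad u.grad :=
    mul_norm_sq_le_innerForm ham hb1 _ (hb.mono fun x hx => hx.1) _
  have h2 : 1 * ‖u.val‖ ^ 2 ≤ Q u.val u.val :=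
    mul_norm_sq_le_innerForm _ hb2 _ (ae_of_all _ fun x => le_rfl) _
  change min a₀ 1 * ‖u‖ ^ 2 ≤ P u.grad u.grad + Q u.val u.val
  rw [u.norm_sq_eq, mul_add, add_comm]
  exact (add_le_add (mul_le_mul_of_nonneg_right (min_le_left _ _) (sq_nonneg _))
    (mul_le_mul_of_nonneg_right (min_le_right _ _) (sq_nonneg _))).trans (add_le_add h1 h2)

lemma exists_mul_mul_le (n : ℝ) {η : ℝ} (hη : 0 < η) :
    ∃ κ > 0, ∀ b, 0 ≤ b → κ * (n * b) ≤ η * b := by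
  refine ⟨η / (|n| + 1), by positivity, fun b hb => ?_⟩
  rw [← mul_assoc]
  refine mul_le_mul_of_nonneg_right ?_ hb
  rw [div_mul_eq_mul_div, div_le_iff₀ (by positivity)]
  nlinarith [le_abs_self n]

lemma integral_comp_mul_eq {X : Type*} [MeasurableSpace X] {μ : Measure X} {b φ c p : X → ℝ}
    {h : ℝ → ℝ} (hb : b =ᵐ[μ] φ) (hc : c =ᵐ[μ] fun _ => 1) :
    ∫ x, h (φ x) * c x * p x ∂μ = ∫ x, h (b x) * p x ∂μ := by
  refine integral_congr_ae ?_
  filter_upwards [hb, hc] with x h1 h2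
  rw [h1, h2, mul_one]

lemma integral_comp_mul_mul_eq {X : Type*} [MeasurableSpace X] {μ : Measure X} {b φ w p : X → ℝ}
    {h : ℝ → ℝ} (hb : b =ᵐ[μ] φ) :
    ∫ x, h (φ x) * w x * p x ∂μ = ∫ x, h (b x) * w x * p x ∂μ := by
  refine integral_congr_ae ?_
  filter_upwards [hb] with x h1
  rw [h1]

lemma isFiniteMeasure_stripMeasure [IsFiniteMeasure ((volume : Measure E3).restrict Ω)] (ε : ℝ) :
    IsFiniteMeasure (stripMeasure Ω ε) :=
  ⟨(stripMeasure_le ε univ).trans_lt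
    (ENNReal.mul_lt_top ENNReal.ofReal_lt_top (measure_lt_top _ _))⟩

namespace IsSmoothBoundedDomain

variable (hΩ : IsSmoothBoundedDomain Ω)
include hΩ

/-- The constant function `1` on the closure of `Ω`, as a smooth function with compact support. -/
lemma exists_eq_one : ∃ χ : smoothFunctions Ω, ∀ x ∈ closure Ω, χ.1 x = 1 := by
  obtain ⟨R, hR, hR'⟩ := hΩ.isBounded.closure.subset_closedBall_lt 0 (0 : E3)
  let χ : ContDiffBump (0 : E3) := ⟨R, R + 1, hR, by linarith⟩
  exact ⟨⟨χ, χ.contDiff, χ.hasCompactSupport,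
    hΩ.memLp_surface χ.continuous χ.hasCompactSupport⟩, fun x hx =>
      χ.one_of_mem_closedBall (hR' hx)⟩

/-- The term in the interior does not depend on `ε`. -/
lemma tracesConverge_valL {C ε₀ : ℝ} (hε₀ : 0 < ε₀)
    (hV : IsTrace (volume.restrict Ω) C (valL (Ω := Ω))) :
    TracesConverge (fun _ => volume.restrict Ω) (volume.restrict Ω) (fun _ => valL (Ω := Ω)) valL
      (Real.sqrt C) ε₀ (range (toH1 : smoothFunctions Ω →ₗ[ℝ] H1 Ω)) where
  nonneg := Real.sqrt_nonneg C
  pos := hε₀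
  norm_le _ _ := hV.norm_le
  norm_le₀ := hV.norm_le
  small η hη := by
    obtain ⟨δ, hδ, h⟩ := hΩ.exists_integral_min_mul_le hV.nonneg hη
    exact ⟨δ, hδ, fun ε _ => h _ _ hV⟩
  small₀ η hη := by
    obtain ⟨δ, hδ, h⟩ := hΩ.exists_integral_min_mul_le hV.nonneg hη
    exact ⟨δ, hδ, h _ _ hV⟩
  dense := hΩ.denseRange_toH1
  tendsto_linear _ _ _ _ _ _ _ η hη := ⟨1, one_pos, fun ε _ p => by
    rw [sub_self, abs_zero]; positivity⟩
  tendsto_bilinear _ _ _ _ _ _ _ η hη := ⟨1, one_pos, fun ε _ w p => by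
    rw [sub_self, abs_zero]; positivity⟩

set_option maxHeartbeats 1000000 in
/-- The linear forms converge: they are bilinear forms with one argument equal to `1` on the closure
of `Ω`. -/
lemma exists_abs_linear_strip_sub_le {C ε₀ : ℝ} (hε₀ : 0 < ε₀)
    (hγ : IsTrace (surface Ω) C (trace (Ω := Ω)))
    (hB : ∀ ε ∈ Ioc 0 ε₀, IsTrace (stripMeasure Ω ε) C (stripTrace Ω ε)) (φ : smoothFunctions Ω)
    {h : ℝ → ℝ} {K : ℝ} (hh : ContDiff ℝ 1 h) (h0 : ∀ s, |h s| ≤ K) (h1 : ∀ s, |deriv h s| ≤ K)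
    {η : ℝ} (hη : 0 < η) : ∃ ε₁ > 0, ∀ ε ∈ Ioc 0 ε₁, ∀ p : H1 Ω,
      |∫ x, h (stripTrace Ω ε (toH1 φ) x) * stripTrace Ω ε p x ∂(stripMeasure Ω ε)
        - ∫ x, h (trace (toH1 φ) x) * trace p x ∂(surface Ω)| ≤ η * ‖p‖ := by
  obtain ⟨hH, M, hM0, hM1⟩ := exists_gradient_comp_bound hh h0 h1 φ
  obtain ⟨χ, hχ⟩ := hΩ.exists_eq_one
  obtain ⟨κ, hκ, hκη⟩ := exists_mul_mul_le ‖toH1 χ‖ hη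
  obtain ⟨ε₁, hε₁, hlim⟩ := hΩ.exists_abs_integral_strip_sub_le hε₀ hγ hB hH hM0 hM1 hκ
  refine ⟨min ε₀ ε₁, lt_min hε₀ hε₁, fun ε hε p => ?_⟩
  have hBε := hB ε ⟨hε.1, hε.2.trans (min_le_left _ _)⟩
  have hmem : ∀ᵐ x ∂(stripMeasure Ω ε), x ∈ Ω :=
    (stripMeasure_absolutelyContinuous ε).ae_le (ae_restrict_mem hΩ.isOpen.measurableSet)
  have e1 := integral_comp_mul_eq (h := h) (p := stripTrace Ω ε p) (hBε.ae_eq φ)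
    ((hBε.ae_eq χ).trans (hmem.mono fun x hx => hχ x (subset_closure hx)))
  have e2 := integral_comp_mul_eq (h := h) (p := trace p) (hγ.ae_eq φ) ((hγ.ae_eq χ).trans
    ((ae_restrict_mem isClosed_frontier.measurableSet).mono
      fun x hx => hχ x (frontier_subset_closure hx)))
  exact (congrArg₂ (fun s t => |s - t|) e1 e2).symm.trans_le
    ((hlim ε ⟨hε.1, hε.2.trans (min_le_right _ _)⟩ (toH1 χ) p).trans
      (hκη _ (norm_nonneg p)))

lemma exists_abs_bilinear_strip_sub_le {C ε₀ : ℝ} (hε₀ : 0 < ε₀)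
    (hγ : IsTrace (surface Ω) C (trace (Ω := Ω)))
    (hB : ∀ ε ∈ Ioc 0 ε₀, IsTrace (stripMeasure Ω ε) C (stripTrace Ω ε)) (φ : smoothFunctions Ω)
    {h : ℝ → ℝ} {K : ℝ} (hh : ContDiff ℝ 1 h) (h0 : ∀ s, |h s| ≤ K) (h1 : ∀ s, |deriv h s| ≤ K)
    {η : ℝ} (hη : 0 < η) : ∃ ε₁ > 0, ∀ ε ∈ Ioc 0 ε₁, ∀ w p : H1 Ω,
      |∫ x, h (stripTrace Ω ε (toH1 φ) x) * stripTrace Ω ε w x * stripTrace Ω ε p x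
          ∂(stripMeasure Ω ε)
        - ∫ x, h (trace (toH1 φ) x) * trace w x * trace p x ∂(surface Ω)| ≤ η * (‖w‖ * ‖p‖) := by
  obtain ⟨hH, M, hM0, hM1⟩ := exists_gradient_comp_bound hh h0 h1 φ
  obtain ⟨ε₁, hε₁, hlim⟩ := hΩ.exists_abs_integral_strip_sub_le hε₀ hγ hB hH hM0 hM1 hη
  refine ⟨min ε₀ ε₁, lt_min hε₀ hε₁, fun ε hε w p => ?_⟩
  have hBε := hB ε ⟨hε.1, hε.2.trans (min_le_left _ _)⟩
  have e1 := integral_comp_mul_mul_eq (h := h) (w := stripTrace Ω ε w) (p := stripTrace Ω ε p)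
    (hBε.ae_eq φ)
  have e2 := integral_comp_mul_mul_eq (h := h) (w := trace w) (p := trace p) (hγ.ae_eq φ)
  exact (congrArg₂ (fun s t => |s - t|) e1 e2).symm.trans_le
    (hlim ε ⟨hε.1, hε.2.trans (min_le_right _ _)⟩ w p)

/-- The restrictions to the strips converge to the trace on the boundary. -/
lemma tracesConverge_stripTrace {C ε₀ : ℝ} (hε₀ : 0 < ε₀)
    (hγ : IsTrace (surface Ω) C (trace (Ω := Ω)))
    (hB : ∀ ε ∈ Ioc 0 ε₀, IsTrace (stripMeasure Ω ε) C (stripTrace Ω ε)) :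
    TracesConverge (stripMeasure Ω) (surface Ω) (stripTrace Ω) trace (Real.sqrt C) ε₀
      (range (toH1 : smoothFunctions Ω →ₗ[ℝ] H1 Ω)) where
  nonneg := Real.sqrt_nonneg C
  pos := hε₀
  norm_le ε hε := (hB ε hε).norm_le
  norm_le₀ := hγ.norm_le
  small η hη := by
    obtain ⟨δ, hδ, h⟩ := hΩ.exists_integral_min_mul_le hγ.nonneg hη
    exact ⟨δ, hδ, fun ε hε => h _ _ (hB ε hε)⟩
  small₀ η hη := by
    obtain ⟨δ, hδ, h⟩ := hΩ.exists_integral_min_mul_le hγ.nonneg hη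
    exact ⟨δ, hδ, h _ _ hγ⟩
  dense := hΩ.denseRange_toH1
  tendsto_linear := by
    rintro _ ⟨φ, rfl⟩ h K hh h0 h1 η hη
    exact hΩ.exists_abs_linear_strip_sub_le hε₀ hγ hB φ hh h0 h1 hη
  tendsto_bilinear := by
    rintro _ ⟨φ, rfl⟩ h K hh h0 h1 η hη
    exact hΩ.exists_abs_bilinear_strip_sub_le hε₀ hγ hB φ hh h0 h1 hη

end IsSmoothBoundedDomain

/-! ### The equations in `H¹(Ω)` -/

/-- Integration by parts against a test function is a closed condition on `(u, ∇u)` in `L²`. -/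
lemma isClosed_sobolevSpace : IsClosed (sobolevSpace Ω : Set
    (WithLp 2 (Lp ℝ 2 (volume.restrict Ω) × Lp E3 2 (volume.restrict Ω)))) := by
  have hset : (sobolevSpace Ω : Set (WithLp 2 (Lp ℝ 2 (volume.restrict Ω) ×
      Lp E3 2 (volume.restrict Ω)))) = {w | ∀ ψ : E3 → ℝ, ContDiff ℝ ∞ ψ → HasCompactSupport ψ →
        tsupport ψ ⊆ Ω → ∀ v : E3,
        ∫ x in Ω, w.fst x * fderiv ℝ ψ x v = - ∫ x in Ω, ⟪w.snd x, v⟫ * ψ x} := rfl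
  rw [hset]
  simp only [ofPred_forall]
  refine isClosed_iInter fun ψ => isClosed_iInter fun hψ => isClosed_iInter fun hc =>
    isClosed_iInter fun _ => isClosed_iInter fun v => ?_
  have m1 := memLp_fderiv hψ hc v (volume.restrict Ω) 2
  have m2 : MemLp (fun x => ψ x • v) 2 (volume.restrict Ω) :=
    (hψ.continuous.smul continuous_const).memLp_of_hasCompactSupport hc.smul_right
  have e1 : ∀ u : Lp ℝ 2 (volume.restrict Ω),
      ∫ x in Ω, u x * fderiv ℝ ψ x v = ⟪m1.toLp _, u⟫ := by
    intro u
    rw [L2.inner_def]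
    refine integral_congr_ae ?_
    filter_upwards [m1.coeFn_toLp] with x hx
    rw [hx]
    rfl
  have e2 : ∀ G : Lp E3 2 (volume.restrict Ω),
      ∫ x in Ω, ⟪G x, v⟫ * ψ x = ⟪m2.toLp _, G⟫ := by
    intro G
    rw [L2.inner_def]
    refine integral_congr_ae ?_
    filter_upwards [m2.coeFn_toLp] with x hx
    rw [hx, real_inner_smul_left, real_inner_comm, mul_comm]
  simp only [e1, e2]
  have c1 : Continuous fun w : WithLp 2 (Lp ℝ 2 (volume.restrict Ω) ×
      Lp E3 2 (volume.restrict Ω)) => w.fst := (WithLp.continuous_fst 2 _ _)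
  have c2 : Continuous fun w : WithLp 2 (Lp ℝ 2 (volume.restrict Ω) ×
      Lp E3 2 (volume.restrict Ω)) => w.snd := (WithLp.continuous_snd 2 _ _)
  exact isClosed_eq (continuous_const.inner c1) (continuous_const.inner c2).neg

lemma completeSpace_H1 : CompleteSpace (H1 Ω) :=
  isClosed_sobolevSpace.completeSpace_coe

section Forms

variable {f g : ℝ → ℝ} {K K' : ℝ} (hf : IsC2Bounded f K) (hg : IsC2Bounded g K')

lemma nemytskii_valL [IsFiniteMeasure ((volume : Measure E3).restrict Ω)] (u p : H1 Ω) :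
    nemytskii hf (valL (Ω := Ω)) u p = ∫ x in Ω, f (u.val x) * p.val x :=
  nemytskii_apply hf (valL (Ω := Ω)) u p

lemma nemytskii_trace [IsFiniteMeasure (surface Ω)] (u p : H1 Ω) :
    nemytskii hg (trace (Ω := Ω)) u p = ∫ x, g (trace u x) * trace p x ∂(surface Ω) :=
  nemytskii_apply hg (trace (Ω := Ω)) u p

lemma nemytskii_stripTrace [∀ ε, IsFiniteMeasure (stripMeasure Ω ε)] {ε : ℝ} (hε : 0 < ε)
    (u p : H1 Ω) : nemytskii hg (stripTrace Ω ε) u p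
      = 1 / ε * ∫ x in Ω ∩ strip Ω ε, g (u.val x) * p.val x := by
  have e : ∫ x, g (stripTrace Ω ε u x) * stripTrace Ω ε p x ∂(stripMeasure Ω ε)
      = ∫ x, g (u.val x) * p.val x ∂(stripMeasure Ω ε) := by
    refine integral_congr_ae ?_
    filter_upwards [stripTrace_ae_eq ε u, stripTrace_ae_eq ε p] with x h1 h2
    rw [h1, h2]
  refine (nemytskii_apply hg (stripTrace Ω ε) u p).trans (e.trans ?_)
  rw [stripMeasure, integral_smul_measure, ENNReal.toReal_ofReal (inv_nonneg.2 hε.le),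
    smul_eq_mul, one_div]

lemma Fconc_eq [IsFiniteMeasure ((volume : Measure E3).restrict Ω)]
    [∀ ε, IsFiniteMeasure (stripMeasure Ω ε)] {ε : ℝ} (hε : 0 < ε) (u p : H1 Ω) :
    Fconc f g ε u p
      = nemytskii hf (valL (Ω := Ω)) u p + nemytskii hg (stripTrace Ω ε) u p :=
  (congrArg₂ (· + ·) (nemytskii_valL hf u p) (nemytskii_stripTrace hg hε u p)).symm

lemma Flim_eq [IsFiniteMeasure ((volume : Measure E3).restrict Ω)] [IsFiniteMeasure (surface Ω)]
    (u p : H1 Ω) :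
    Flim f g u p = nemytskii hf (valL (Ω := Ω)) u p + nemytskii hg (trace (Ω := Ω)) u p :=
  (congrArg₂ (· + ·) (nemytskii_valL hf u p) (nemytskii_trace hg u p)).symm

lemma nemytskiiDeriv_valL (u w p : H1 Ω) : nemytskiiDeriv hf (valL (Ω := Ω)) u w p
    = ∫ x in Ω, deriv f (u.val x) * w.val x * p.val x :=
  nemytskiiDeriv_apply hf (valL (Ω := Ω)) u w p

lemma nemytskiiDeriv_trace (u w p : H1 Ω) : nemytskiiDeriv hg (trace (Ω := Ω)) u w p
    = ∫ x, deriv g (trace u x) * trace w x * trace p x ∂(surface Ω) :=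
  nemytskiiDeriv_apply hg (trace (Ω := Ω)) u w p

lemma DFlim_eq (u w p : H1 Ω) :
    DFlim f g u w p = nemytskiiDeriv hf (valL (Ω := Ω)) u w p
      + nemytskiiDeriv hg (trace (Ω := Ω)) u w p :=
  (congrArg₂ (· + ·) (nemytskiiDeriv_valL hf u w p) (nemytskiiDeriv_trace hg u w p)).symm

end Forms

variable {a : E3 → ℝ} {f g : ℝ → ℝ} {K K' : ℝ} {Λ : H1 Ω →L[ℝ] StrongDual ℝ (H1 Ω)}

/-- The solutions of the limit problem as the zeros of an operator into the dual. -/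
lemma limSolutions_eq (hf : IsC2Bounded f K) (hg : IsC2Bounded g K')
    [IsFiniteMeasure ((volume : Measure E3).restrict Ω)] [IsFiniteMeasure (surface Ω)]
    (hΛ : ∀ u p, Λ u p = Lam a u p) :
    limSolutions Ω a f g = {u | Λ u - nemytskii hf (valL (Ω := Ω)) u
      - nemytskii hg (trace (Ω := Ω)) u = 0} := by
  refine Set.ext fun u => Iff.trans (forall_congr' fun p => ?_) ContinuousLinearMap.ext_iff.symm
  have e : (Λ u - nemytskii hf (valL (Ω := Ω)) u - nemytskii hg (trace (Ω := Ω)) u) p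
      = Lam a u p - Flim f g u p :=
    (sub_sub _ _ _).trans (congrArg₂ (· - ·) (hΛ u p) (Flim_eq hf hg u p).symm)
  exact (congrArg (· = 0) e.symm).to_iff

/-- The solutions of the concentrated problem as the zeros of an operator into the dual. -/
lemma concSolutions_eq (hf : IsC2Bounded f K) (hg : IsC2Bounded g K')
    [IsFiniteMeasure ((volume : Measure E3).restrict Ω)] [∀ ε, IsFiniteMeasure (stripMeasure Ω ε)]
    (hΛ : ∀ u p, Λ u p = Lam a u p) {ε : ℝ} (hε : 0 < ε) :
    concSolutions Ω a f g ε = {u | Λ u - nemytskii hf (valL (Ω := Ω)) u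
      - nemytskii hg (stripTrace Ω ε) u = 0} := by
  refine Set.ext fun u => Iff.trans (forall_congr' fun p => ?_) ContinuousLinearMap.ext_iff.symm
  have e : (Λ u - nemytskii hf (valL (Ω := Ω)) u - nemytskii hg (stripTrace Ω ε) u) p
      = Lam a u p - Fconc f g ε u p :=
    (sub_sub _ _ _).trans (congrArg₂ (· - ·) (hΛ u p) (Fconc_eq hf hg hε u p).symm)
  exact (congrArg (· = 0) e.symm).to_iff

/-- At a nondegenerate solution, the linearization, as an operator from `H¹(Ω)` to its dual, has a
bounded inverse. -/
lemma exists_inverse_linearization (hf : IsC2Bounded f K) (hg : IsC2Bounded g K')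
    (hΛ : ∀ u p, Λ u p = Lam a u p) {u : H1 Ω}
    (h : (0 : ℝ) ∉ opSpectrum (linearization a f g u)) :
    ∃ R : StrongDual ℝ (H1 Ω) →L[ℝ] H1 Ω,
      (∀ w, R (Λ w - nemytskiiDeriv hf (valL (Ω := Ω)) u w
        - nemytskiiDeriv hg (trace (Ω := Ω)) u w) = w) ∧
      ∀ l, Λ (R l) - nemytskiiDeriv hf (valL (Ω := Ω)) u (R l)
        - nemytskiiDeriv hg (trace (Ω := Ω)) u (R l) = l := by
  have h' : ∃ R : StrongDual ℝ (H1 Ω) →L[ℝ] H1 Ω, IsResolvent (linearization a f g u) 0 R :=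
    Classical.byContradiction h
  refine h'.imp fun R hR => ?_
  have e : ∀ w p, (Λ w - nemytskiiDeriv hf (valL (Ω := Ω)) u w
      - nemytskiiDeriv hg (trace (Ω := Ω)) u w) p = linearization a f g u w p := fun w p =>
    (sub_sub _ _ _).trans (congrArg₂ (· - ·) (hΛ w p) (DFlim_eq hf hg u w p).symm)
  have e0 : ∀ s t : ℝ, s - 0 * t = s := fun s t => by ring
  refine ⟨fun w => hR.2 _ _ fun p => (e0 _ _).trans (e w p).symm, fun l => ?_⟩
  exact ContinuousLinearMap.ext fun p => (e (R l) p).trans ((e0 _ _).symm.trans (hR.1 l p))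

namespace IsSmoothBoundedDomain

/-- Persistence of a nondegenerate solution. -/
theorem exists_unique_solution (hΩ : IsSmoothBoundedDomain Ω)
    (hf : IsC2Bounded f K) (hg : IsC2Bounded g K')
    (hΛ : ∀ u p, Λ u p = Lam a u p) {u₀ : H1 Ω} (hu₀ : u₀ ∈ limSolutions Ω a f g)
    (h : (0 : ℝ) ∉ opSpectrum (linearization a f g u₀)) :
    ∃ ε₀ > (0 : ℝ), ∃ δ > (0 : ℝ), ∃ u : ℝ → H1 Ω,
      (∀ ε ∈ Ioc 0 ε₀, concSolutions Ω a f g ε ∩ {v | ‖v - u₀‖ ≤ δ} = {u ε}) ∧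
      Tendsto u (𝓝[>] 0) (𝓝 u₀) := by
  have := hΩ.isFiniteMeasure_surface
  have := hΩ.isFiniteMeasure_restrict
  have : ∀ ε, IsFiniteMeasure (stripMeasure Ω ε) := isFiniteMeasure_stripMeasure
  have : CompleteSpace (H1 Ω) := completeSpace_H1
  obtain ⟨C, -, ε₀, hε₀, hV, hγ, hB⟩ := hΩ.exists_isTrace
  obtain ⟨R, hRL, hLR⟩ := exists_inverse_linearization hf hg hΛ h
  rw [limSolutions_eq hf hg hΛ] at hu₀
  obtain ⟨ε₁, hε₁, δ, hδ, u, hu, hlim⟩ := exists_unique_solution_near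
    (hΩ.tracesConverge_stripTrace hε₀ hγ hB) valL (hΩ.tracesConverge_valL hε₀ hV) hf hg Λ u₀
    hu₀ R hRL hLR
  refine ⟨ε₁, hε₁, δ, hδ, u, fun ε hε => ?_, hlim⟩
  rw [concSolutions_eq hf hg hΛ hε.1]
  exact hu ε hε

/-- Precompactness of the set of solutions of the limit problem. -/
theorem totallyBounded_limSolutions (hΩ : IsSmoothBoundedDomain Ω)
    (hf : IsC2Bounded f K) (hg : IsC2Bounded g K')
    (hΛ : ∀ u p, Λ u p = Lam a u p) {c : ℝ} (hc : 0 < c) (hco : ∀ u, c * ‖u‖ ^ 2 ≤ Λ u u) :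
    TotallyBounded (limSolutions Ω a f g) := by
  have := hΩ.isFiniteMeasure_surface
  have := hΩ.isFiniteMeasure_restrict
  obtain ⟨C, -, ε₀, -, -, hγ, -⟩ := hΩ.exists_isTrace
  rw [limSolutions_eq hf hg hΛ]
  refine totallyBounded_solutions trace valL hγ.nonneg hγ.norm_sq_le (fun η hη => ?_) hf hg Λ hc hco
  obtain ⟨T, hTf, hT⟩ := hΩ.exists_finite_net hη
  refine ⟨toH1 '' T, hTf.image _, fun u hu => ?_⟩
  obtain ⟨φ, hφ, -, h⟩ := hT u hu
  exact ⟨_, mem_image_of_mem _ hφ, h⟩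

end IsSmoothBoundedDomain

end Concentrated

end

theorem theorem5p5
    (Ω : Set Concentrated.E3) (hΩ : Concentrated.IsSmoothBoundedDomain Ω)
    (a : Concentrated.E3 → ℝ) (ha : ContDiffOn ℝ 1 a (closure Ω))
    (a₀ a₁ : ℝ) (ha₀ : 0 < a₀) (hbound : ∀ x ∈ closure Ω, a₀ ≤ a x ∧ a x ≤ a₁)
    (f g : ℝ → ℝ) (hf : Concentrated.IsAdmissible f) (hg : Concentrated.IsAdmissible g)
    (u₀ : Concentrated.H1 Ω) (hu₀ : u₀ ∈ Concentrated.limSolutions Ω a f g)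
    (hspec : (0 : ℝ) ∉ Concentrated.opSpectrum (Concentrated.linearization a f g u₀)) :
    (∃ ε₀ > (0 : ℝ), ∃ δ > (0 : ℝ), ∃ u : ℝ → Concentrated.H1 Ω,
      (∀ ε ∈ Ioc 0 ε₀,
        Concentrated.concSolutions Ω a f g ε ∩ {v | ‖v - u₀‖ ≤ δ} = {u ε}) ∧
      Tendsto u (𝓝[>] 0) (𝓝 u₀)) ∧
    ((∀ v ∈ Concentrated.limSolutions Ω a f g,
        (0 : ℝ) ∉ Concentrated.opSpectrum (Concentrated.linearization a f g v)) →
      Concentrated.LowerSemicontinuousAtZero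
        (Concentrated.concSolutions Ω a f g) (Concentrated.limSolutions Ω a f g)) := by
  obtain ⟨K, hK⟩ := hf.exists_isC2Bounded
  obtain ⟨K', hK'⟩ := hg.exists_isC2Bounded
  have hm := hΩ.isOpen.measurableSet
  have ham : AEStronglyMeasurable a (volume.restrict Ω) :=
    (ha.continuousOn.mono subset_closure).aestronglyMeasurable hm
  obtain ⟨Λ, hΛ, hco⟩ := Concentrated.exists_LamL ham ha₀
    ((ae_restrict_mem hm).mono fun x hx => hbound x (subset_closure hx))
  refine ⟨hΩ.exists_unique_solution hK hK' hΛ hu₀ hspec, fun h => ?_⟩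
  refine Concentrated.lowerSemicontinuousAtZero_of_totallyBounded
    (hΩ.totallyBounded_limSolutions hK hK' hΛ (lt_min ha₀ one_pos) hco) fun v hv => ?_
  obtain ⟨ε₁, hε₁, δ, -, u, hu, hlim⟩ := hΩ.exists_unique_solution hK hK' hΛ hv (h v hv)
  refine ⟨u, ?_, hlim⟩
  filter_upwards [Ioc_mem_nhdsGT hε₁] with ε hε
  exact (singleton_subset_iff.1 (hu ε hε).symm.subset).1
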